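/- Let $N>2$, let $V$ be a finite-dimensional real vector space, and for multi-indices $I=(j_1,\dots,j_N)\in\mathbb Z_{\ge0}^N$ write $\varphi_I=\partial^{|I|}\varphi/(\partial\xi_1)^{j_1}\cdots(\partial\xi_N)^{j_N}$ for a $V$-valued field $\varphi(\xi_1,\dots,\xi_N)$. Let $\mathsf L=\sum_{i<j}\mathscr L_{(ij)}\,d\xi_i\wedge d\xi_j$ be a Lagrangian 2-form: each $\mathscr L_{(ij)}=-\mathscr L_{(ji)}$ is a real- or complex-valued smooth function, on an open set of jets, of $\xi$ and of finitely many of the variables $\varphi_I$. Let $D_i=\partial_{\xi_i}+\sum_I\varphi_{I\xi_i}\,\partial/\partial\varphi_I$ be the total derivative, where $I\xi_i=I+e_i$ with $e_i$ the $i$-th unit multi-index, and put $$d\mathsf L=\sum_{i<j<k}\bigl(D_i\mathscr L_{(jk)}+D_j\mathscr L_{(ki)}+D_k\mathscr L_{(ij)}\bigr)\,d\xi_i\wedge d\xi_j\wedge d\xi_k,\qquad \delta d\mathsf L=\sum_I\frac{\partial\, d\mathsf L}{\partial\varphi_I}\,\delta\varphi_I,$$ $$\frac{\delta\mathscr L_{(ij)}}{\delta\varphi_I}=\sum_{\alpha,\beta\ge0}(-1)^{\alpha+\beta}D_i^\alpha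 D_j^\beta\frac{\partial\mathscr L_{(ij)}}{\partial\varphi_{I+\alpha e_i+\beta e_j}},$$ the last expression being $0$ by convention if $I$ has a negative entry. Let $\varphi$ be a smooth field on an open set $U\subseteq\mathbb R^N$ whose jets lie in the domain of $\mathsf L$. The following are equivalent: 1. for every compact oriented (piecewise smooth) surface $\sigma$ in $U$, the action $\int_\sigma\mathsf L$ is stationary at $\varphi$ with respect to all smooth variations of the field that vanish near the boundary of $\sigma$ (all smooth variations, if $\sigma$ is closed); 2. for all pairwise distinct $i,j,k$ and every three-dimensional closed ball $B\subset U$ parallel to the $(\xi_i,\xi_j,\xi_k)$-coordinate space, $\oint_{\partial B}\mathsf L$ is stationary at $\varphi$ with respect to all smooth variations of the field; 3. $\delta d\mathsf L=0$ along $\varphi$ on $U$, i.e. the coefficient of every $\delta\varphi_I$ in every component of $d\mathsf L$ vanishes on the jets of $\varphi$; 4. $\varphi$ satisfies on $U$ the multiform Euler–Lagrange equations $$\frac{\delta\mathscr L_{(ij)}}{\delta\varphi_{I-e_k}}+\frac{\delta\mathscr L_{(jk)}}{\delta\varphi_{I-e_i}}+\frac{\delta\mathscr L_{(ki)}}{\delta\varphi_{I-e_j}}=0$$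 for all pairwise distinct $i,j,k$ and all multi-indices $I$. If $l,m,n\ge0$ are the entries of $I$ in the directions $i,j,k$ and its other entries (there are none for $N=3$) are zero, the equation in 4 reads $\dfrac{\delta\mathscr L_{(ij)}}{\delta\varphi_{i^lj^mk^{n-1}}}+\dfrac{\delta\mathscr L_{(jk)}}{\delta\varphi_{i^{l-1}j^mk^n}}+\dfrac{\delta\mathscr L_{(ki)}}{\delta\varphi_{i^lj^{m-1}k^n}}=0$. -/

import Mathlib

open scoped ContDiff Topology

namespace Multiform

noncomputable section

/-- The space of independent variables `ξ = (ξ_1, …, ξ_N)`. -/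
abbrev Pt (N : ℕ) := Fin N → ℝ

/-- Multi-indices `I = (j_1, …, j_N)`. -/
abbrev MultiIdx (N : ℕ) := Fin N → ℕ

/-- The multi-index with a single entry `1`, in direction `i`; thus `I + unit i` is `I ξ_i`. -/
def unit {N : ℕ} (i : Fin N) : MultiIdx N := Pi.single i 1

/-- Points of the infinite jet fibre: one value `u I ∈ V` for every jet coordinate `φ_I`.
`V` is the space in which the (multi-component) field takes its values. -/
abbrev Jet (N : ℕ) (V : Type*) := MultiIdx N → V

/-- Functions of the independent variables and of the jet coordinates. -/
abbrev DiffFun (N : ℕ) (V 𝕜 : Type*) := Pt N → Jet N V → 𝕜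

section Calculus

variable {N : ℕ} {V 𝕜 : Type*} [NormedAddCommGroup V] [NormedSpace ℝ V] [RCLike 𝕜]

/-- `f` is, on the set `𝒟` of jets, a smooth function of `ξ` and of finitely many of the
jet coordinates `φ_I`. -/
def SmoothOn (f : DiffFun N V 𝕜) (𝒟 : Set (Pt N × Jet N V)) : Prop :=
  ∃ (S : Finset (MultiIdx N)) (W : Set (Pt N × (S → V))) (F : Pt N × (S → V) → 𝕜),
    IsOpen W ∧ ContDiffOn ℝ ∞ F W ∧
      ∀ x u, (x, u) ∈ 𝒟 →
        (x, fun I : S => u I) ∈ W ∧ f x u = F (x, fun I : S => u I)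

/-- The partial derivative `∂f/∂φ_I`, applied to `v ∈ V` (for `v` the `α`-th basis vector, this
is the partial derivative with respect to the `α`-th component of `φ_I`). -/
def pdJet (I : MultiIdx N) (v : V) (f : DiffFun N V 𝕜) : DiffFun N V 𝕜 := fun x u =>
  deriv (fun t : ℝ => f x (Function.update u I (u I + t • v))) 0

/-- The explicit partial derivative `∂f/∂ξ_i`. -/
def pdBase (i : Fin N) (f : DiffFun N V 𝕜) : DiffFun N V 𝕜 := fun x u =>
  deriv (fun t : ℝ => f (x + t • Pi.single i 1) u) 0

/-- The total derivative `D_i f = ∂f/∂ξ_i + ∑_I φ_{Iξ_i} ∂f/∂φ_I`. -/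
def totalD (i : Fin N) (f : DiffFun N V 𝕜) : DiffFun N V 𝕜 := fun x u =>
  pdBase i f x u + ∑ᶠ I : MultiIdx N, pdJet I (u (I + unit i)) f x u

/-- The vertical differential `δf = ∑_I (∂f/∂φ_I) δφ_I`, with `w I` in place of `δφ_I`. -/
def vertD (f : DiffFun N V 𝕜) (x : Pt N) (u w : Jet N V) : 𝕜 :=
  ∑ᶠ I : MultiIdx N, pdJet I (w I) f x u

/-- The variational derivative in the `(ξ_i, ξ_j)`-plane,
`δf/δφ_I = ∑_{a,b ≥ 0} (-1)^{a+b} D_i^a D_j^b ∂f/∂φ_{I i^a j^b}`, applied to `v ∈ V`. -/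
def varDeriv (i j : Fin N) (I : MultiIdx N) (v : V) (f : DiffFun N V 𝕜) : DiffFun N V 𝕜 :=
  fun x u => ∑ᶠ p : ℕ × ℕ, (-1 : 𝕜) ^ (p.1 + p.2) *
    ((totalD i)^[p.1] ((totalD j)^[p.2]
      (pdJet (I + p.1 • unit i + p.2 • unit j) v f))) x u

/-- The variational derivative with respect to `φ_{I - k}`, the index of `ξ_k` in `I` being
lowered by one; it is zero when that index would become negative. -/
def varDerivLower (i j k : Fin N) (I : MultiIdx N) (v : V) (f : DiffFun N V 𝕜) :
    DiffFun N V 𝕜 :=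
  if I k = 0 then 0 else varDeriv i j (I - unit k) v f

/-- The partial derivative `∂φ/∂ξ_i` of a field. -/
def pd (i : Fin N) (φ : Pt N → V) : Pt N → V := fun x => fderiv ℝ φ x (Pi.single i 1)

/-- The derivative `φ_I = ∂^{|I|} φ / (∂ξ_1)^{j_1} ⋯ (∂ξ_N)^{j_N}` of a field. -/
def pdMulti (I : MultiIdx N) (φ : Pt N → V) : Pt N → V :=
  (List.finRange N).foldr (fun i g => (pd i)^[I i] g) φ

/-- The infinite jet of a field at a point. -/
def jet (φ : Pt N → V) (x : Pt N) : Jet N V := fun I => pdMulti I φ x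

end Calculus

/-- A Lagrangian 2-form `L = ∑_{i<j} L_(ij) dξ_i ∧ dξ_j` whose components are smooth functions of
`ξ` and finitely many `φ_I`, defined on the set `𝒟` of jets; as usual `L_(ji) = -L_(ij)`. -/
structure LagrangianTwoForm (N : ℕ) (V 𝕜 : Type*) [NormedAddCommGroup V] [NormedSpace ℝ V]
    [RCLike 𝕜] (𝒟 : Set (Pt N × Jet N V)) where
  comp : Fin N → Fin N → DiffFun N V 𝕜
  antisymm : ∀ i j, comp j i = -comp i j
  smooth : ∀ i j, SmoothOn (comp i j) 𝒟

/-- The four sides of the unit square, traversed counterclockwise. -/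
def side : Fin 4 → ℝ → ℝ × ℝ
  | 0, t => (t, 0)
  | 1, t => (1, t)
  | 2, t => (1 - t, 1)
  | 3, t => (0, 1 - t)

/-- A compact oriented (piecewise smooth) surface in `U`, cut into finitely many smoothly
parametrized squares. Sides that are not free are glued in pairs with opposite orientations
(a side may be folded onto itself); the free sides form the boundary of the surface. -/
structure Surface {N : ℕ} (U : Set (Pt N)) where
  faces : ℕ
  patch : Fin faces → ℝ × ℝ → Pt N
  smooth : ∀ f, ContDiff ℝ ∞ (patch f)
  mem : ∀ f, ∀ s ∈ Set.Icc (0 : ℝ) 1, ∀ t ∈ Set.Icc (0 : ℝ) 1, patch f (s, t) ∈ U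
  free : Set (Fin faces × Fin 4)
  glue : Fin faces × Fin 4 → Fin faces × Fin 4
  glue_invol : Function.Involutive glue
  glue_free : ∀ e ∈ free, glue e = e
  glue_edge : ∀ e ∉ free, ∀ t ∈ Set.Icc (0 : ℝ) 1,
    patch (glue e).1 (side (glue e).2 t) = patch e.1 (side e.2 (1 - t))

/-- The round sphere with centre `c` and radius `r` in the `(ξ_i, ξ_j, ξ_k)`-space through `c`,
in spherical coordinates scaled to the unit square. -/
def spherePatch {N : ℕ} (i j k : Fin N) (c : Pt N) (r : ℝ) : ℝ × ℝ → Pt N := fun p =>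
  c + (r * Real.sin (Real.pi * p.1) * Real.cos (2 * Real.pi * p.2)) • Pi.single i 1
    + (r * Real.sin (Real.pi * p.1) * Real.sin (2 * Real.pi * p.2)) • Pi.single j 1
    + (r * Real.cos (Real.pi * p.1)) • Pi.single k 1

/-- The solid closed three-dimensional ball bounded by that sphere. -/
def ball3 {N : ℕ} (i j k : Fin N) (c : Pt N) (r : ℝ) : Set (Pt N) :=
  {x | ∃ a b d : ℝ, a ^ 2 + b ^ 2 + d ^ 2 ≤ r ^ 2 ∧
    x = c + a • Pi.single i 1 + b • Pi.single j 1 + d • Pi.single k 1}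

section Multiforms

variable {N : ℕ} {V 𝕜 : Type*} [NormedAddCommGroup V] [NormedSpace ℝ V] [RCLike 𝕜]
  {𝒟 : Set (Pt N × Jet N V)}

/-- The integral of `L`, evaluated on the field `φ`, over one parametrized square `σ`. -/
def patchAction (L : LagrangianTwoForm N V 𝕜 𝒟) (φ : Pt N → V) (σ : ℝ × ℝ → Pt N) : 𝕜 :=
  ∫ s in (0 : ℝ)..1, ∫ t in (0 : ℝ)..1, ∑ i : Fin N, ∑ j ∈ Finset.Ioi i,
    (deriv (fun s' => σ (s', t) i) s * deriv (fun t' => σ (s, t') j) t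
      - deriv (fun s' => σ (s', t) j) s * deriv (fun t' => σ (s, t') i) t) •
        L.comp i j (σ (s, t)) (jet φ (σ (s, t)))

/-- The action `∫_σ L` as a functional of the field and of the surface. -/
def action {U : Set (Pt N)} (L : LagrangianTwoForm N V 𝕜 𝒟) (φ : Pt N → V) (σ : Surface U) : 𝕜 :=
  ∑ f, patchAction L φ (σ.patch f)

/-- The action is stationary at `φ` on every surface in `U`, with respect to all smooth variations
that vanish near the boundary of the surface (all smooth variations, if the surface is closed). -/
def StationaryOnSurfaces (L : LagrangianTwoForm N V 𝕜 𝒟) (U : Set (Pt N)) (φ : Pt N → V) : Prop :=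
  ∀ (σ : Surface U) (η : Pt N → V), ContDiffOn ℝ ∞ η U →
    (∀ e ∈ σ.free, ∀ t ∈ Set.Icc (0 : ℝ) 1, η =ᶠ[𝓝 (σ.patch e.1 (side e.2 t))] 0) →
    HasDerivAt (fun ε : ℝ => action L (φ + ε • η) σ) 0 0

/-- The action is stationary at `φ` on the boundary sphere of every three-dimensional ball in `U`
(parallel to three of the coordinate axes), with respect to all smooth variations. -/
def StationaryOnSpheres (L : LagrangianTwoForm N V 𝕜 𝒟) (U : Set (Pt N)) (φ : Pt N → V) : Prop :=
  ∀ i j k : Fin N, i ≠ j → j ≠ k → k ≠ i → ∀ (c : Pt N) (r : ℝ), 0 < r → ball3 i j k c r ⊆ U →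
    ∀ η : Pt N → V, ContDiffOn ℝ ∞ η U →
      HasDerivAt (fun ε : ℝ => patchAction L (φ + ε • η) (spherePatch i j k c r)) 0 0

/-- The coefficient of `dξ_i ∧ dξ_j ∧ dξ_k` in `dL`. -/
def dComp (L : LagrangianTwoForm N V 𝕜 𝒟) (i j k : Fin N) : DiffFun N V 𝕜 :=
  totalD i (L.comp j k) + totalD j (L.comp k i) + totalD k (L.comp i j)

/-- `δ dL = 0` at the field `φ` on `U`: the vertical differential of every coefficient of `dL`
vanishes at the jets of `φ`. -/
def DeltaDVanishes (L : LagrangianTwoForm N V 𝕜 𝒟) (U : Set (Pt N)) (φ : Pt N → V) : Prop :=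
  ∀ x ∈ U, ∀ i j k : Fin N, i < j → j < k → ∀ w : Jet N V, vertD (dComp L i j k) x (jet φ x) w = 0

/-- The multiform Euler–Lagrange equations for `φ` on `U`. The entries of `I` in the directions
`i, j, k` are `l, m, n ≥ 0`; for `N = 3` there are no further entries. -/
def MultiformEL (L : LagrangianTwoForm N V 𝕜 𝒟) (U : Set (Pt N)) (φ : Pt N → V) : Prop :=
  ∀ x ∈ U, ∀ i j k : Fin N, i ≠ j → j ≠ k → k ≠ i → ∀ (I : MultiIdx N) (v : V),
    varDerivLower i j k I v (L.comp i j) x (jet φ x)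
      + varDerivLower j k i I v (L.comp j k) x (jet φ x)
      + varDerivLower k i j I v (L.comp k i) x (jet φ x) = 0

end Multiforms

end

end Multiform

namespace Multiform

noncomputable section

/-! ### Partial derivatives and jets of fields; Taylor monomials. -/

section Fields

/-! For a variation η, let ω_η be the two-form along φ whose components are δL_(ij) evaluated on the
jet of η (`varForm`). The first variation of the action over a surface is the integral of ω_η
(`hasDerivAt_patchAction`). Since δ commutes with total derivatives along a field, dω_η is δdL
evaluated on the jet of η (`extD_varForm_single`). Thus 3 makes every ω_η closed, while 1 and 2 say
that integrals of ω_η vanish.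

1 ⇒ 2: a coordinate sphere is a single glued square without boundary.

2 ⇒ 3: differentiating the integral of ω_η over a sphere with respect to the radius gives a weighted
mean of dω_η over that sphere, and letting the radius tend to 0 gives dω_η at the centre
(`extD_eq_zero_of_integral_sphere`). A cut-off Taylor monomial as η has a jet with one prescribed
nonzero coordinate there (`jet_taylorMono`), so each coefficient of δdL vanishes separately.

3 ⇒ 1: a partition of unity splits η into pieces supported in small balls. If η vanishes near the
centre of the ball, the piece is zero. Otherwise the centre p is off the boundary of σ, and σ is
translated in a direction v. The integral of the closed form changes only by fluxes through the
moving edges: glued edges cancel, and the free edges never meet the support. After a long enough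
translation σ itself misses the support, so the integral was zero all along
(`Surface.exists_ball_sum_squareIntegral_eq_zero`). A suitable v exists because the cone over the
edges with apex p has dimension at most 2 < N.

3 ⇔ 4 is algebra on families (a_I) of functions on U. Write S_i for the shift a_I ↦ a_{I+i} and T_i
for a_I ↦ a_{I-i}, so S_i T_i = 1. For a_I = ∂f/∂φ_I, the coefficients of δ(D_i f) are (D_i + T_i)a
= (1 + D_i S_i) T_i a, and the variational derivatives in the (i,j)-plane are P_i P_j a, where P_i =
(1 + D_i S_i)⁻¹ is a Neumann series that terminates on the families at hand. Applying the injective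
operator P_i P_j P_k to the coefficients of δdL yields exactly the left side of the multiform
Euler–Lagrange equations (`cyclic_closed_iff`). -/

theorem two_le_infty : (2 : WithTop ℕ∞) ≤ ∞ :=
  WithTop.coe_le_coe.2 (le_top : (2 : ℕ∞) ≤ ⊤)

variable {N : ℕ} {E : Type*} [NormedAddCommGroup E] [NormedSpace ℝ E] {U : Set (Pt N)}

theorem contDiffOn_pd (hU : IsOpen U) {φ : Pt N → E} (hφ : ContDiffOn ℝ ∞ φ U) (i : Fin N) :
    ContDiffOn ℝ ∞ (pd i φ) U :=
  (hφ.fderiv_of_isOpen hU (by simp)).clm_apply contDiffOn_const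

theorem contDiffOn_pd_iterate (hU : IsOpen U) {φ : Pt N → E} (hφ : ContDiffOn ℝ ∞ φ U) (i : Fin N)
    (n : ℕ) : ContDiffOn ℝ ∞ ((pd i)^[n] φ) U := by
  induction n with
  | zero => exact hφ
  | succ n ih => rw [Function.iterate_succ_apply']; exact contDiffOn_pd hU ih i

/-- The part of `pdMulti` that differentiates in the directions of a list. -/
def pdList (l : List (Fin N)) (I : MultiIdx N) (φ : Pt N → E) : Pt N → E :=
  l.foldr (fun i g => (pd i)^[I i] g) φ

theorem pdMulti_eq_pdList (I : MultiIdx N) (φ : Pt N → E) :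
    pdMulti I φ = pdList (List.finRange N) I φ := rfl

theorem pdList_cons (i : Fin N) (l : List (Fin N)) (I : MultiIdx N) (φ : Pt N → E) :
    pdList (i :: l) I φ = (pd i)^[I i] (pdList l I φ) := rfl

theorem contDiffOn_pdList (hU : IsOpen U) {φ : Pt N → E} (hφ : ContDiffOn ℝ ∞ φ U)
    (l : List (Fin N)) (I : MultiIdx N) : ContDiffOn ℝ ∞ (pdList l I φ) U := by
  induction l with
  | nil => exact hφ
  | cons i l ih => rw [pdList_cons]; exact contDiffOn_pd_iterate hU ih i _

theorem contDiffOn_pdMulti (hU : IsOpen U) {φ : Pt N → E} (hφ : ContDiffOn ℝ ∞ φ U)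
    (I : MultiIdx N) : ContDiffOn ℝ ∞ (pdMulti I φ) U :=
  contDiffOn_pdList hU hφ _ I

theorem pd_eqOn (hU : IsOpen U) {φ ψ : Pt N → E} (h : Set.EqOn φ ψ U) (i : Fin N) :
    Set.EqOn (pd i φ) (pd i ψ) U := fun x hx => by
  have : φ =ᶠ[𝓝 x] ψ := by filter_upwards [hU.mem_nhds hx] with y hy using h hy
  simp only [pd, this.fderiv_eq]

theorem pd_iterate_eqOn (hU : IsOpen U) {φ ψ : Pt N → E} (h : Set.EqOn φ ψ U) (i : Fin N)
    (n : ℕ) : Set.EqOn ((pd i)^[n] φ) ((pd i)^[n] ψ) U := by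
  induction n with
  | zero => exact h
  | succ n ih =>
    rw [Function.iterate_succ_apply', Function.iterate_succ_apply']; exact pd_eqOn hU ih i

theorem pdList_eqOn (hU : IsOpen U) {φ ψ : Pt N → E} (h : Set.EqOn φ ψ U) (l : List (Fin N))
    (I : MultiIdx N) : Set.EqOn (pdList l I φ) (pdList l I ψ) U := by
  induction l with
  | nil => exact h
  | cons i l ih => exact pd_iterate_eqOn hU ih i _

/-- Jets depend only on germs; this is why all cutoffs below are controlled on neighbourhoods and
not just pointwise. -/
theorem jet_congr {φ ψ : Pt N → E} {x : Pt N} (h : φ =ᶠ[𝓝 x] ψ) : jet φ x = jet ψ x := by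
  obtain ⟨O, hO, hOo, hx⟩ := mem_nhds_iff.1 h
  exact funext fun I => pdList_eqOn hOo (fun y hy => hO hy) _ I hx

theorem pd_comm (hU : IsOpen U) {φ : Pt N → E} (hφ : ContDiffOn ℝ ∞ φ U) (i j : Fin N) :
    Set.EqOn (pd i (pd j φ)) (pd j (pd i φ)) U := fun x hx => by
  have hc : ContDiffAt ℝ ∞ φ x := hφ.contDiffAt (hU.mem_nhds hx)
  have hd : DifferentiableAt ℝ (fderiv ℝ φ) x :=
    (hc.fderiv_right (m := 1) (by rw [one_add_one_eq_two]; exact two_le_infty)).differentiableAt (by simp)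
  have hs : IsSymmSndFDerivAt ℝ φ x := hc.isSymmSndFDerivAt (by simpa using two_le_infty)
  have key : ∀ a b : Fin N, pd a (pd b φ) x
      = fderiv ℝ (fderiv ℝ φ) x (Pi.single a 1) (Pi.single b 1) := fun a b => by
    change fderiv ℝ (fun y => fderiv ℝ φ y (Pi.single b 1)) x (Pi.single a 1) = _
    rw [fderiv_clm_apply hd (differentiableAt_const _)]
    simp
  rw [key, key, hs.eq]

theorem pd_iterate_comm (hU : IsOpen U) {φ : Pt N → E} (hφ : ContDiffOn ℝ ∞ φ U) (i j : Fin N)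
    (n : ℕ) : Set.EqOn ((pd i)^[n] (pd j φ)) (pd j ((pd i)^[n] φ)) U := by
  induction n with
  | zero => exact fun _ _ => rfl
  | succ n ih =>
    rw [Function.iterate_succ_apply', Function.iterate_succ_apply']
    exact (pd_eqOn hU ih i).trans (pd_comm hU (contDiffOn_pd_iterate hU hφ i n) i j)

theorem pdList_add_unit_of_notMem {l : List (Fin N)} {i : Fin N} (hi : i ∉ l) (I : MultiIdx N)
    (φ : Pt N → E) : pdList l (I + unit i) φ = pdList l I φ := by
  induction l with
  | nil => rfl
  | cons j l ih =>
    rw [List.mem_cons, not_or] at hi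
    rw [pdList_cons, pdList_cons, ih hi.2]
    simp [unit, Ne.symm hi.1]

/-- The extra derivative enters at the single place where `i` occurs in the list, and is carried
outwards past the other derivatives by symmetry of second derivatives. -/
theorem pdList_add_unit (hU : IsOpen U) {φ : Pt N → E} (hφ : ContDiffOn ℝ ∞ φ U)
    {l : List (Fin N)} (hl : l.Nodup) {i : Fin N} (hi : i ∈ l) (I : MultiIdx N) :
    Set.EqOn (pdList l (I + unit i) φ) (pd i (pdList l I φ)) U := by
  induction l with
  | nil => simp at hi
  | cons j l ih =>
    rw [List.nodup_cons] at hl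
    rw [pdList_cons, pdList_cons]
    by_cases hij : i = j
    · subst hij
      rw [pdList_add_unit_of_notMem hl.1]
      simp only [Pi.add_apply, unit, Pi.single_eq_same, Function.iterate_succ_apply']
      exact fun _ _ => rfl
    · have hi' : i ∈ l := (List.mem_cons.1 hi).resolve_left hij
      have : (I + unit i) j = I j := by simp [unit, Ne.symm hij]
      rw [this]
      exact (pd_iterate_eqOn hU (ih hl.2 hi') j _).trans
        (pd_iterate_comm hU (contDiffOn_pdList hU hφ l I) j i _)

theorem pdMulti_add_unit (hU : IsOpen U) {φ : Pt N → E} (hφ : ContDiffOn ℝ ∞ φ U)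
    (I : MultiIdx N) (i : Fin N) :
    Set.EqOn (pdMulti (I + unit i) φ) (pd i (pdMulti I φ)) U :=
  pdList_add_unit hU hφ (List.nodup_finRange N) (List.mem_finRange i) I

theorem pd_add_smul {φ ψ : Pt N → E} {x : Pt N} (hφ : DifferentiableAt ℝ φ x)
    (hψ : DifferentiableAt ℝ ψ x) (c : ℝ) (i : Fin N) :
    pd i (φ + c • ψ) x = pd i φ x + c • pd i ψ x := by
  simp only [pd]
  rw [fderiv_add hφ (hψ.const_smul c), fderiv_const_smul hψ]
  rfl

theorem pdList_add_smul (hU : IsOpen U) {φ ψ : Pt N → E} (hφ : ContDiffOn ℝ ∞ φ U)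
    (hψ : ContDiffOn ℝ ∞ ψ U) (c : ℝ) (l : List (Fin N)) (I : MultiIdx N) :
    Set.EqOn (pdList l I (φ + c • ψ)) (pdList l I φ + c • pdList l I ψ) U := by
  induction l with
  | nil => exact fun _ _ => rfl
  | cons i l ih =>
    have key : ∀ n, Set.EqOn ((pd i)^[n] (pdList l I (φ + c • ψ)))
        ((pd i)^[n] (pdList l I φ) + c • (pd i)^[n] (pdList l I ψ)) U := by
      intro n
      induction n with
      | zero => exact ih
      | succ n ihn =>
        simp only [Function.iterate_succ_apply']
        refine (pd_eqOn hU ihn i).trans fun x hx => ?_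
        have h1 := contDiffOn_pd_iterate hU (contDiffOn_pdList hU hφ l I) i n
        have h2 := contDiffOn_pd_iterate hU (contDiffOn_pdList hU hψ l I) i n
        exact pd_add_smul
          ((h1.contDiffAt (hU.mem_nhds hx)).differentiableAt (by simp))
          ((h2.contDiffAt (hU.mem_nhds hx)).differentiableAt (by simp)) c i
    exact key _

theorem jet_add_smul (hU : IsOpen U) {φ ψ : Pt N → E} (hφ : ContDiffOn ℝ ∞ φ U)
    (hψ : ContDiffOn ℝ ∞ ψ U) (c : ℝ) {x : Pt N} (hx : x ∈ U) :
    jet (φ + c • ψ) x = jet φ x + c • jet ψ x :=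
  funext fun I => pdList_add_smul hU hφ hψ c _ I hx

theorem jet_zero (x : Pt N) : jet (0 : Pt N → E) x = 0 := by
  have := jet_add_smul (x := x) isOpen_univ (φ := (0 : Pt N → E)) (ψ := 0) contDiffOn_const
    contDiffOn_const 1 trivial
  simpa using this

theorem jet_sum (hU : IsOpen U) {ι : Type*} (s : Finset ι) {φ : ι → Pt N → E}
    (hφ : ∀ a ∈ s, ContDiffOn ℝ ∞ (φ a) U) {x : Pt N} (hx : x ∈ U) :
    jet (∑ a ∈ s, φ a) x = ∑ a ∈ s, jet (φ a) x := by
  classical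
  induction s using Finset.induction_on with
  | empty => simpa using jet_zero x
  | insert a s ha ih =>
    have h1 := hφ a (Finset.mem_insert_self a s)
    have h2 : ∀ b ∈ s, ContDiffOn ℝ ∞ (φ b) U := fun b hb => hφ b (Finset.mem_insert_of_mem hb)
    rw [Finset.sum_insert ha, Finset.sum_insert ha, ← ih h2]
    have h3 : ContDiffOn ℝ ∞ (∑ b ∈ s, φ b) U := by
      have := ContDiffOn.sum h2
      convert this using 1
      ext y; simp
    simpa using jet_add_smul hU h1 h3 1 hx

theorem continuousOn_jet (hU : IsOpen U) {φ : Pt N → E} (hφ : ContDiffOn ℝ ∞ φ U) :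
    ContinuousOn (jet φ) U :=
  continuousOn_pi.2 fun I => (contDiffOn_pdMulti hU hφ I).continuousOn

/-- The Taylor monomial `(y - x)^I / I!` with coefficient `v`. -/
def taylorMono (x : Pt N) (I : MultiIdx N) (v : E) : Pt N → E := fun y =>
  (∏ i, (y i - x i) ^ I i / (Nat.factorial (I i) : ℝ)) • v

theorem contDiff_taylorMono (x : Pt N) (I : MultiIdx N) (v : E) :
    ContDiff ℝ ∞ (taylorMono x I v) := by
  refine ContDiff.smul (contDiff_prod fun i _ => ?_) contDiff_const
  exact (((contDiff_apply ℝ ℝ i).sub contDiff_const).pow _).div_const _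

theorem pd_apply_eq_deriv {φ : Pt N → E} {x : Pt N} (h : DifferentiableAt ℝ φ x) (i : Fin N) :
    pd i φ x = deriv (fun t : ℝ => φ (Function.update x i t)) (x i) := by
  have h2 : HasDerivAt (Function.update x i) (Pi.single i (1 : ℝ)) (x i) := hasDerivAt_update x i _
  have h1 : HasFDerivAt φ (fderiv ℝ φ x) (Function.update x i (x i)) := by
    rw [Function.update_eq_self]; exact h.hasFDerivAt
  exact (h1.comp_hasDerivAt (x i) h2).deriv.symm

theorem pd_taylorMono_succ (x : Pt N) (I : MultiIdx N) (v : E) (i : Fin N) :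
    pd i (taylorMono x (I + unit i) v) = taylorMono x I v := by
  funext y
  rw [pd_apply_eq_deriv ((contDiff_taylorMono x _ v).differentiable (by simp) y)]
  simp only [taylorMono]
  have h : ∀ (J : MultiIdx N) (t : ℝ),
      (∏ k, (Function.update y i t k - x k) ^ J k / (Nat.factorial (J k) : ℝ)) =
      (t - x i) ^ J i / (Nat.factorial (J i) : ℝ) *
      ∏ k ∈ Finset.univ.erase i, (y k - x k) ^ J k / (Nat.factorial (J k) : ℝ) := fun J t => by
    rw [← Finset.mul_prod_erase _ _ (Finset.mem_univ i), Function.update_self]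
    congr 1
    refine Finset.prod_congr rfl fun k hk => ?_
    rw [Function.update_of_ne (Finset.ne_of_mem_erase hk)]
  have h0 := h I (y i)
  rw [Function.update_eq_self] at h0
  simp only [h, h0]
  have hp : ∏ k ∈ Finset.univ.erase i,
      (y k - x k) ^ (I + unit i) k / (Nat.factorial ((I + unit i) k) : ℝ) =
      ∏ k ∈ Finset.univ.erase i, (y k - x k) ^ I k / (Nat.factorial (I k) : ℝ) := by
    refine Finset.prod_congr rfl fun k hk => ?_
    have : (I + unit i) k = I k := by simp [unit, Finset.ne_of_mem_erase hk]
    rw [this]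
  have hi : (I + unit i) i = I i + 1 := by simp [unit]
  rw [hp, hi]
  set P := ∏ k ∈ Finset.univ.erase i, (y k - x k) ^ I k / (Nat.factorial (I k) : ℝ)
  have hd : HasDerivAt (fun t : ℝ => ((t - x i) ^ (I i + 1) / (Nat.factorial (I i + 1) : ℝ) * P) • v)
      ((((I i + 1 : ℕ) : ℝ) * (y i - x i) ^ (I i) * 1 / (Nat.factorial (I i + 1) : ℝ) * P) • v)
      (y i) := by
    refine HasDerivAt.smul_const (HasDerivAt.mul_const (HasDerivAt.div_const ?_ _) _) _
    exact ((hasDerivAt_id (y i)).sub_const (x i)).pow (I i + 1)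
  rw [hd.deriv, Nat.factorial_succ]
  congr 2
  push_cast
  have : (Nat.factorial (I i) : ℝ) ≠ 0 := by positivity
  field_simp

theorem pd_taylorMono_zero (x : Pt N) {I : MultiIdx N} (v : E) {i : Fin N} (hI : I i = 0) :
    pd i (taylorMono x I v) = 0 := by
  funext y
  rw [pd_apply_eq_deriv ((contDiff_taylorMono x _ v).differentiable (by simp) y)]
  have : (fun t : ℝ => taylorMono x I v (Function.update y i t)) = fun _ => taylorMono x I v y := by
    funext t
    simp only [taylorMono]
    congr 1
    refine Finset.prod_congr rfl fun k _ => ?_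
    by_cases hk : k = i
    · subst hk; simp [hI]
    · rw [Function.update_of_ne hk]
  rw [this]; simp

/-- This supplies variations whose jet at a given point has a single prescribed coordinate and zeros
elsewhere. The induction is on the order of the derivative with `I` free, because each
differentiation lowers both multi-indices. -/
theorem jet_taylorMono (x : Pt N) (I : MultiIdx N) (v : E) :
    jet (taylorMono x I v) x = Pi.single I v := by
  have aux : ∀ (n : ℕ) (J I : MultiIdx N), ∑ i, J i = n →
      pdMulti J (taylorMono x I v) x = Pi.single (M := fun _ => E) I v J := by
    intro n
    induction n with
    | zero =>
      intro J I hJ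
      have hJ0 : J = 0 := by
        funext i
        exact (Finset.sum_eq_zero_iff.1 hJ) i (Finset.mem_univ i)
      subst hJ0
      have : pdMulti (0 : MultiIdx N) (taylorMono x I v) = taylorMono x I v := by
        rw [pdMulti_eq_pdList]
        generalize List.finRange N = l
        induction l with
        | nil => rfl
        | cons i l ih => rw [pdList_cons, ih]; rfl
      rw [this]
      by_cases hI : I = 0
      · subst hI; simp [taylorMono]
      · rw [Pi.single_eq_of_ne (Ne.symm hI)]
        obtain ⟨i, hi⟩ := Function.ne_iff.1 hI
        simp only [taylorMono]
        rw [Finset.prod_eq_zero (Finset.mem_univ i), zero_smul]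
        have : I i ≠ 0 := hi
        simp [this]
    | succ n ih =>
      intro J I hJ
      obtain ⟨i, hi⟩ : ∃ i, J i ≠ 0 := by
        by_contra! h
        simp [h] at hJ
      obtain ⟨J', rfl⟩ : ∃ J', J = J' + unit i := by
        refine ⟨J - unit i, funext fun k => ?_⟩
        by_cases hk : k = i
        · subst hk; simp [unit]; omega
        · simp [unit, hk]
      have hJ' : ∑ k, J' k = n := by
        have : ∑ k, (J' + unit i) k = ∑ k, J' k + 1 := by
          simp only [Pi.add_apply, Finset.sum_add_distrib, unit]
          simp
        omega
      have hs : ∀ K : MultiIdx N, ContDiffOn ℝ ∞ (taylorMono x K v) Set.univ :=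
        fun K => (contDiff_taylorMono x K v).contDiffOn
      -- One derivative is moved to the innermost position, where it acts on the monomial itself.
      have hc : pdMulti (J' + unit i) (taylorMono x I v) x
          = pdMulti J' (pd i (taylorMono x I v)) x := by
        rw [pdMulti_add_unit isOpen_univ (hs I) J' i trivial]
        rw [pdMulti_eq_pdList, pdMulti_eq_pdList]
        have : ∀ l : List (Fin N), Set.EqOn (pd i (pdList l J' (taylorMono x I v)))
            (pdList l J' (pd i (taylorMono x I v))) Set.univ := by
          intro l
          induction l with
          | nil => exact fun _ _ => rfl
          | cons k l ih' =>
            rw [pdList_cons, pdList_cons]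
            exact (pd_iterate_comm isOpen_univ (contDiffOn_pdList isOpen_univ (hs I) l J') k i
              _).symm.trans (pd_iterate_eqOn isOpen_univ ih' k _)
        exact this _ trivial
      rw [hc]
      by_cases hI : I i = 0
      · rw [pd_taylorMono_zero x v hI]
        rw [Pi.single_eq_of_ne]
        · exact congrFun (jet_zero x) J'
        · intro h
          have := congrFun h i
          simp [unit, hI] at this
      · obtain ⟨I', rfl⟩ : ∃ I', I = I' + unit i := by
          refine ⟨I - unit i, funext fun k => ?_⟩
          by_cases hk : k = i
          · subst hk; simp [unit]; omega
          · simp [unit, hk]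
        rw [pd_taylorMono_succ, ih J' I' hJ']
        simp only [Pi.single_apply, add_left_inj]
  exact funext fun J => aux _ J I rfl

end Fields

/-! ### Passing from infinite jets to finitely many coordinates. -/

section Restriction

variable {N : ℕ} {V : Type*} [NormedAddCommGroup V] {S : Finset (MultiIdx N)}

/-- Restriction of a jet to finitely many of its coordinates. -/
def restr (S : Finset (MultiIdx N)) (u : Jet N V) : S → V := fun I => u I

theorem restr_single_of_notMem {I : MultiIdx N} (hI : I ∉ S) (v : V) :
    restr S (Pi.single I v) = 0 := by
  funext J
  have : (J : MultiIdx N) ≠ I := fun h => hI (h ▸ J.2)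
  simp [restr, this]

theorem sum_restr_single (w : Jet N V) : ∑ I ∈ S, restr S (Pi.single I (w I)) = restr S w := by
  funext J
  rw [Finset.sum_apply]
  simp only [restr]
  rw [Finset.sum_eq_single (J : MultiIdx N)]
  · simp
  · intro I _ hI
    rw [Pi.single_eq_of_ne (Ne.symm hI)]
  · intro hJ
    exact absurd J.2 hJ

end Restriction

/-! ### Calculus of functions of finitely many jet coordinates. -/

section JetFunctions

variable {N : ℕ} {V 𝕜 : Type*} [NormedAddCommGroup V] [NormedSpace ℝ V] [RCLike 𝕜]
  {𝒟 : Set (Pt N × Jet N V)} {U : Set (Pt N)}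

/-- `F` expresses `f` on `𝒟` through `ξ` and the jet coordinates in `S`. -/
structure Represents (f : DiffFun N V 𝕜) (𝒟 : Set (Pt N × Jet N V)) (S : Finset (MultiIdx N))
    (W : Set (Pt N × (S → V))) (F : Pt N × (S → V) → 𝕜) : Prop where
  isOpen : IsOpen W
  contDiffOn : ContDiffOn ℝ ∞ F W
  mem : ∀ {x u}, (x, u) ∈ 𝒟 → (x, restr S u) ∈ W
  eq : ∀ {x u}, (x, u) ∈ 𝒟 → f x u = F (x, restr S u)

theorem SmoothOn.exists_represents {f : DiffFun N V 𝕜} (hf : SmoothOn f 𝒟) :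
    ∃ S W F, Represents f 𝒟 S W F := by
  obtain ⟨S, W, F, hW, hF, h⟩ := hf
  exact ⟨S, W, F, hW, hF, fun hx => (h _ _ hx).1, fun hx => (h _ _ hx).2⟩

theorem Represents.smoothOn {f : DiffFun N V 𝕜} {S : Finset (MultiIdx N)}
    {W : Set (Pt N × (S → V))} {F : Pt N × (S → V) → 𝕜} (h : Represents f 𝒟 S W F) :
    SmoothOn f 𝒟 :=
  ⟨S, W, F, h.isOpen, h.contDiffOn, fun _ _ hx => ⟨h.mem hx, h.eq hx⟩⟩

section Represents

variable {f : DiffFun N V 𝕜} {S : Finset (MultiIdx N)} {W : Set (Pt N × (S → V))}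
  {F : Pt N × (S → V) → 𝕜}

theorem Represents.contDiffAt (h : Represents f 𝒟 S W F) {x : Pt N} {u : Jet N V}
    (hx : (x, u) ∈ 𝒟) : ContDiffAt ℝ ∞ F (x, restr S u) :=
  h.contDiffOn.contDiffAt (h.isOpen.mem_nhds (h.mem hx))

/-- The infinite jet fibre is only a product space, so the chain rule is applied to `F`, which lives
on a normed space. Openness of `𝒟` makes the representation valid near the point, hence for
derivatives. -/
theorem Represents.hasFDerivAt_comp (h : Represents f 𝒟 S W F) (h𝒟 : IsOpen 𝒟) {G : Type*}
    [NormedAddCommGroup G] [NormedSpace ℝ G] {c : G → Pt N} {w : G → Jet N V} {g : G}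
    (hc : ContinuousAt c g) (hw : ContinuousAt w g) (hg : (c g, w g) ∈ 𝒟)
    {d : G →L[ℝ] Pt N × (S → V)} (hd : HasFDerivAt (fun y => (c y, restr S (w y))) d g) :
    HasFDerivAt (fun y => f (c y) (w y)) ((fderiv ℝ F (c g, restr S (w g))).comp d) g := by
  have h1 : HasFDerivAt F (fderiv ℝ F (c g, restr S (w g))) (c g, restr S (w g)) :=
    ((h.contDiffAt hg).differentiableAt (by simp)).hasFDerivAt
  refine (h1.comp g hd).congr_of_eventuallyEq ?_
  filter_upwards [(hc.prodMk hw).preimage_mem_nhds (h𝒟.mem_nhds hg)] with y hy using h.eq hy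

theorem Represents.hasDerivAt_line (h : Represents f 𝒟 S W F) (h𝒟 : IsOpen 𝒟) {x : Pt N}
    {u : Jet N V} (hx : (x, u) ∈ 𝒟) (a : Pt N) (w : Jet N V) :
    HasDerivAt (fun t : ℝ => f (x + t • a) (u + t • w))
      (fderiv ℝ F (x, restr S u) (a, restr S w)) 0 := by
  have hd : HasDerivAt (fun t : ℝ => (x + t • a, restr S (u + t • w))) (a, restr S w) 0 := by
    have : HasDerivAt (fun t : ℝ => (x, restr S u) + t • (a, restr S w)) ((1 : ℝ) • (a, restr S w))
        0 := ((hasDerivAt_id (0 : ℝ)).smul_const _).const_add _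
    rw [one_smul] at this
    exact this
  have hc : ContinuousAt (fun t : ℝ => x + t • a) 0 := by fun_prop
  have hw : ContinuousAt (fun t : ℝ => u + t • w) 0 := by fun_prop
  have := (h.hasFDerivAt_comp h𝒟 hc hw (by simpa using hx) hd.hasFDerivAt).hasDerivAt
  simpa using this

theorem update_add_smul (u : Jet N V) (I : MultiIdx N) (t : ℝ) (v : V) :
    Function.update u I (u I + t • v) = u + t • (Pi.single I v : Jet N V) := by
  classical
  funext J
  by_cases hJ : J = I
  · subst hJ; simp
  · simp [hJ]

theorem Represents.pdJet_eq (h : Represents f 𝒟 S W F) (h𝒟 : IsOpen 𝒟) {x : Pt N}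
    {u : Jet N V} (hx : (x, u) ∈ 𝒟) (I : MultiIdx N) (v : V) :
    pdJet I v f x u = fderiv ℝ F (x, restr S u) (0, restr S (Pi.single I v)) := by
  rw [← (h.hasDerivAt_line h𝒟 hx 0 (Pi.single I v)).deriv]
  simp [pdJet, update_add_smul]

theorem Represents.pdBase_eq (h : Represents f 𝒟 S W F) (h𝒟 : IsOpen 𝒟) {x : Pt N}
    {u : Jet N V} (hx : (x, u) ∈ 𝒟) (i : Fin N) :
    pdBase i f x u = fderiv ℝ F (x, restr S u) (Pi.single i 1, 0) := by
  have := (h.hasDerivAt_line h𝒟 hx (Pi.single i 1) 0).deriv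
  simp only [smul_zero, add_zero] at this
  exact this

theorem Represents.pdJet_eq_zero (h : Represents f 𝒟 S W F) (h𝒟 : IsOpen 𝒟) {x : Pt N}
    {u : Jet N V} (hx : (x, u) ∈ 𝒟) {I : MultiIdx N} (hI : I ∉ S) (v : V) :
    pdJet I v f x u = 0 := by
  rw [h.pdJet_eq h𝒟 hx, restr_single_of_notMem hI]
  exact map_zero _

theorem Represents.finsum_pdJet (h : Represents f 𝒟 S W F) (h𝒟 : IsOpen 𝒟) {x : Pt N}
    {u : Jet N V} (hx : (x, u) ∈ 𝒟) (w : Jet N V) :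
    ∑ᶠ I : MultiIdx N, pdJet I (w I) f x u = ∑ I ∈ S, pdJet I (w I) f x u := by
  refine finsum_eq_finsetSum_of_support_subset _ fun I hI => ?_
  by_contra hS
  exact hI (h.pdJet_eq_zero h𝒟 hx hS _)

theorem Represents.vertD_eq (h : Represents f 𝒟 S W F) (h𝒟 : IsOpen 𝒟) {x : Pt N}
    {u : Jet N V} (hx : (x, u) ∈ 𝒟) (w : Jet N V) :
    vertD f x u w = fderiv ℝ F (x, restr S u) (0, restr S w) := by
  rw [vertD, h.finsum_pdJet h𝒟 hx, Finset.sum_congr rfl fun I _ => h.pdJet_eq h𝒟 hx I (w I),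
    ← map_sum, ← sum_restr_single w]
  congr 1
  ext <;> simp [Prod.fst_sum, Prod.snd_sum]

theorem Represents.totalD_eq (h : Represents f 𝒟 S W F) (h𝒟 : IsOpen 𝒟) {x : Pt N}
    {u : Jet N V} (hx : (x, u) ∈ 𝒟) (i : Fin N) :
    totalD i f x u =
      fderiv ℝ F (x, restr S u) (Pi.single i 1, restr S fun I => u (I + unit i)) := by
  have := h.vertD_eq h𝒟 hx fun I => u (I + unit i)
  rw [vertD] at this
  rw [totalD, this, h.pdBase_eq h𝒟 hx, ← map_add]
  simp

theorem contDiffOn_fderiv_apply {G H K : Type*} [NormedAddCommGroup G] [NormedSpace ℝ G]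
    [NormedAddCommGroup H] [NormedSpace ℝ H] [NormedAddCommGroup K] [NormedSpace ℝ K] {F : G → K}
    {W : Set G} (hW : IsOpen W) (hF : ContDiffOn ℝ ∞ F W) {g d : H → G} {T : Set H}
    (hg : ContDiffOn ℝ ∞ g T) (hd : ContDiffOn ℝ ∞ d T) (hT : Set.MapsTo g T W) :
    ContDiffOn ℝ ∞ (fun y => fderiv ℝ F (g y) (d y)) T :=
  ((hF.fderiv_of_isOpen hW (by simp)).comp hg hT).clm_apply hd

theorem Represents.pdJet (h : Represents f 𝒟 S W F) (h𝒟 : IsOpen 𝒟) (I : MultiIdx N) (v : V) :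
    Represents (pdJet I v f) 𝒟 S W fun p => fderiv ℝ F p (0, restr S (Pi.single I v)) where
  isOpen := h.isOpen
  contDiffOn := contDiffOn_fderiv_apply h.isOpen h.contDiffOn contDiffOn_id contDiffOn_const
    fun _ hx => hx
  mem := h.mem
  eq hx := h.pdJet_eq h𝒟 hx I v

end Represents

theorem SmoothOn.pdJet {f : DiffFun N V 𝕜} (hf : SmoothOn f 𝒟) (h𝒟 : IsOpen 𝒟) (I : MultiIdx N)
    (v : V) : SmoothOn (pdJet I v f) 𝒟 := by
  obtain ⟨S, W, F, h⟩ := hf.exists_represents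
  exact (h.pdJet h𝒟 I v).smoothOn

theorem SmoothOn.totalD {f : DiffFun N V 𝕜} (hf : SmoothOn f 𝒟) (h𝒟 : IsOpen 𝒟) (i : Fin N) :
    SmoothOn (totalD i f) 𝒟 := by
  classical
  obtain ⟨S, W, F, h⟩ := hf.exists_represents
  -- A total derivative involves the old coordinates and their shifts by `i`.
  let S' : Finset (MultiIdx N) := S ∪ S.image (· + unit i)
  have h1 : ∀ I : S, (I : MultiIdx N) ∈ S' := fun I => Finset.mem_union_left _ I.2
  have h2 : ∀ I : S, (I : MultiIdx N) + unit i ∈ S' := fun I =>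
    Finset.mem_union_right _ (Finset.mem_image_of_mem _ I.2)
  let g : Pt N × (S' → V) → Pt N × (S → V) := fun p => (p.1, fun I => p.2 ⟨I, h1 I⟩)
  let d : Pt N × (S' → V) → Pt N × (S → V) := fun p =>
    (Pi.single i 1, fun I => p.2 ⟨_, h2 I⟩)
  have hg : ContDiff ℝ ∞ g := contDiff_fst.prodMk
    (contDiff_pi.2 fun I => (contDiff_apply ℝ V _).comp contDiff_snd)
  have hd : ContDiff ℝ ∞ d := contDiff_const.prodMk
    (contDiff_pi.2 fun I => (contDiff_apply ℝ V _).comp contDiff_snd)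
  have hr : Represents (Multiform.totalD i f) 𝒟 S' (g ⁻¹' W) fun p => fderiv ℝ F (g p) (d p) :=
    { isOpen := h.isOpen.preimage hg.continuous
      contDiffOn := contDiffOn_fderiv_apply h.isOpen h.contDiffOn hg.contDiffOn hd.contDiffOn
        fun _ hx => hx
      mem := fun hx => h.mem hx
      eq := fun hx => h.totalD_eq h𝒟 hx i }
  exact hr.smoothOn

theorem SmoothOn.add {f g : DiffFun N V 𝕜} (hf : SmoothOn f 𝒟) (hg : SmoothOn g 𝒟) :
    SmoothOn (f + g) 𝒟 := by
  classical
  obtain ⟨S, W, F, h⟩ := hf.exists_represents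
  obtain ⟨S', W', F', h'⟩ := hg.exists_represents
  let p : Pt N × ((S ∪ S' : Finset (MultiIdx N)) → V) → Pt N × (S → V) := fun q =>
    (q.1, fun I => q.2 ⟨I, Finset.mem_union_left _ I.2⟩)
  let p' : Pt N × ((S ∪ S' : Finset (MultiIdx N)) → V) → Pt N × (S' → V) := fun q =>
    (q.1, fun I => q.2 ⟨I, Finset.mem_union_right _ I.2⟩)
  have hp : ContDiff ℝ ∞ p := contDiff_fst.prodMk
    (contDiff_pi.2 fun I => (contDiff_apply ℝ V _).comp contDiff_snd)
  have hp' : ContDiff ℝ ∞ p' := contDiff_fst.prodMk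
    (contDiff_pi.2 fun I => (contDiff_apply ℝ V _).comp contDiff_snd)
  have hr : Represents (f + g) 𝒟 (S ∪ S') (p ⁻¹' W ∩ p' ⁻¹' W') fun q => F (p q) + F' (p' q) :=
    { isOpen := (h.isOpen.preimage hp.continuous).inter (h'.isOpen.preimage hp'.continuous)
      contDiffOn := (h.contDiffOn.comp hp.contDiffOn fun _ hx => hx.1).add
        (h'.contDiffOn.comp hp'.contDiffOn fun _ hx => hx.2)
      mem := fun hx => ⟨h.mem hx, h'.mem hx⟩
      eq := fun {x u} hx => by
        show f x u + g x u = _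
        rw [h.eq hx, h'.eq hx]; rfl }
  exact hr.smoothOn

/-- As a derivative along a line, the vertical differential no longer refers to a chosen
representation; identities for it follow from uniqueness of derivatives. -/
theorem hasDerivAt_vertD {f : DiffFun N V 𝕜} (hf : SmoothOn f 𝒟) (h𝒟 : IsOpen 𝒟) {x : Pt N}
    {u : Jet N V} (hx : (x, u) ∈ 𝒟) (w : Jet N V) :
    HasDerivAt (fun t : ℝ => f x (u + t • w)) (vertD f x u w) 0 := by
  obtain ⟨S, W, F, h⟩ := hf.exists_represents
  have := h.hasDerivAt_line h𝒟 hx 0 w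
  rw [h.vertD_eq h𝒟 hx]
  simpa using this

theorem vertD_single (f : DiffFun N V 𝕜) (x : Pt N) (u : Jet N V) (I : MultiIdx N) (v : V) :
    vertD f x u (Pi.single I v) = pdJet I v f x u := by
  rw [vertD, finsum_eq_single _ I]
  · simp
  · intro J hJ
    simp [hJ, pdJet]

theorem vertD_sum {f : DiffFun N V 𝕜} (hf : SmoothOn f 𝒟) (h𝒟 : IsOpen 𝒟) {x : Pt N}
    {u : Jet N V} (hx : (x, u) ∈ 𝒟) {ι : Type*} (s : Finset ι) (w : ι → Jet N V) :
    vertD f x u (∑ a ∈ s, w a) = ∑ a ∈ s, vertD f x u (w a) := by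
  obtain ⟨S, W, F, h⟩ := hf.exists_represents
  simp only [h.vertD_eq h𝒟 hx]
  rw [← map_sum]
  congr 1
  have : restr S (∑ a ∈ s, w a) = ∑ a ∈ s, restr S (w a) := by
    funext I; simp [restr]
  rw [this]
  ext <;> simp [Prod.fst_sum, Prod.snd_sum]

theorem vertD_zero (f : DiffFun N V 𝕜) (x : Pt N) (u : Jet N V) : vertD f x u 0 = 0 := by
  simp [vertD, pdJet]

theorem vertD_add {f g : DiffFun N V 𝕜} (hf : SmoothOn f 𝒟) (hg : SmoothOn g 𝒟) (h𝒟 : IsOpen 𝒟)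
    {x : Pt N} {u : Jet N V} (hx : (x, u) ∈ 𝒟) (w : Jet N V) :
    vertD (f + g) x u w = vertD f x u w + vertD g x u w :=
  (hasDerivAt_vertD (hf.add hg) h𝒟 hx w).unique
    ((hasDerivAt_vertD hf h𝒟 hx w).add (hasDerivAt_vertD hg h𝒟 hx w))

section AlongField

variable {φ η : Pt N → V}

theorem contDiffOn_comp_jet {f : DiffFun N V 𝕜} (hf : SmoothOn f 𝒟) (hU : IsOpen U)
    (hφ : ContDiffOn ℝ ∞ φ U) (hjet : ∀ x ∈ U, (x, jet φ x) ∈ 𝒟) :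
    ContDiffOn ℝ ∞ (fun y => f y (jet φ y)) U := by
  obtain ⟨S, W, F, h⟩ := hf.exists_represents
  have hg : ContDiffOn ℝ ∞ (fun y => (y, restr S (jet φ y))) U :=
    contDiffOn_id.prodMk (contDiffOn_pi.2 fun I => contDiffOn_pdMulti hU hφ I)
  exact (h.contDiffOn.comp hg fun x hx => h.mem (hjet x hx)).congr fun x hx => h.eq (hjet x hx)

theorem hasFDerivAt_restr_jet (hU : IsOpen U) (hφ : ContDiffOn ℝ ∞ φ U) (S : Finset (MultiIdx N))
    {x : Pt N} (hx : x ∈ U) :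
    DifferentiableAt ℝ (fun y => restr S (jet φ y)) x ∧
    ∀ i, fderiv ℝ (fun y => restr S (jet φ y)) x (Pi.single i 1) =
      restr S fun I => jet φ x (I + unit i) := by
  have hd : ∀ I : S, DifferentiableAt ℝ (fun y => restr S (jet φ y) I) x := fun I =>
    ((contDiffOn_pdMulti hU hφ I).contDiffAt (hU.mem_nhds hx)).differentiableAt (by simp)
  refine ⟨differentiableAt_pi.2 hd, fun i => funext fun I => ?_⟩
  rw [fderiv_pi hd]
  exact (pdMulti_add_unit hU hφ I i hx).symm

theorem totalD_jet {f : DiffFun N V 𝕜} (hf : SmoothOn f 𝒟) (h𝒟 : IsOpen 𝒟) (hU : IsOpen U)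
    (hφ : ContDiffOn ℝ ∞ φ U) (hjet : ∀ x ∈ U, (x, jet φ x) ∈ 𝒟) (i : Fin N) {x : Pt N}
    (hx : x ∈ U) : totalD i f x (jet φ x) = pd i (fun y => f y (jet φ y)) x := by
  obtain ⟨S, W, F, h⟩ := hf.exists_represents
  obtain ⟨h1, h2⟩ := hasFDerivAt_restr_jet hU hφ S hx
  have := h.hasFDerivAt_comp h𝒟 (c := fun y => y) continuousAt_id
    ((continuousOn_jet hU hφ).continuousAt (hU.mem_nhds hx)) (hjet x hx)
    ((hasFDerivAt_id x).prodMk h1.hasFDerivAt)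
  simp only [pd]
  rw [HasFDerivAt.fderiv this, h.totalD_eq h𝒟 (hjet x hx), ← h2]
  rfl

theorem contDiffOn_vertD_jet {f : DiffFun N V 𝕜} (hf : SmoothOn f 𝒟) (h𝒟 : IsOpen 𝒟)
    (hU : IsOpen U) (hφ : ContDiffOn ℝ ∞ φ U) (hjet : ∀ x ∈ U, (x, jet φ x) ∈ 𝒟)
    (hη : ContDiffOn ℝ ∞ η U) :
    ContDiffOn ℝ ∞ (fun y => vertD f y (jet φ y) (jet η y)) U := by
  obtain ⟨S, W, F, h⟩ := hf.exists_represents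
  have hr : ∀ ψ : Pt N → V, ContDiffOn ℝ ∞ ψ U → ContDiffOn ℝ ∞ (fun y => restr S (jet ψ y)) U :=
    fun ψ hψ => contDiffOn_pi.2 fun I => contDiffOn_pdMulti hU hψ I
  exact (contDiffOn_fderiv_apply h.isOpen h.contDiffOn (contDiffOn_id.prodMk (hr φ hφ))
    (contDiffOn_const (c := (0 : Pt N)).prodMk (hr η hη)) fun x hx => h.mem (hjet x hx)).congr
      fun x hx => h.vertD_eq h𝒟 (hjet x hx) _

theorem Represents.differentiableAt_fderiv {f : DiffFun N V 𝕜} {S : Finset (MultiIdx N)}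
    {W : Set (Pt N × (S → V))} {F : Pt N × (S → V) → 𝕜} (h : Represents f 𝒟 S W F) {x : Pt N}
    {u : Jet N V} (hx : (x, u) ∈ 𝒟) : DifferentiableAt ℝ (fderiv ℝ F) (x, restr S u) :=
  ((h.contDiffAt hx).fderiv_right (m := 1)
    (by rw [one_add_one_eq_two]; exact two_le_infty)).differentiableAt (by simp)

/-- Product rule: moving `u` to `u + t • w` changes both the base point and the direction in the
formula for the total derivative, since that direction contains the shifted jet itself. -/
theorem Represents.vertD_totalD {f : DiffFun N V 𝕜} {S : Finset (MultiIdx N)}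
    {W : Set (Pt N × (S → V))} {F : Pt N × (S → V) → 𝕜} (h : Represents f 𝒟 S W F)
    (h𝒟 : IsOpen 𝒟) {x : Pt N} {u : Jet N V} (hx : (x, u) ∈ 𝒟) (w : Jet N V) (i : Fin N) :
    vertD (Multiform.totalD i f) x u w =
      fderiv ℝ (fderiv ℝ F) (x, restr S u) (Pi.single i 1, restr S fun I => u (I + unit i))
        (0, restr S w) +
      fderiv ℝ F (x, restr S u) (0, restr S fun I => w (I + unit i)) := by
  have hs : IsSymmSndFDerivAt ℝ F (x, restr S u) :=
    (h.contDiffAt hx).isSymmSndFDerivAt (by simpa using two_le_infty)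
  have hF' := h.differentiableAt_fderiv hx
  rw [hs.eq]
  set p : Pt N × (S → V) := (x, restr S u)
  refine (hasDerivAt_vertD (h.smoothOn.totalD h𝒟 i) h𝒟 hx w).unique ?_
  have e : (fun t : ℝ => Multiform.totalD i f x (u + t • w)) =ᶠ[𝓝 0] fun t =>
      fderiv ℝ F (p + t • (0, restr S w))
        ((Pi.single i 1, restr S fun I => u (I + unit i)) +
          t • (0, restr S fun I => w (I + unit i))) := by
    have hc : ContinuousAt (fun t : ℝ => (x, u + t • w)) 0 := by fun_prop
    filter_upwards [hc.preimage_mem_nhds (h𝒟.mem_nhds (by simpa using hx))] with t ht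
    rw [h.totalD_eq h𝒟 ht]
    congr 2
    · simp [p]; rfl
    · simp
  have hline : ∀ a b : Pt N × (S → V), HasDerivAt (fun t : ℝ => a + t • b) b 0 := fun a b => by
    simpa using ((hasDerivAt_id (0 : ℝ)).smul_const b).const_add a
  refine HasDerivAt.congr_of_eventuallyEq ?_ e
  have hc : HasDerivAt (fun t : ℝ => fderiv ℝ F (p + t • (0, restr S w)))
      (fderiv ℝ (fderiv ℝ F) p (0, restr S w)) 0 := by
    have h0 : HasFDerivAt (fderiv ℝ F) (fderiv ℝ (fderiv ℝ F) p)
        (p + (0 : ℝ) • (0, restr S w)) := by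
      rw [zero_smul, add_zero]; exact hF'.hasFDerivAt
    exact h0.comp_hasDerivAt 0 (hline p _)
  have := hc.clm_apply (hline (Pi.single i 1, restr S fun I => u (I + unit i))
    (0, restr S fun I => w (I + unit i)))
  simpa using this

/-- By the chain rule both sides consist of a second-derivative term and a term with the shifted jet
of η, and the derivative of a jet is the shifted jet. This identity turns dω_η into δdL. -/
theorem vertD_totalD_jet {f : DiffFun N V 𝕜} (hf : SmoothOn f 𝒟) (h𝒟 : IsOpen 𝒟)
    (hU : IsOpen U) (hφ : ContDiffOn ℝ ∞ φ U) (hjet : ∀ x ∈ U, (x, jet φ x) ∈ 𝒟)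
    (hη : ContDiffOn ℝ ∞ η U) (i : Fin N) {x : Pt N} (hx : x ∈ U) :
    vertD (totalD i f) x (jet φ x) (jet η x) =
      pd i (fun y => vertD f y (jet φ y) (jet η y)) x := by
  obtain ⟨S, W, F, h⟩ := hf.exists_represents
  have e : (fun y => vertD f y (jet φ y) (jet η y)) =ᶠ[𝓝 x] fun y =>
      fderiv ℝ F (y, restr S (jet φ y)) (0, restr S (jet η y)) := by
    filter_upwards [hU.mem_nhds hx] with y hy using h.vertD_eq h𝒟 (hjet y hy) _
  have h1 := (hasFDerivAt_restr_jet hU hφ S hx).1.hasFDerivAt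
  have h2 := (hasFDerivAt_restr_jet hU hη S hx).1.hasFDerivAt
  have hc : HasFDerivAt (fun y => fderiv ℝ F (y, restr S (jet φ y))) _ x :=
    HasFDerivAt.comp x (g := fderiv ℝ F) (h.differentiableAt_fderiv (hjet x hx)).hasFDerivAt
      ((hasFDerivAt_id x).prodMk h1)
  have hR := (hc.clm_apply ((hasFDerivAt_const (0 : Pt N) x).prodMk h2)).congr_of_eventuallyEq e
  have e1 := (hasFDerivAt_restr_jet hU hφ S hx).2 i
  have e2 := (hasFDerivAt_restr_jet hU hη S hx).2 i
  rw [h.vertD_totalD h𝒟 (hjet x hx), pd, hR.fderiv]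
  simp only [_root_.add_apply, ContinuousLinearMap.comp_apply,
    ContinuousLinearMap.flip_apply, ContinuousLinearMap.prod_apply, e1, e2,
    _root_.zero_apply, ContinuousLinearMap.id_apply]
  rw [add_comm]

/-- The commutator of ∂/∂φ_I with D_i is ∂/∂φ_{I-i}: a jet concentrated at `I`, shifted by `i`, is
concentrated at `I - unit i`, or is zero if that index does not exist. -/
theorem pdJet_totalD_jet {f : DiffFun N V 𝕜} (hf : SmoothOn f 𝒟) (h𝒟 : IsOpen 𝒟)
    (hU : IsOpen U) (hφ : ContDiffOn ℝ ∞ φ U) (hjet : ∀ x ∈ U, (x, jet φ x) ∈ 𝒟)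
    (I : MultiIdx N) (v : V) (i : Fin N) {x : Pt N} (hx : x ∈ U) :
    pdJet I v (totalD i f) x (jet φ x) =
      pd i (fun y => pdJet I v f y (jet φ y)) x +
        if I i = 0 then 0 else pdJet (I - unit i) v f x (jet φ x) := by
  obtain ⟨S, W, F, h⟩ := hf.exists_represents
  rw [← vertD_single, h.vertD_totalD h𝒟 (hjet x hx), ← h.vertD_eq h𝒟 (hjet x hx)]
  congr 1
  · have e : (fun y => pdJet I v f y (jet φ y)) =ᶠ[𝓝 x] fun y =>
        fderiv ℝ F (y, restr S (jet φ y)) (0, restr S (Pi.single I v)) := by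
      filter_upwards [hU.mem_nhds hx] with y hy using h.pdJet_eq h𝒟 (hjet y hy) _ _
    have h1 := (hasFDerivAt_restr_jet hU hφ S hx).1.hasFDerivAt
    have hc : HasFDerivAt (fun y => fderiv ℝ F (y, restr S (jet φ y))) _ x :=
      HasFDerivAt.comp x (g := fderiv ℝ F) (h.differentiableAt_fderiv (hjet x hx)).hasFDerivAt
        ((hasFDerivAt_id x).prodMk h1)
    have hR := (hc.clm_apply (hasFDerivAt_const ((0 : Pt N), restr S (Pi.single I v))
      x)).congr_of_eventuallyEq e
    have e1 := (hasFDerivAt_restr_jet hU hφ S hx).2 i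
    rw [pd, hR.fderiv]
    simp [ContinuousLinearMap.comp_apply, ContinuousLinearMap.flip_apply, e1]
  · split_ifs with hI
    · have : (fun J => (Pi.single I v : Jet N V) (J + unit i)) = 0 := by
        funext J
        refine Pi.single_eq_of_ne (fun h => ?_) _
        have := congrFun h i
        simp [unit, hI] at this
      rw [this, vertD_zero]
    · have hI' : I - unit i + unit i = I := by
        funext k
        by_cases hk : k = i
        · subst hk; simp [unit]; omega
        · simp [unit, hk]
      have : (fun J => (Pi.single I v : Jet N V) (J + unit i)) = Pi.single (I - unit i) v := by
        funext J
        have : J + unit i = I ↔ J = I - unit i := 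
          ⟨fun h => add_right_cancel (h.trans hI'.symm), fun h => h ▸ hI'⟩
        simp only [Pi.single_apply, this]
      rw [this, vertD_single]

end AlongField

end JetFunctions

/-! ### Shift operators on families indexed by multi-indices, and their Neumann series. -/

section ShiftAlgebra

variable {N : ℕ} {M : Type*} [AddCommGroup M] [Module ℝ M]

/-- A linear operator applied to every term of a family indexed by multi-indices. -/
def termwise (d : Module.End ℝ M) : Module.End ℝ (MultiIdx N → M) := d.compLeft (MultiIdx N)

/-- The operator `a ↦ (I ↦ a (I + i))`. -/
def raise (i : Fin N) : Module.End ℝ (MultiIdx N → M) := LinearMap.funLeft ℝ M (· + unit i)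

/-- The operator `a ↦ (I ↦ a (I - i))`, with value zero where `I - i` has a negative entry. -/
def lower (i : Fin N) : Module.End ℝ (MultiIdx N → M) where
  toFun a I := if I i = 0 then 0 else a (I - unit i)
  map_add' a b := by funext I; simp only [Pi.add_apply]; split_ifs <;> simp
  map_smul' c a := by funext I; simp only [Pi.smul_apply]; split_ifs <;> simp

@[simp] theorem termwise_apply (d : Module.End ℝ M) (a : MultiIdx N → M) (I : MultiIdx N) :
    termwise d a I = d (a I) := rfl

@[simp] theorem raise_apply (i : Fin N) (a : MultiIdx N → M) (I : MultiIdx N) :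
    raise i a I = a (I + unit i) := rfl

theorem lower_apply (i : Fin N) (a : MultiIdx N → M) (I : MultiIdx N) :
    lower i a I = if I i = 0 then 0 else a (I - unit i) := rfl

/-- Only this order gives the identity; the opposite product erases the terms with `I i = 0`. -/
theorem raise_mul_lower (i : Fin N) : (raise i * lower i : Module.End ℝ (MultiIdx N → M)) = 1 := by
  refine LinearMap.ext fun a => funext fun I => ?_
  simp [lower_apply, unit]

theorem commute_raise (i j : Fin N) :
    Commute (raise i) (raise j : Module.End ℝ (MultiIdx N → M)) := by
  refine LinearMap.ext fun a => funext fun I => ?_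
  simp [add_right_comm]

theorem commute_lower_raise {i j : Fin N} (h : i ≠ j) :
    Commute (lower i) (raise j : Module.End ℝ (MultiIdx N → M)) := by
  refine LinearMap.ext fun a => funext fun I => ?_
  have h1 : (I + unit j) i = I i := by simp [unit, h]
  simp only [Module.End.mul_apply, lower_apply, raise_apply, h1]
  split_ifs with hI
  · rfl
  · congr 1
    funext k
    by_cases hk : k = i
    · subst hk; simp [unit, h]
    · simp [unit, hk]

theorem commute_termwise_raise (d : Module.End ℝ M) (i : Fin N) :
    Commute (termwise d) (raise i : Module.End ℝ (MultiIdx N → M)) := rfl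

theorem commute_termwise_lower (d : Module.End ℝ M) (i : Fin N) :
    Commute (termwise d) (lower i : Module.End ℝ (MultiIdx N → M)) := by
  refine LinearMap.ext fun a => funext fun I => ?_
  simp only [Module.End.mul_apply, lower_apply, termwise_apply]
  split_ifs <;> simp

theorem commute_termwise {d e : Module.End ℝ M} (h : Commute d e) :
    Commute (termwise d) (termwise e : Module.End ℝ (MultiIdx N → M)) :=
  LinearMap.ext fun a => funext fun I => LinearMap.congr_fun h.eq (a I)

variable (D : Fin N → Module.End ℝ M)

/-- The operator `-D_i S_i`, where `S_i` raises indices. -/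
def negRaise (i : Fin N) : Module.End ℝ (MultiIdx N → M) :=
  termwise ((-1 : ℝ) • D i) * raise i

/-- The truncated Neumann series `∑_{a < K} (-D_i S_i)^a`. -/
def neumann (K : ℕ) (i : Fin N) : Module.End ℝ (MultiIdx N → M) :=
  ∑ a ∈ Finset.range K, negRaise D i ^ a

/-- These are the terms, with their signs and shifted indices, of a variational derivative in one
direction. -/
theorem negRaise_pow_apply (i : Fin N) (n : ℕ) (a : MultiIdx N → M) (I : MultiIdx N) :
    (negRaise D i ^ n) a I = (-1 : ℝ) ^ n • (D i ^ n) (a (I + n • unit i)) := by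
  induction n generalizing I with
  | zero => simp
  | succ n ih =>
    rw [pow_succ', Module.End.mul_apply]
    simp only [negRaise, LinearMap.smul_apply, Module.End.mul_apply, termwise_apply, raise_apply]
    rw [← negRaise, ih, map_smul, pow_succ', pow_succ', Module.End.mul_apply, add_assoc, succ_nsmul',
      mul_smul]

theorem negRaise_pow_eq_zero {i : Fin N} {n : ℕ} {a : MultiIdx N → M}
    (h : ∀ I : MultiIdx N, n ≤ I i → a I = 0) : (negRaise D i ^ n) a = 0 := by
  funext I
  rw [negRaise_pow_apply, h]
  · simp
  · simp [unit]

variable {D}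

theorem commute_termwise_negRaise {d : Module.End ℝ M} {j : Fin N} (hd : Commute d (D j)) :
    Commute (termwise d) (negRaise D j) :=
  (commute_termwise (hd.smul_right _)).mul_right (commute_termwise_raise _ j)

theorem commute_raise_negRaise (i j : Fin N) : Commute (raise i) (negRaise D j) :=
  (commute_termwise_raise _ i).symm.mul_right (commute_raise i j)

theorem commute_negRaise (hD : ∀ i j, Commute (D i) (D j)) (i j : Fin N) :
    Commute (negRaise D i) (negRaise D j) :=
  (commute_termwise_negRaise ((hD i j).smul_left _)).mul_left (commute_raise_negRaise i j)

theorem commute_lower_negRaise {i j : Fin N} (h : i ≠ j) :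
    Commute (lower i) (negRaise D j) :=
  (commute_termwise_lower _ i).symm.mul_right (commute_lower_raise h)

theorem commute_neumann_right {X : Module.End ℝ (MultiIdx N → M)} {j : Fin N}
    (h : Commute X (negRaise D j)) (K : ℕ) : Commute X (neumann D K j) :=
  Commute.sum_right _ _ _ fun a _ => h.pow_right a

/-- Since S_i T_i = 1, every positive power satisfies (-D_i S_i)^(a+1) T_i = -D_i (-D_i S_i)^a. One
power is used up, whence `K + 1` on the left and `K` on the right. -/
theorem neumann_mul_lower (hD : ∀ i j, Commute (D i) (D j)) (K : ℕ) (i : Fin N) :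
    neumann D (K + 1) i * lower i = lower i + termwise ((-1 : ℝ) • D i) * neumann D K i := by
  have h : negRaise D i * lower i = termwise ((-1 : ℝ) • D i) := by
    rw [negRaise, mul_assoc, raise_mul_lower, mul_one]
  rw [neumann, Finset.sum_range_succ', add_mul, pow_zero, one_mul, Finset.sum_mul, neumann,
    Finset.mul_sum, add_comm]
  congr 1
  refine Finset.sum_congr rfl fun a _ => ?_
  rw [pow_succ, mul_assoc, h,
    ((commute_termwise_negRaise ((hD i i).smul_left (-1 : ℝ))).pow_right a).eq]

variable (D) in
/-- The operator `a ↦ (I ↦ D_i a I + a (I - i))`. -/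
def diffLower (i : Fin N) : Module.End ℝ (MultiIdx N → M) := termwise (D i) + lower i

theorem diffLower_apply (i : Fin N) (a : MultiIdx N → M) (I : MultiIdx N) :
    diffLower D i a I = D i (a I) + if I i = 0 then 0 else a (I - unit i) := rfl

/-- The truncated form of P_i (D_i + T_i) = T_i: the two terms D_i P_i a cancel. The vanishing of
`a` beyond `K` makes the truncations at `K` and `K + 1` agree on it. -/
theorem neumann_diffLower_apply (hD : ∀ i j, Commute (D i) (D j)) {K : ℕ} {i : Fin N}
    {a : MultiIdx N → M} (ha : ∀ I : MultiIdx N, K ≤ I i → a I = 0) :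
    neumann D (K + 1) i (diffLower D i a) = lower i a := by
  have h1 : neumann D (K + 1) i a = neumann D K i a := by
    rw [neumann, Finset.sum_range_succ, LinearMap.add_apply, negRaise_pow_eq_zero D ha, add_zero]
    rfl
  have h2 := LinearMap.congr_fun (neumann_mul_lower hD K i) a
  have h3 := LinearMap.congr_fun
    (commute_neumann_right (commute_termwise_negRaise (hD i i)) (K + 1)).eq a
  simp only [Module.End.mul_apply, LinearMap.add_apply] at h2 h3
  rw [diffLower, LinearMap.add_apply, map_add, h2, ← h3, h1]
  funext I
  simp

/-- The telescoping geometric sum. When the top power kills `b`, it recovers `b` from its image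
under the series, so no information is lost there. -/
theorem neumann_apply_eq (K : ℕ) (i : Fin N) (b : MultiIdx N → M) :
    neumann D K i b + (negRaise D i ^ K) b = b + negRaise D i (neumann D K i b) := by
  induction K with
  | zero => simp [neumann]
  | succ K ih =>
    have h : neumann D (K + 1) i b = neumann D K i b + (negRaise D i ^ K) b := by
      rw [neumann, Finset.sum_range_succ]; rfl
    rw [h, map_add, ← add_assoc b, ← ih, pow_succ']
    rfl

theorem neumann_eq_zero_iff {K : ℕ} {i : Fin N} {b : MultiIdx N → M}
    (hb : (negRaise D i ^ K) b = 0) : neumann D K i b = 0 ↔ b = 0 := by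
  refine ⟨fun h => ?_, fun h => by rw [h, map_zero]⟩
  have := neumann_apply_eq (D := D) K i b
  rw [h, hb, map_zero, add_zero, add_zero] at this
  exact this.symm

theorem negRaise_pow_neumann_eq_zero (hD : ∀ i j, Commute (D i) (D j)) {K n : ℕ} {i j : Fin N}
    {b : MultiIdx N → M} (hb : (negRaise D i ^ n) b = 0) :
    (negRaise D i ^ n) (neumann D K j b) = 0 := by
  have := LinearMap.congr_fun
    (commute_neumann_right ((commute_negRaise hD i j).pow_left n) K).eq b
  rw [Module.End.mul_apply, Module.End.mul_apply, hb, map_zero] at this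
  exact this

/-- T_i commutes with the series in the two directions other than `i`, and is absorbed only by the
one in direction `i`. -/
theorem neumann_three_apply (hD : ∀ i j, Commute (D i) (D j)) {K : ℕ} {i j k : Fin N} (hij : i ≠ j)
    (hki : k ≠ i) {a : MultiIdx N → M} (ha : ∀ I : MultiIdx N, K ≤ I i → a I = 0) :
    neumann D (K + 1) i (neumann D (K + 1) j (neumann D (K + 1) k
      (diffLower D i a))) =
    lower i (neumann D (K + 1) j (neumann D (K + 1) k a)) := by
  have c : ∀ p q, Commute (neumann D (K + 1) p) (neumann D (K + 1) q) := fun p q =>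
    commute_neumann_right
      (commute_neumann_right (commute_negRaise hD q p) (K + 1)).symm (K + 1)
  have l : ∀ {q}, i ≠ q → Commute (neumann D (K + 1) q) (lower i) := fun h =>
    (commute_neumann_right (commute_lower_negRaise h) (K + 1)).symm
  have e1 := LinearMap.congr_fun ((c i j).mul_right (c i k)).eq (diffLower D i a)
  have e2 := LinearMap.congr_fun ((l hij).mul_left (l hki.symm)).eq a
  simp only [Module.End.mul_apply] at e1 e2
  rw [e1, neumann_diffLower_apply hD ha, e2]

/-- The right side is the image of the left side under the three Neumann series, and each series is
injective on the families that occur. With `a`, `b`, `c` the coefficients of L_(jk), L_(ki), L_(ij),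
this is the equivalence of closedness and the multiform Euler–Lagrange equations. -/
theorem cyclic_closed_iff (hD : ∀ i j, Commute (D i) (D j)) {K : ℕ} {i j k : Fin N} (hij : i ≠ j)
    (hjk : j ≠ k) (hki : k ≠ i) {a b c : MultiIdx N → M}
    (ha : ∀ (I : MultiIdx N) (l : Fin N), K ≤ I l → a I = 0)
    (hb : ∀ (I : MultiIdx N) (l : Fin N), K ≤ I l → b I = 0)
    (hc : ∀ (I : MultiIdx N) (l : Fin N), K ≤ I l → c I = 0) :
    diffLower D i a + diffLower D j b + diffLower D k c = 0 ↔
    lower k (neumann D (K + 1) i (neumann D (K + 1) j c)) +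
      lower i (neumann D (K + 1) j (neumann D (K + 1) k a)) +
      lower j (neumann D (K + 1) k (neumann D (K + 1) i b)) = 0 := by
  set z := diffLower D i a + diffLower D j b +
    diffLower D k c with hz
  have cc : ∀ p q (y : MultiIdx N → M), neumann D (K + 1) p (neumann D (K + 1) q y) =
      neumann D (K + 1) q (neumann D (K + 1) p y) := fun p q y =>
    LinearMap.congr_fun (commute_neumann_right
      (commute_neumann_right (commute_negRaise hD q p) (K + 1)).symm (K + 1)).eq y
  -- `diffLower` can raise an entry of the support by one, so the left side is supported below `K +
  -- 1`; this is the reason for truncating there.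
  have hsupp : ∀ (p : Fin N) {y : MultiIdx N → M},
      (∀ (I : MultiIdx N) (l : Fin N), K ≤ I l → y I = 0) →
      ∀ (I : MultiIdx N) (l : Fin N), K + 1 ≤ I l → diffLower D p y I = 0 := by
    intro p y hy I l hI
    rw [diffLower_apply, hy I l (by omega), map_zero, zero_add]
    split_ifs with h
    · rfl
    · refine hy _ l ?_
      have : (unit p : MultiIdx N) l ≤ 1 := by
        by_cases h : l = p
        · subst h; simp [unit]
        · simp [unit, h]
      simp only [Pi.sub_apply]
      omega
  have hz0 : ∀ l, (negRaise D l ^ (K + 1)) z = 0 := fun l =>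
    negRaise_pow_eq_zero D fun I hI => by
      rw [hz, Pi.add_apply, Pi.add_apply, hsupp i ha I l hI, hsupp j hb I l hI, hsupp k hc I l hI]
      simp
  have key : neumann D (K + 1) i (neumann D (K + 1) j (neumann D (K + 1) k z)) =
      lower k (neumann D (K + 1) i (neumann D (K + 1) j c)) +
      lower i (neumann D (K + 1) j (neumann D (K + 1) k a)) +
      lower j (neumann D (K + 1) k (neumann D (K + 1) i b)) := by
    rw [hz]
    have hadd : ∀ l (y y' : MultiIdx N → M), neumann D (K + 1) l (y + y') =
        neumann D (K + 1) l y + neumann D (K + 1) l y' := fun l => map_add _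
    simp only [hadd]
    rw [neumann_three_apply hD hij hki fun I => ha I i]
    rw [cc j k (diffLower D j b), cc i k, cc i j, cc k j,
      neumann_three_apply hD hjk hij fun I => hb I j]
    rw [cc j k (diffLower D k c), cc i k,
      neumann_three_apply hD hki hjk fun I => hc I k]
    abel
  rw [← key, neumann_eq_zero_iff, neumann_eq_zero_iff, neumann_eq_zero_iff (hz0 k)]
  · exact negRaise_pow_neumann_eq_zero hD (hz0 j)
  · exact negRaise_pow_neumann_eq_zero hD (negRaise_pow_neumann_eq_zero hD (hz0 i))

end ShiftAlgebra

/-! ### Smooth functions on an open set as a module with commuting derivations. -/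

section SmoothFunctions

variable {N : ℕ} {𝕜 : Type*} [RCLike 𝕜] {U : Set (Pt N)}

variable (𝕜 U) in
/-- Functions that are smooth on `U` and vanish off `U`. -/
def smoothFun : Submodule ℝ (Pt N → 𝕜) where
  carrier := {f | ContDiffOn ℝ ∞ f U ∧ ∀ x ∉ U, f x = 0}
  add_mem' hf hg := ⟨hf.1.add hg.1, fun x hx => by simp [hf.2 x hx, hg.2 x hx]⟩
  zero_mem' := ⟨contDiffOn_const, fun _ _ => rfl⟩
  smul_mem' c _ hf := ⟨contDiffOn_const.smul hf.1, fun x hx => by simp [hf.2 x hx]⟩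

/-- A function that is smooth on `U`, set to zero off `U`. -/
def toSmoothFun {g : Pt N → 𝕜} (hg : ContDiffOn ℝ ∞ g U) : smoothFun 𝕜 U :=
  ⟨U.indicator g, hg.congr fun _ hx => Set.indicator_of_mem hx g,
    fun _ hx => Set.indicator_of_notMem hx g⟩

theorem toSmoothFun_apply {g : Pt N → 𝕜} (hg : ContDiffOn ℝ ∞ g U) {x : Pt N} (hx : x ∈ U) :
    (toSmoothFun hg : Pt N → 𝕜) x = g x := Set.indicator_of_mem hx g

/-- Prescribing the value zero off `U` makes equality in the module mean equality on `U`, so that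
the partial derivatives become honest commuting endomorphisms. -/
theorem smoothFun_eq_zero_iff {m : smoothFun 𝕜 U} :
    m = 0 ↔ ∀ x ∈ U, (m : Pt N → 𝕜) x = 0 := by
  refine ⟨fun h x _ => by rw [h]; rfl, fun h => Subtype.ext (funext fun x => ?_)⟩
  by_cases hx : x ∈ U
  · exact h x hx
  · exact m.2.2 x hx

theorem contDiffOn_smoothFun (m : smoothFun 𝕜 U) : ContDiffOn ℝ ∞ (m : Pt N → 𝕜) U := m.2.1

theorem smoothFun_apply_of_notMem (m : smoothFun 𝕜 U) {x : Pt N} (hx : x ∉ U) :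
    (m : Pt N → 𝕜) x = 0 := m.2.2 x hx

/-- The partial derivative as an operator on functions smooth on `U`. -/
def pdEnd (hU : IsOpen U) (i : Fin N) : Module.End ℝ (smoothFun 𝕜 U) where
  toFun m := toSmoothFun (contDiffOn_pd hU (contDiffOn_smoothFun m) i)
  map_add' m n := Subtype.ext <| funext fun x => by
    by_cases hx : x ∈ U
    · have h1 := ((contDiffOn_smoothFun m).contDiffAt (hU.mem_nhds hx)).differentiableAt (by simp)
      have h2 := ((contDiffOn_smoothFun n).contDiffAt (hU.mem_nhds hx)).differentiableAt (by simp)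
      have := pd_add_smul h1 h2 1 i
      rw [one_smul, one_smul] at this
      rw [toSmoothFun_apply _ hx, Submodule.coe_add, Submodule.coe_add, Pi.add_apply,
        toSmoothFun_apply _ hx, toSmoothFun_apply _ hx, this]
    · simp only [smoothFun_apply_of_notMem _ hx]
  map_smul' c m := Subtype.ext <| funext fun x => by
    by_cases hx : x ∈ U
    · have h1 := ((contDiffOn_smoothFun m).contDiffAt (hU.mem_nhds hx)).differentiableAt (by simp)
      have := pd_add_smul (differentiableAt_const (0 : 𝕜)) h1 c i
      have h0 : (fun _ : Pt N => (0 : 𝕜)) = 0 := rfl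
      rw [h0, zero_add] at this
      have h3 : pd i (0 : Pt N → 𝕜) x = 0 := by simp [pd]
      rw [h3, zero_add] at this
      rw [toSmoothFun_apply _ hx, Submodule.coe_smul, Submodule.coe_smul, Pi.smul_apply,
        toSmoothFun_apply _ hx, this]
      rfl
    · simp only [smoothFun_apply_of_notMem _ hx]

theorem pdEnd_apply (hU : IsOpen U) (i : Fin N) (m : smoothFun 𝕜 U) {x : Pt N} (hx : x ∈ U) :
    (pdEnd hU i m).1 x = pd i m.1 x :=
  toSmoothFun_apply (contDiffOn_pd hU (contDiffOn_smoothFun m) i) hx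

theorem commute_pdEnd (hU : IsOpen U) (i j : Fin N) :
    Commute (pdEnd hU i : Module.End ℝ (smoothFun 𝕜 U)) (pdEnd hU j) := by
  refine LinearMap.ext fun m => Subtype.ext (funext fun x => ?_)
  by_cases hx : x ∈ U
  · rw [Module.End.mul_apply, Module.End.mul_apply, pdEnd_apply hU i _ hx, pdEnd_apply hU j _ hx,
      pd_eqOn hU (fun y hy => pdEnd_apply hU j m hy) i hx,
      pd_eqOn hU (fun y hy => pdEnd_apply hU i m hy) j hx, pd_comm hU (contDiffOn_smoothFun m) i j hx]
  · rw [smoothFun_apply_of_notMem _ hx, smoothFun_apply_of_notMem _ hx]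

theorem pdEnd_pow_eqOn (hU : IsOpen U) (i : Fin N) (n : ℕ) {m : smoothFun 𝕜 U} {g : Pt N → 𝕜}
    (h : Set.EqOn m g U) :
    Set.EqOn ((pdEnd hU i ^ n) m : smoothFun 𝕜 U) ((pd i)^[n] g) U := by
  induction n with
  | zero => exact h
  | succ n ih =>
    rw [pow_succ', Module.End.mul_apply, Function.iterate_succ_apply']
    exact fun x hx => (pdEnd_apply hU i _ hx).trans (pd_eqOn hU ih i hx)

end SmoothFunctions

/-! ### Equivalence of `δdL = 0` and the multiform Euler–Lagrange equations. -/

section ClosednessAndEulerLagrange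

variable {N : ℕ} {V 𝕜 : Type*} [NormedAddCommGroup V] [NormedSpace ℝ V] [RCLike 𝕜]
  {𝒟 : Set (Pt N × Jet N V)} {U : Set (Pt N)} {φ : Pt N → V}

theorem smoothOn_totalD_iterate {f : DiffFun N V 𝕜} (hf : SmoothOn f 𝒟) (h𝒟 : IsOpen 𝒟)
    (i : Fin N) (n : ℕ) : SmoothOn ((totalD i)^[n] f) 𝒟 := by
  induction n with
  | zero => exact hf
  | succ n ih => rw [Function.iterate_succ_apply']; exact ih.totalD h𝒟 i

theorem totalD_iterate_jet {f : DiffFun N V 𝕜} (hf : SmoothOn f 𝒟) (h𝒟 : IsOpen 𝒟)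
    (hU : IsOpen U) (hφ : ContDiffOn ℝ ∞ φ U) (hjet : ∀ x ∈ U, (x, jet φ x) ∈ 𝒟) (i : Fin N)
    (n : ℕ) : Set.EqOn (fun x => (totalD i)^[n] f x (jet φ x))
      ((pd i)^[n] fun y => f y (jet φ y)) U := by
  induction n with
  | zero => exact fun _ _ => rfl
  | succ n ih =>
    intro x hx
    simp only [Function.iterate_succ_apply']
    rw [totalD_jet (smoothOn_totalD_iterate hf h𝒟 i n) h𝒟 hU hφ hjet i hx]
    exact pd_eqOn hU ih i hx

/-- The coefficients `∂f/∂φ_I` along the field `φ`, as functions on `U`. -/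
def jetCoeff {f : DiffFun N V 𝕜} (hf : SmoothOn f 𝒟) (h𝒟 : IsOpen 𝒟) (hU : IsOpen U)
    (hφ : ContDiffOn ℝ ∞ φ U) (hjet : ∀ x ∈ U, (x, jet φ x) ∈ 𝒟) (v : V) (I : MultiIdx N) :
    smoothFun 𝕜 U :=
  toSmoothFun (contDiffOn_comp_jet (hf.pdJet h𝒟 I v) hU hφ hjet)

theorem jetCoeff_eqOn {f : DiffFun N V 𝕜} (hf : SmoothOn f 𝒟) (h𝒟 : IsOpen 𝒟) (hU : IsOpen U)
    (hφ : ContDiffOn ℝ ∞ φ U) (hjet : ∀ x ∈ U, (x, jet φ x) ∈ 𝒟) (v : V) (I : MultiIdx N) :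
    Set.EqOn (jetCoeff hf h𝒟 hU hφ hjet v I).1 (fun y => pdJet I v f y (jet φ y)) U :=
  fun _ hx => toSmoothFun_apply (contDiffOn_comp_jet (hf.pdJet h𝒟 I v) hU hφ hjet) hx

theorem exists_jetCoeff_bound {f : DiffFun N V 𝕜} (hf : SmoothOn f 𝒟) (h𝒟 : IsOpen 𝒟)
    (hU : IsOpen U) (hφ : ContDiffOn ℝ ∞ φ U) (hjet : ∀ x ∈ U, (x, jet φ x) ∈ 𝒟) :
    ∃ K, ∀ K' ≥ K, ∀ (v : V) (I : MultiIdx N) (l : Fin N), K' ≤ I l →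
      jetCoeff hf h𝒟 hU hφ hjet v I = 0 := by
  obtain ⟨S, W, F, h⟩ := hf.exists_represents
  -- The largest total order of a coordinate on which `f` depends bounds every single entry; adding
  -- one makes the bound strict.
  refine ⟨S.sup (fun I => ∑ l, I l) + 1, fun K' hK' v I l hI => ?_⟩
  refine smoothFun_eq_zero_iff.2 fun x hx => ?_
  refine (toSmoothFun_apply _ hx).trans (h.pdJet_eq_zero h𝒟 (hjet x hx) (fun hS => ?_) v)
  have h1 : ∑ l, I l ≤ S.sup fun I : MultiIdx N => ∑ l, I l :=
    Finset.le_sup (f := fun I : MultiIdx N => ∑ l, I l) hS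
  have h2 : I l ≤ ∑ l, I l := Finset.single_le_sum (fun _ _ => Nat.zero_le _) (Finset.mem_univ l)
  omega

/-- Expanding the product of two Neumann series gives the defining double sum; terms with an
exponent at least `K` vanish because they involve a coefficient beyond the support. -/
theorem varDeriv_jet {f : DiffFun N V 𝕜} (hf : SmoothOn f 𝒟) (h𝒟 : IsOpen 𝒟)
    (hU : IsOpen U) (hφ : ContDiffOn ℝ ∞ φ U) (hjet : ∀ x ∈ U, (x, jet φ x) ∈ 𝒟) {K : ℕ} {v : V}
    (hK : ∀ (I : MultiIdx N) (l : Fin N), K ≤ I l → jetCoeff hf h𝒟 hU hφ hjet v I = 0)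
    (i j : Fin N) (I : MultiIdx N) {x : Pt N} (hx : x ∈ U) :
    varDeriv i j I v f x (jet φ x) =
      (neumann (pdEnd hU) K i (neumann (pdEnd hU) K j (jetCoeff hf h𝒟 hU hφ hjet v)) I).1 x := by
  set a := jetCoeff hf h𝒟 hU hφ hjet v
  have hterm : ∀ p : ℕ × ℕ, (-1 : 𝕜) ^ (p.1 + p.2) * ((totalD i)^[p.1] ((totalD j)^[p.2]
      (pdJet (I + p.1 • unit i + p.2 • unit j) v f))) x (jet φ x) =
      (-1 : 𝕜) ^ (p.1 + p.2) * ((pdEnd hU i ^ p.1) ((pdEnd hU j ^ p.2)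
        (a (I + p.1 • unit i + p.2 • unit j)))).1 x := fun p => by
    have hs := hf.pdJet h𝒟 (I + p.1 • unit i + p.2 • unit j) v
    have h1 := totalD_iterate_jet (smoothOn_totalD_iterate hs h𝒟 j p.2) h𝒟 hU hφ hjet i p.1 hx
    have h2 := pd_iterate_eqOn hU (totalD_iterate_jet hs h𝒟 hU hφ hjet j p.2) i p.1 hx
    have h3 := pdEnd_pow_eqOn hU i p.1 (pdEnd_pow_eqOn hU j p.2
      (jetCoeff_eqOn hf h𝒟 hU hφ hjet v (I + p.1 • unit i + p.2 • unit j))) hx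
    exact congrArg _ (h1.trans (h2.trans h3.symm))
  have hR : neumann (pdEnd hU) K i (neumann (pdEnd hU) K j a) I =
      ∑ α ∈ Finset.range K, ∑ β ∈ Finset.range K, (-1 : ℝ) ^ (α + β) •
        ((pdEnd hU i ^ α) ((pdEnd hU j ^ β) (a (I + α • unit i + β • unit j)))) := by
    rw [neumann, LinearMap.sum_apply, Finset.sum_apply]
    refine Finset.sum_congr rfl fun α _ => ?_
    rw [negRaise_pow_apply, neumann, LinearMap.sum_apply, Finset.sum_apply, map_sum,
      Finset.smul_sum]
    refine Finset.sum_congr rfl fun β _ => ?_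
    rw [negRaise_pow_apply, map_smul, smul_smul, pow_add]
  have hsgn : ∀ (n : ℕ) (y : 𝕜), (-1 : 𝕜) ^ n * y = (-1 : ℝ) ^ n • y := fun n y => by
    rw [Algebra.smul_def, map_pow, map_neg, map_one]
  rw [varDeriv, finsum_congr hterm,
    finsum_eq_finsetSum_of_support_subset (s := Finset.range K ×ˢ Finset.range K),
    Finset.sum_product, hR]
  · have hc : ∀ (s : Finset ℕ) (m : ℕ → smoothFun 𝕜 U),
        (∑ b ∈ s, m b).1 x = ∑ b ∈ s, (m b).1 x := by
      intro s m
      rw [Submodule.coe_sum, Finset.sum_apply]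
    rw [hc]
    refine Finset.sum_congr rfl fun α _ => ?_
    rw [hc]
    refine Finset.sum_congr rfl fun β _ => ?_
    rw [Submodule.coe_smul, Pi.smul_apply]
    exact hsgn _ _
  · intro p hp
    by_contra hn
    refine hp ?_
    have h0 : a (I + p.1 • unit i + p.2 • unit j) = 0 := by
      simp only [Finset.coe_product, Set.mem_prod, Finset.coe_range, Set.mem_Iio, not_and_or,
        not_lt] at hn
      rcases hn with hn | hn
      · refine hK _ i ?_
        simp [unit]; omega
      · refine hK _ j ?_
        simp [unit]; omega
    simp only [h0, map_zero, ZeroMemClass.coe_zero, Pi.zero_apply, mul_zero]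

theorem varDerivLower_jet {f : DiffFun N V 𝕜} (hf : SmoothOn f 𝒟) (h𝒟 : IsOpen 𝒟)
    (hU : IsOpen U) (hφ : ContDiffOn ℝ ∞ φ U) (hjet : ∀ x ∈ U, (x, jet φ x) ∈ 𝒟) {K : ℕ} {v : V}
    (hK : ∀ (I : MultiIdx N) (l : Fin N), K ≤ I l → jetCoeff hf h𝒟 hU hφ hjet v I = 0)
    (i j k : Fin N) (I : MultiIdx N) {x : Pt N} (hx : x ∈ U) :
    varDerivLower i j k I v f x (jet φ x) =
      (lower k (neumann (pdEnd hU) K i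
        (neumann (pdEnd hU) K j (jetCoeff hf h𝒟 hU hφ hjet v))) I).1 x := by
  rw [varDerivLower, lower_apply]
  split_ifs with h
  · rfl
  · exact varDeriv_jet hf h𝒟 hU hφ hjet hK i j _ hx

theorem pdJet_totalD_jet_eq_diffLower {f : DiffFun N V 𝕜} (hf : SmoothOn f 𝒟) (h𝒟 : IsOpen 𝒟)
    (hU : IsOpen U) (hφ : ContDiffOn ℝ ∞ φ U) (hjet : ∀ x ∈ U, (x, jet φ x) ∈ 𝒟) (v : V)
    (I : MultiIdx N) (i : Fin N) {x : Pt N} (hx : x ∈ U) :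
    pdJet I v (totalD i f) x (jet φ x) =
      (diffLower (pdEnd hU) i (jetCoeff hf h𝒟 hU hφ hjet v) I).1 x := by
  rw [pdJet_totalD_jet hf h𝒟 hU hφ hjet I v i hx, diffLower_apply, Submodule.coe_add, Pi.add_apply,
    pdEnd_apply hU i _ hx, pd_eqOn hU (jetCoeff_eqOn hf h𝒟 hU hφ hjet v I) i hx]
  congr 1
  split_ifs
  · rfl
  · exact (jetCoeff_eqOn hf h𝒟 hU hφ hjet v _ hx).symm

variable (L : LagrangianTwoForm N V 𝕜 𝒟)

theorem vertD_dComp (h𝒟 : IsOpen 𝒟) (i j k : Fin N) {x : Pt N} {u : Jet N V} (hx : (x, u) ∈ 𝒟)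
    (w : Jet N V) : vertD (dComp L i j k) x u w = vertD (totalD i (L.comp j k)) x u w +
      vertD (totalD j (L.comp k i)) x u w + vertD (totalD k (L.comp i j)) x u w := by
  have h1 := (L.smooth j k).totalD h𝒟 i
  have h2 := (L.smooth k i).totalD h𝒟 j
  have h3 := (L.smooth i j).totalD h𝒟 k
  rw [dComp, vertD_add (h1.add h2) h3 h𝒟 hx, vertD_add h1 h2 h𝒟 hx]

theorem vertD_totalD_comp_antisymm (h𝒟 : IsOpen 𝒟) (i j k : Fin N) {x : Pt N} {u : Jet N V}
    (hx : (x, u) ∈ 𝒟) (w : Jet N V) :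
    vertD (totalD i (L.comp k j)) x u w = -vertD (totalD i (L.comp j k)) x u w := by
  have h1 := L.smooth j k
  have h2 := L.smooth k j
  have e : ∀ y z, (y, z) ∈ 𝒟 → (totalD i (L.comp k j) + totalD i (L.comp j k)) y z = 0 := by
    intro y z hyz
    have e0 : L.comp k j = -L.comp j k := L.antisymm j k
    have hb : ∀ (I : MultiIdx N) (v : V), pdJet I v (-L.comp j k) y z =
        -pdJet I v (L.comp j k) y z := fun I v => by
      simp [pdJet, deriv.fun_neg]
    have hb' : pdBase i (-L.comp j k) y z = -pdBase i (L.comp j k) y z := by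
      simp [pdBase, deriv.fun_neg]
    show totalD i (L.comp k j) y z + totalD i (L.comp j k) y z = 0
    rw [e0]
    simp only [totalD, hb, hb', finsum_neg_distrib]
    ring
  have := (hasDerivAt_vertD ((h2.totalD h𝒟 i).add (h1.totalD h𝒟 i)) h𝒟 hx w)
  rw [vertD_add (h2.totalD h𝒟 i) (h1.totalD h𝒟 i) h𝒟 hx] at this
  have h0 : (fun t : ℝ => (totalD i (L.comp k j) + totalD i (L.comp j k)) x (u + t • w))
      =ᶠ[𝓝 0] fun _ => 0 := by
    have hc : ContinuousAt (fun t : ℝ => (x, u + t • w)) 0 := by fun_prop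
    filter_upwards [hc.preimage_mem_nhds (h𝒟.mem_nhds (by simpa using hx))] with t ht
    exact e _ _ ht
  have h3 := (this.congr_of_eventuallyEq h0.symm).unique (hasDerivAt_const (0 : ℝ) (0 : 𝕜))
  exact eq_neg_of_add_eq_zero_left h3

/-- Up to sign, the differential of a component of dL is invariant under permutations of its
indices, so increasing triples suffice; a cyclic shift and a transposition generate all the
permutations. -/
theorem deltaDVanishes_iff (h𝒟 : IsOpen 𝒟) (hjet : ∀ x ∈ U, (x, jet φ x) ∈ 𝒟) :
    DeltaDVanishes L U φ ↔ ∀ x ∈ U, ∀ i j k : Fin N, i ≠ j → j ≠ k → k ≠ i → ∀ w : Jet N V,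
      vertD (dComp L i j k) x (jet φ x) w = 0 := by
  refine ⟨fun h x hx => ?_, fun h x hx i j k hij hjk w =>
    h x hx i j k hij.ne hjk.ne (hij.trans hjk).ne' w⟩
  have hcyc : ∀ i j k w, vertD (dComp L i j k) x (jet φ x) w = 0 →
      vertD (dComp L j k i) x (jet φ x) w = 0 := fun i j k w h0 => by
    rw [vertD_dComp L h𝒟 _ _ _ (hjet x hx)] at h0 ⊢
    rw [← h0]; ring
  have hswap : ∀ i j k w, vertD (dComp L i j k) x (jet φ x) w = 0 →
      vertD (dComp L j i k) x (jet φ x) w = 0 := fun i j k w h0 => by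
    rw [vertD_dComp L h𝒟 _ _ _ (hjet x hx)] at h0 ⊢
    rw [vertD_totalD_comp_antisymm L h𝒟 j k i (hjet x hx),
      vertD_totalD_comp_antisymm L h𝒟 i j k (hjet x hx),
      vertD_totalD_comp_antisymm L h𝒟 k i j (hjet x hx), ← neg_eq_zero, ← h0]
    ring
  intro i j k hij hjk hki w
  have h' := fun a b c hab hbc => h x hx a b c hab hbc w
  rcases lt_or_gt_of_ne hij with h1 | h1 <;> rcases lt_or_gt_of_ne hjk with h2 | h2 <;>
    rcases lt_or_gt_of_ne hki with h3 | h3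
  · exact h' _ _ _ h1 h2
  · exact h' _ _ _ h1 h2
  · exact hcyc _ _ _ _ (h' _ _ _ h3 h1)
  · exact hcyc _ _ _ _ (hswap _ _ _ _ (h' _ _ _ h3 h2))
  · exact hcyc _ _ _ _ (hcyc _ _ _ _ (h' _ _ _ h2 h3))
  · exact hswap _ _ _ _ (h' _ _ _ h1 h3)
  · exact hswap _ _ _ _ (hcyc _ _ _ _ (h' _ _ _ h2 h1))
  · exact absurd (h2.trans h1) h3.asymm

theorem deltaDVanishes_iff_multiformEL (h𝒟 : IsOpen 𝒟) (hU : IsOpen U)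
    (hφ : ContDiffOn ℝ ∞ φ U) (hjet : ∀ x ∈ U, (x, jet φ x) ∈ 𝒟) :
    DeltaDVanishes L U φ ↔ MultiformEL L U φ := by
  rw [deltaDVanishes_iff L h𝒟 hjet]
  let co : V → Fin N → Fin N → MultiIdx N → smoothFun 𝕜 U := fun v i j =>
    jetCoeff (L.smooth i j) h𝒟 hU hφ hjet v
  have hb : ∀ i j, ∃ K, ∀ K' ≥ K, ∀ (v : V) (I : MultiIdx N) (l : Fin N), K' ≤ I l →
      co v i j I = 0 := fun i j => exists_jetCoeff_bound (L.smooth i j) h𝒟 hU hφ hjet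
  choose K0 hK0 using hb
  -- One truncation order for all components at once; a sum of natural numbers dominates each
  -- summand.
  let K := ∑ i, ∑ j, K0 i j
  have hK : ∀ K' ≥ K, ∀ i j (v : V) (I : MultiIdx N) (l : Fin N), K' ≤ I l → co v i j I = 0 := by
    intro K' hK' i j
    refine hK0 i j K' (le_trans ?_ hK')
    exact (Finset.single_le_sum (f := fun j => K0 i j) (fun _ _ => Nat.zero_le _)
      (Finset.mem_univ j)).trans (Finset.single_le_sum (f := fun i => ∑ j, K0 i j)
      (fun _ _ => Nat.zero_le _) (Finset.mem_univ i))
  have h1 : ∀ i j k v (I : MultiIdx N) x, x ∈ U → pdJet I v (dComp L i j k) x (jet φ x) =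
      ((diffLower (pdEnd hU) i (co v j k) + diffLower (pdEnd hU) j (co v k i) +
        diffLower (pdEnd hU) k (co v i j)) I).1 x := by
    intro i j k v I x hx
    rw [← vertD_single, vertD_dComp L h𝒟 i j k (hjet x hx), vertD_single, vertD_single,
      vertD_single, pdJet_totalD_jet_eq_diffLower (L.smooth j k) h𝒟 hU hφ hjet v I i hx,
      pdJet_totalD_jet_eq_diffLower (L.smooth k i) h𝒟 hU hφ hjet v I j hx,
      pdJet_totalD_jet_eq_diffLower (L.smooth i j) h𝒟 hU hφ hjet v I k hx]
    rfl
  have h2 : ∀ i j k v (I : MultiIdx N) x, x ∈ U → varDerivLower i j k I v (L.comp i j) x (jet φ x)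
      + varDerivLower j k i I v (L.comp j k) x (jet φ x)
      + varDerivLower k i j I v (L.comp k i) x (jet φ x) =
      ((lower k (neumann (pdEnd hU) (K + 1) i (neumann (pdEnd hU) (K + 1) j (co v i j))) +
        lower i (neumann (pdEnd hU) (K + 1) j (neumann (pdEnd hU) (K + 1) k (co v j k))) +
        lower j (neumann (pdEnd hU) (K + 1) k (neumann (pdEnd hU) (K + 1) i (co v k i)))) I).1 x := by
    intro i j k v I x hx
    rw [varDerivLower_jet (L.smooth i j) h𝒟 hU hφ hjet (hK (K + 1) (by omega) i j v) i j k I hx,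
      varDerivLower_jet (L.smooth j k) h𝒟 hU hφ hjet (hK (K + 1) (by omega) j k v) j k i I hx,
      varDerivLower_jet (L.smooth k i) h𝒟 hU hφ hjet (hK (K + 1) (by omega) k i v) k i j I hx]
    rfl
  have h3 := fun i j k hij hjk hki v => cyclic_closed_iff (D := pdEnd hU (𝕜 := 𝕜))
    (commute_pdEnd hU) (K := K) (i := i) (j := j) (k := k) hij hjk hki (hK K le_rfl j k v)
    (hK K le_rfl k i v) (hK K le_rfl i j v)
  constructor
  · intro h x hx i j k hij hjk hki I v
    rw [h2 i j k v I x hx, (h3 i j k hij hjk hki v).1]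
    · rfl
    · refine funext fun I => smoothFun_eq_zero_iff.2 fun x hx => ?_
      rw [← h1 i j k v I x hx, ← vertD_single]
      exact h x hx i j k hij hjk hki _
  · intro h x hx i j k hij hjk hki w
    rw [vertD]
    refine finsum_eq_zero_of_forall_eq_zero fun I => ?_
    rw [h1 i j k _ I x hx, (h3 i j k hij hjk hki _).2]
    · rfl
    · refine funext fun I' => smoothFun_eq_zero_iff.2 fun x hx => ?_
      rw [← h2 i j k _ I' x hx]
      exact h x hx i j k hij hjk hki I' _

end ClosednessAndEulerLagrange

/-! ### Differentiation under the integral and the fundamental theorem on the square. -/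

section ParametricIntegrals

variable {F : Type*} [NormedAddCommGroup F] [NormedSpace ℝ F]

theorem hasDerivAt_integral_unitInterval {f f' : ℝ → ℝ → F} (hf : Continuous fun p : ℝ × ℝ => f p.1 p.2)
    (hf' : Continuous fun p : ℝ × ℝ => f' p.1 p.2)
    (h : ∀ t s, HasDerivAt (fun t => f t s) (f' t s) t) (t : ℝ) :
    HasDerivAt (fun t => ∫ s in (0 : ℝ)..1, f t s) (∫ s in (0 : ℝ)..1, f' t s) t := by
  obtain ⟨C, hC⟩ := ((isCompact_Icc (a := t - 1) (b := t + 1)).prod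
    (isCompact_Icc (a := (0 : ℝ)) (b := 1))).exists_bound_of_continuousOn hf'.continuousOn
  have hc : ∀ t, Continuous (f t) := fun t => hf.comp (by fun_prop : Continuous fun s => (t, s))
  have hc' : ∀ t, Continuous (f' t) := fun t => hf'.comp (by fun_prop : Continuous fun s => (t, s))
  refine (intervalIntegral.hasDerivAt_integral_of_dominated_loc_of_deriv_le
    (s := Set.Icc (t - 1) (t + 1)) (bound := fun _ => C) (Icc_mem_nhds (by linarith) (by linarith))
    (Filter.Eventually.of_forall fun t => (hc t).aestronglyMeasurable)
    ((hc t).intervalIntegrable _ _) (hc' t).aestronglyMeasurable ?_ (by simp) ?_).2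
  · refine Filter.Eventually.of_forall fun s hs r hr => hC (r, s) ⟨hr, ?_⟩
    rw [Set.uIoc_of_le zero_le_one] at hs
    exact Set.Ioc_subset_Icc_self hs
  · exact Filter.Eventually.of_forall fun s _ r _ => h r s

variable {G : ℝ × ℝ × ℝ → F}

theorem hasDerivAt_comp_fst (hG : ContDiff ℝ ∞ G) (t s u : ℝ) :
    HasDerivAt (fun t => G (t, s, u)) (fderiv ℝ G (t, s, u) (1, 0, 0)) t := by
  have h := (hG.differentiable (by simp) (t, s, u)).hasFDerivAt
  exact h.comp_hasDerivAt t ((hasDerivAt_id t).prodMk (hasDerivAt_const t (s, u)))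

theorem hasDerivAt_comp_snd (hG : ContDiff ℝ ∞ G) (t s u : ℝ) :
    HasDerivAt (fun s => G (t, s, u)) (fderiv ℝ G (t, s, u) (0, 1, 0)) s := by
  have h := (hG.differentiable (by simp) (t, s, u)).hasFDerivAt
  exact h.comp_hasDerivAt s ((hasDerivAt_const s t).prodMk
    ((hasDerivAt_id s).prodMk (hasDerivAt_const s u)))

theorem hasDerivAt_comp_trd (hG : ContDiff ℝ ∞ G) (t s u : ℝ) :
    HasDerivAt (fun u => G (t, s, u)) (fderiv ℝ G (t, s, u) (0, 0, 1)) u := by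
  have h := (hG.differentiable (by simp) (t, s, u)).hasFDerivAt
  exact h.comp_hasDerivAt u ((hasDerivAt_const u t).prodMk
    ((hasDerivAt_const u s).prodMk (hasDerivAt_id u)))

theorem continuous_fderiv_apply_const (hG : ContDiff ℝ ∞ G) (d : ℝ × ℝ × ℝ) :
    Continuous fun p => fderiv ℝ G p d :=
  (hG.continuous_fderiv (by simp)).clm_apply continuous_const

theorem hasDerivAt_integral_unitSquare (hG : ContDiff ℝ ∞ G) (t : ℝ) :
    HasDerivAt (fun t => ∫ s in (0 : ℝ)..1, ∫ u in (0 : ℝ)..1, G (t, s, u))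
      (∫ s in (0 : ℝ)..1, ∫ u in (0 : ℝ)..1, fderiv ℝ G (t, s, u) (1, 0, 0)) t := by
  have hc := continuous_fderiv_apply_const hG (1, 0, 0)
  refine hasDerivAt_integral_unitInterval
    (f := fun t s => ∫ u in (0 : ℝ)..1, G (t, s, u))
    (f' := fun t s => ∫ u in (0 : ℝ)..1, fderiv ℝ G (t, s, u) (1, 0, 0)) ?_ ?_ (fun t s => ?_) t
  · exact intervalIntegral.continuous_parametric_intervalIntegral_of_continuous'
      (f := fun (p : ℝ × ℝ) u => G (p.1, p.2, u))
      (hG.continuous.comp (by fun_prop : Continuous fun q : (ℝ × ℝ) × ℝ => (q.1.1, q.1.2, q.2))) _ _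
  · exact intervalIntegral.continuous_parametric_intervalIntegral_of_continuous'
      (f := fun (p : ℝ × ℝ) u => fderiv ℝ G (p.1, p.2, u) (1, 0, 0))
      (hc.comp (by fun_prop : Continuous fun q : (ℝ × ℝ) × ℝ => (q.1.1, q.1.2, q.2))) _ _
  · exact hasDerivAt_integral_unitInterval
      (f := fun t u => G (t, s, u)) (f' := fun t u => fderiv ℝ G (t, s, u) (1, 0, 0))
      (hG.continuous.comp (by fun_prop : Continuous fun q : ℝ × ℝ => (q.1, s, q.2)))
      (hc.comp (by fun_prop : Continuous fun q : ℝ × ℝ => (q.1, s, q.2)))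
      (fun t u => hasDerivAt_comp_fst hG t s u) t

variable [CompleteSpace F]

theorem integral_fderiv_trd (hG : ContDiff ℝ ∞ G) (t : ℝ) :
    ∫ s in (0 : ℝ)..1, ∫ u in (0 : ℝ)..1, fderiv ℝ G (t, s, u) (0, 0, 1) =
      ∫ s in (0 : ℝ)..1, (G (t, s, 1) - G (t, s, 0)) := by
  refine intervalIntegral.integral_congr fun s _ => ?_
  refine intervalIntegral.integral_eq_sub_of_hasDerivAt
    (fun u _ => hasDerivAt_comp_trd hG t s u) ?_
  exact ((continuous_fderiv_apply_const hG (0, 0, 1)).comp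
    (by fun_prop : Continuous fun u : ℝ => (t, s, u))).intervalIntegrable _ _

theorem integral_fderiv_snd (hG : ContDiff ℝ ∞ G) (t : ℝ) :
    ∫ s in (0 : ℝ)..1, ∫ u in (0 : ℝ)..1, fderiv ℝ G (t, s, u) (0, 1, 0) =
      ∫ u in (0 : ℝ)..1, (G (t, 1, u) - G (t, 0, u)) := by
  have hc := continuous_fderiv_apply_const hG (0, 1, 0)
  rw [MeasureTheory.intervalIntegral_intervalIntegral_swap]
  · refine intervalIntegral.integral_congr fun u _ => ?_
    refine intervalIntegral.integral_eq_sub_of_hasDerivAt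
      (fun s _ => hasDerivAt_comp_snd hG t s u) ?_
    exact (hc.comp (by fun_prop : Continuous fun s : ℝ => (t, s, u))).intervalIntegrable _ _
  · rw [Set.uIoc_of_le zero_le_one]
    have : Continuous (Function.uncurry fun s u : ℝ => fderiv ℝ G (t, s, u) (0, 1, 0)) :=
      hc.comp (by fun_prop : Continuous fun q : ℝ × ℝ => (t, q.1, q.2))
    exact (this.continuousOn.integrableOn_compact
      ((isCompact_Icc (a := (0 : ℝ)) (b := 1)).prod (isCompact_Icc (a := (0 : ℝ)) (b := 1)))).mono_set
      (Set.prod_mono Set.Ioc_subset_Icc_self Set.Ioc_subset_Icc_self)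

end ParametricIntegrals

/-! ### Vector-valued two-forms, exterior derivative and moving squares. -/

section TwoForms

variable {E F : Type*} [NormedAddCommGroup E] [NormedSpace ℝ E] [NormedAddCommGroup F]
  [NormedSpace ℝ F]

/-- The exterior derivative of a two-form given as a family of bilinear maps. -/
def extD (α : E → E →L[ℝ] E →L[ℝ] F) (y a b c : E) : F :=
  fderiv ℝ α y a b c - fderiv ℝ α y b a c + fderiv ℝ α y c a b

/-- The pullback of a two-form along `Φ`, evaluated on constant vectors. -/
def pullback {P : Type*} [NormedAddCommGroup P] [NormedSpace ℝ P] (α : E → E →L[ℝ] E →L[ℝ] F)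
    (Φ : P → E) (a b p : P) : F :=
  α (Φ p) (fderiv ℝ Φ p a) (fderiv ℝ Φ p b)

variable {P : Type*} [NormedAddCommGroup P] [NormedSpace ℝ P] {α : E → E →L[ℝ] E →L[ℝ] F}
  {Φ : P → E}

theorem contDiff_pullback (hα : ContDiff ℝ ∞ α) (hΦ : ContDiff ℝ ∞ Φ) (a b : P) :
    ContDiff ℝ ∞ (pullback α Φ a b) := by
  have h : ∀ d, ContDiff ℝ ∞ fun p => fderiv ℝ Φ p d := fun d =>
    (hΦ.fderiv_right (by simp)).clm_apply contDiff_const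
  exact ((hα.comp hΦ).clm_apply (h a)).clm_apply (h b)

theorem fderiv_pullback (hα : ContDiff ℝ ∞ α) (hΦ : ContDiff ℝ ∞ Φ) (a b c p : P) :
    fderiv ℝ (pullback α Φ b c) p a =
      fderiv ℝ α (Φ p) (fderiv ℝ Φ p a) (fderiv ℝ Φ p b) (fderiv ℝ Φ p c) +
      α (Φ p) (fderiv ℝ (fderiv ℝ Φ) p a b) (fderiv ℝ Φ p c) +
      α (Φ p) (fderiv ℝ Φ p b) (fderiv ℝ (fderiv ℝ Φ) p a c) := by
  have h1 : HasFDerivAt Φ (fderiv ℝ Φ p) p := (hΦ.differentiable (by simp) p).hasFDerivAt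
  have h2 : HasFDerivAt (fderiv ℝ Φ) (fderiv ℝ (fderiv ℝ Φ) p) p :=
    ((hΦ.fderiv_right (m := ∞) (by simp)).differentiable (by simp) p).hasFDerivAt
  have h3 : HasFDerivAt α (fderiv ℝ α (Φ p)) (Φ p) :=
    (hα.differentiable (by simp) (Φ p)).hasFDerivAt
  have h4 : HasFDerivAt (fun q => α (Φ q)) ((fderiv ℝ α (Φ p)).comp (fderiv ℝ Φ p)) p :=
    HasFDerivAt.comp (g := α) p h3 h1
  have h := (h4.clm_apply (h2.clm_apply (hasFDerivAt_const b p))).clm_apply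
    (h2.clm_apply (hasFDerivAt_const c p))
  have h' : HasFDerivAt (pullback α Φ b c) _ p := h
  rw [h'.fderiv]
  simp
  abel

/-- Exterior derivative commutes with pullback, solved for one of the three derivatives: the second
derivatives of `Φ` cancel by their symmetry and the antisymmetry of `α`. -/
theorem fderiv_pullback_eq (hα : ContDiff ℝ ∞ α) (hΦ : ContDiff ℝ ∞ Φ)
    (halt : ∀ y a b, α y a b = -α y b a) (a b c p : P) :
    fderiv ℝ (pullback α Φ b c) p a =
      fderiv ℝ (pullback α Φ a c) p b - fderiv ℝ (pullback α Φ a b) p c +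
        extD α (Φ p) (fderiv ℝ Φ p a) (fderiv ℝ Φ p b) (fderiv ℝ Φ p c) := by
  have hs : IsSymmSndFDerivAt ℝ Φ p :=
    hΦ.contDiffAt.isSymmSndFDerivAt (by simpa using two_le_infty)
  rw [fderiv_pullback hα hΦ, fderiv_pullback hα hΦ, fderiv_pullback hα hΦ, extD, hs.eq b a,
    hs.eq c a, hs.eq c b, halt (Φ p) (fderiv ℝ (fderiv ℝ Φ) p a c)]
  abel

theorem extD_eq_zero_of_basis {N : ℕ} {α : Pt N → Pt N →L[ℝ] Pt N →L[ℝ] F} {y : Pt N}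
    (h : ∀ i j k : Fin N,
      extD α y (Pi.single i 1) (Pi.single j 1) (Pi.single k 1) = 0) (a b c : Pt N) :
    extD α y a b c = 0 := by
  have hsum : ∀ a : Pt N, a = ∑ i, a i • Pi.single i (1 : ℝ) := fun a => by
    funext k
    simp [Finset.sum_apply, Pi.single_apply]
  have hc : ∀ i j, extD α y (Pi.single i 1) (Pi.single j 1) c = 0 := fun i j => by
    have h1 : extD α y (Pi.single i 1) (Pi.single j 1) c =
        ∑ k, c k • extD α y (Pi.single i 1) (Pi.single j 1) (Pi.single k 1) := by
      conv_lhs => rw [hsum c]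
      simp [extD, map_sum, Finset.sum_add_distrib, Finset.sum_sub_distrib, smul_add, smul_sub,
        _root_.sum_apply]
    rw [h1]; simp [h]
  have hb : ∀ i, extD α y (Pi.single i 1) b c = 0 := fun i => by
    have h1 : extD α y (Pi.single i 1) b c =
        ∑ j, b j • extD α y (Pi.single i 1) (Pi.single j 1) c := by
      conv_lhs => rw [hsum b]
      simp [extD, map_sum, Finset.sum_add_distrib, Finset.sum_sub_distrib, smul_add, smul_sub,
        _root_.sum_apply]
    rw [h1]; simp [hc]
  have h1 : extD α y a b c = ∑ i, a i • extD α y (Pi.single i 1) b c := by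
    conv_lhs => rw [hsum a]
    simp [extD, map_sum, Finset.sum_add_distrib, Finset.sum_sub_distrib, smul_add, smul_sub,
        _root_.sum_apply]
  rw [h1]; simp [hb]

/-- The derivative of the integral of a two-form over a moving square: a flux through the solid
swept out, plus a flux through the moving sides. -/
theorem hasDerivAt_integral_pullback [CompleteSpace F] {Φ : ℝ × ℝ × ℝ → E} (hα : ContDiff ℝ ∞ α)
    (hΦ : ContDiff ℝ ∞ Φ) (halt : ∀ y a b, α y a b = -α y b a) (t : ℝ) :
    HasDerivAt (fun t => ∫ s in (0 : ℝ)..1, ∫ u in (0 : ℝ)..1,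
        pullback α Φ (0, 1, 0) (0, 0, 1) (t, s, u))
      ((∫ u in (0 : ℝ)..1, (pullback α Φ (1, 0, 0) (0, 0, 1) (t, 1, u) -
          pullback α Φ (1, 0, 0) (0, 0, 1) (t, 0, u))) -
        (∫ s in (0 : ℝ)..1, (pullback α Φ (1, 0, 0) (0, 1, 0) (t, s, 1) -
          pullback α Φ (1, 0, 0) (0, 1, 0) (t, s, 0))) +
        ∫ s in (0 : ℝ)..1, ∫ u in (0 : ℝ)..1, extD α (Φ (t, s, u))
          (fderiv ℝ Φ (t, s, u) (1, 0, 0)) (fderiv ℝ Φ (t, s, u) (0, 1, 0))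
          (fderiv ℝ Φ (t, s, u) (0, 0, 1))) t := by
  have hp := fun a b => contDiff_pullback hα hΦ a b
  refine (hasDerivAt_integral_unitSquare (hp _ _) t).congr_deriv ?_
  -- The side terms are written back as double integrals of derivatives, so that both sides can be
  -- compared pointwise under the integral.
  rw [← integral_fderiv_snd (hp _ _), ← integral_fderiv_trd (hp _ _)]
  have hd : ∀ d, Continuous fun p => fderiv ℝ Φ p d := fun d =>
    continuous_fderiv_apply_const hΦ d
  have he : Continuous fun p => extD α (Φ p) (fderiv ℝ Φ p (1, 0, 0)) (fderiv ℝ Φ p (0, 1, 0))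
      (fderiv ℝ Φ p (0, 0, 1)) := by
    have hw : Continuous fun p => fderiv ℝ α (Φ p) :=
      (hα.continuous_fderiv (by simp)).comp hΦ.continuous
    exact ((((hw.clm_apply (hd _)).clm_apply (hd _)).clm_apply (hd _)).sub
      (((hw.clm_apply (hd _)).clm_apply (hd _)).clm_apply (hd _))).add
      (((hw.clm_apply (hd _)).clm_apply (hd _)).clm_apply (hd _))
  have hi1 : ∀ {g : ℝ × ℝ × ℝ → F}, Continuous g → ∀ s,
      IntervalIntegrable (fun u => g (t, s, u)) MeasureTheory.volume 0 1 := fun hg s =>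
    (hg.comp (by fun_prop : Continuous fun u : ℝ => (t, s, u))).intervalIntegrable _ _
  have hi2 : ∀ {g : ℝ × ℝ × ℝ → F}, Continuous g →
      IntervalIntegrable (fun s => ∫ u in (0 : ℝ)..1, g (t, s, u)) MeasureTheory.volume 0 1 :=
    fun {g} hg => (intervalIntegral.continuous_parametric_intervalIntegral_of_continuous'
      (f := fun s u => g (t, s, u))
      (hg.comp (by fun_prop : Continuous fun q : ℝ × ℝ => (t, q.1, q.2))) _ _).intervalIntegrable _ _
  have h1 := continuous_fderiv_apply_const (hp (1, 0, 0) (0, 0, 1)) (0, 1, 0)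
  have h2 := continuous_fderiv_apply_const (hp (1, 0, 0) (0, 1, 0)) (0, 0, 1)
  rw [← intervalIntegral.integral_sub (hi2 h1) (hi2 h2),
    ← intervalIntegral.integral_add ((hi2 h1).sub (hi2 h2)) (hi2 he)]
  refine intervalIntegral.integral_congr fun s _ => ?_
  rw [← intervalIntegral.integral_sub (hi1 h1 s) (hi1 h2 s),
    ← intervalIntegral.integral_add ((hi1 h1 s).sub (hi1 h2 s)) (hi1 he s)]
  exact intervalIntegral.integral_congr fun u _ => fderiv_pullback_eq hα hΦ halt _ _ _ _

end TwoForms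

/-! ### Smooth cutoff functions. -/

section Cutoff

variable {E F : Type*} [NormedAddCommGroup E] [NormedSpace ℝ E] [NormedAddCommGroup F]
  [NormedSpace ℝ F]

theorem contDiff_of_contDiffOn_of_eventually_zero {f : E → F} {O : Set E} (hO : IsOpen O)
    (hf : ContDiffOn ℝ ∞ f O) (h : ∀ x ∉ O, f =ᶠ[𝓝 x] 0) : ContDiff ℝ ∞ f := by
  refine contDiff_iff_contDiffAt.2 fun x => ?_
  by_cases hx : x ∈ O
  · exact hf.contDiffAt (hO.mem_nhds hx)
  · exact (contDiffAt_const (c := (0 : F))).congr_of_eventuallyEq (h x hx)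

/-- Both conclusions concern germs: jets at points of `K` must not notice the cutoff, and a product
with a function smooth only on `O` must extend smoothly by zero. -/
theorem exists_cutoff [FiniteDimensional ℝ E] {K O : Set E} (hK : IsClosed K) (hO : IsOpen O)
    (h : K ⊆ O) : ∃ χ : E → ℝ, ContDiff ℝ ∞ χ ∧ (∀ x ∈ K, χ =ᶠ[𝓝 x] 1) ∧
      ∀ x ∉ O, χ =ᶠ[𝓝 x] 0 := by
  obtain ⟨f, h0, h1, -⟩ := exists_contMDiffMap_zero_one_nhds_of_isClosed (n := ⊤)
    (modelWithCornersSelf ℝ E) hO.isClosed_compl hK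
    (Set.disjoint_left.2 fun x hx hxK => hx (h hxK))
  exact ⟨f, contMDiff_iff_contDiff.1 f.contMDiff,
    fun x hx => Filter.eventually_iff.2 ((eventually_nhdsSet_iff_forall.1 h1) x hx),
    fun x hx => Filter.eventually_iff.2 ((eventually_nhdsSet_iff_forall.1 h0) x hx)⟩

theorem contDiff_cutoff_smul {χ : E → ℝ} {f : E → F} {O : Set E} (hO : IsOpen O)
    (hχ : ContDiff ℝ ∞ χ) (hf : ContDiffOn ℝ ∞ f O) (h0 : ∀ x ∉ O, χ =ᶠ[𝓝 x] 0) :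
    ContDiff ℝ ∞ fun x => χ x • f x := by
  refine contDiff_of_contDiffOn_of_eventually_zero hO (hχ.contDiffOn.smul hf) fun x hx => ?_
  filter_upwards [h0 x hx] with y hy
  simp [hy]

end Cutoff

/-! ### The first variation of the action as the integral of a two-form. -/

section VariationForm

variable {N : ℕ} {V 𝕜 : Type*} [NormedAddCommGroup V] [NormedSpace ℝ V] [RCLike 𝕜]
  {𝒟 : Set (Pt N × Jet N V)} {U : Set (Pt N)} {φ η : Pt N → V}

/-- The bilinear form with components `c i j`. -/
def formOf (c : Fin N → Fin N → Pt N → 𝕜) (y : Pt N) : Pt N →L[ℝ] Pt N →L[ℝ] 𝕜 :=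
  ∑ i, ∑ j, (ContinuousLinearMap.proj (R := ℝ) (φ := fun _ : Fin N => ℝ) i).smulRight
    ((ContinuousLinearMap.proj (R := ℝ) (φ := fun _ : Fin N => ℝ) j).smulRight (c i j y))

theorem formOf_apply (c : Fin N → Fin N → Pt N → 𝕜) (y a b : Pt N) :
    formOf c y a b = ∑ i, ∑ j, a i • b j • c i j y := by
  simp [formOf, _root_.sum_apply]

theorem formOf_single (c : Fin N → Fin N → Pt N → 𝕜) (y : Pt N) (i j : Fin N) :
    formOf c y (Pi.single i 1) (Pi.single j 1) = c i j y := by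
  rw [formOf_apply, Finset.sum_eq_single i, Finset.sum_eq_single j]
  · simp
  · intro k _ hk; simp [hk]
  · simp
  · intro k _ hk; simp [hk]
  · simp

theorem contDiff_formOf {c : Fin N → Fin N → Pt N → 𝕜} (hc : ∀ i j, ContDiff ℝ ∞ (c i j)) :
    ContDiff ℝ ∞ (formOf c) := by
  unfold formOf
  refine ContDiff.sum fun i _ => ContDiff.sum fun j _ => ?_
  exact contDiff_const.smulRight (contDiff_const.smulRight (hc i j))

theorem formOf_antisymm {c : Fin N → Fin N → Pt N → 𝕜} (hc : ∀ i j y, c j i y = -c i j y)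
    (y a b : Pt N) : formOf c y a b = -formOf c y b a := by
  rw [formOf_apply, formOf_apply, Finset.sum_comm, ← Finset.sum_neg_distrib]
  refine Finset.sum_congr rfl fun i _ => ?_
  rw [← Finset.sum_neg_distrib]
  refine Finset.sum_congr rfl fun j _ => ?_
  rw [hc i j, smul_neg, smul_neg, smul_comm]

/-- The diagonal vanishes by antisymmetry, and each pair of off-diagonal terms combines into a 2×2
minor. The left side is the shape of the integrand in `patchAction`. -/
theorem sum_Ioi_eq_formOf {c : Fin N → Fin N → Pt N → 𝕜} (hc : ∀ i j y, c j i y = -c i j y)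
    (y a b : Pt N) :
    ∑ i, ∑ j ∈ Finset.Ioi i, (a i * b j - a j * b i) • c i j y = formOf c y a b := by
  have h0 : ∀ i, c i i y = 0 := fun i => self_eq_neg.1 (hc i i y)
  have h1 : ∀ i, ∑ j, a i • b j • c i j y =
      ∑ j ∈ Finset.Ioi i, a i • b j • c i j y + ∑ j ∈ Finset.Iio i, a i • b j • c i j y := fun i => by
    have hu : (Finset.univ : Finset (Fin N)) = insert i (Finset.Ioi i ∪ Finset.Iio i) := by
      ext j
      simp only [Finset.mem_univ, Finset.mem_insert, Finset.mem_union, Finset.mem_Ioi,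
        Finset.mem_Iio, true_iff]
      rcases lt_trichotomy j i with h | h | h <;> simp [h]
    rw [hu, Finset.sum_insert (by simp), h0, smul_zero, smul_zero, zero_add,
      Finset.sum_union]
    exact Finset.disjoint_left.2 fun j hj hj' =>
      absurd (Finset.mem_Ioi.1 hj) (Finset.mem_Iio.1 hj').asymm
  rw [formOf_apply, Finset.sum_congr rfl fun i _ => h1 i, Finset.sum_add_distrib]
  have h2 : ∑ i, ∑ j ∈ Finset.Iio i, a i • b j • c i j y =
      ∑ j, ∑ i ∈ Finset.Ioi j, a i • b j • c i j y :=
    Finset.sum_comm' fun i j => by simp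
  rw [h2, ← Finset.sum_add_distrib]
  refine Finset.sum_congr rfl fun i _ => ?_
  rw [← Finset.sum_add_distrib]
  refine Finset.sum_congr rfl fun j _ => ?_
  rw [hc i j, smul_neg, smul_neg, sub_smul, smul_smul, smul_smul, sub_eq_add_neg]

theorem extD_formOf_single {c : Fin N → Fin N → Pt N → 𝕜} (hc : ∀ i j, ContDiff ℝ ∞ (c i j))
    (hanti : ∀ i j y, c j i y = -c i j y) (y : Pt N) (i j k : Fin N) :
    extD (formOf c) y (Pi.single i 1) (Pi.single j 1) (Pi.single k 1) =
      pd i (c j k) y + pd j (c k i) y + pd k (c i j) y := by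
  have hd : DifferentiableAt ℝ (formOf c) y := (contDiff_formOf hc).differentiable (by simp) y
  have h : ∀ (a : Pt N) (p q : Fin N),
      fderiv ℝ (formOf c) y a (Pi.single p 1) (Pi.single q 1) = fderiv ℝ (c p q) y a := by
    intro a p q
    have h1 : HasFDerivAt (fun z => formOf c z (Pi.single p 1) (Pi.single q 1)) _ y :=
      (hd.hasFDerivAt.clm_apply (hasFDerivAt_const (Pi.single p (1 : ℝ)) y)).clm_apply
        (hasFDerivAt_const (Pi.single q (1 : ℝ)) y)
    simp only [formOf_single] at h1
    have h2 := h1.fderiv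
    have h3 : fderiv ℝ (c p q) y = _ := h2
    rw [h3]
    simp
  have hneg : fderiv ℝ (c i k) y = -fderiv ℝ (c k i) y := by
    have : c i k = -c k i := funext fun z => hanti k i z
    rw [this, fderiv_neg]
  rw [extD, h, h, h, hneg]
  simp [pd]

theorem vertD_neg (f : DiffFun N V 𝕜) (x : Pt N) (u w : Jet N V) :
    vertD (-f) x u w = -vertD f x u w := by
  have hb : ∀ (I : MultiIdx N) (v : V), pdJet I v (-f) x u = -pdJet I v f x u := fun I v => by
    simp [pdJet, deriv.fun_neg]
  simp only [vertD, hb, finsum_neg_distrib]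

/-- The first variation of the Lagrangian form at `φ` in the direction `η`, as a two-form. -/
def varForm (L : LagrangianTwoForm N V 𝕜 𝒟) (φ η : Pt N → V) :
    Pt N → Pt N →L[ℝ] Pt N →L[ℝ] 𝕜 :=
  formOf fun i j y => vertD (L.comp i j) y (jet φ y) (jet η y)

variable (L : LagrangianTwoForm N V 𝕜 𝒟)

theorem vertD_comp_antisymm (i j : Fin N) (y : Pt N) (u w : Jet N V) :
    vertD (L.comp j i) y u w = -vertD (L.comp i j) y u w := by
  rw [L.antisymm, vertD_neg]

theorem varForm_antisymm (y a b : Pt N) : varForm L φ η y a b = -varForm L φ η y b a :=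
  formOf_antisymm (fun i j y => vertD_comp_antisymm L i j y _ _) y a b

/-- Nothing is known of φ off `U`, but there the jet of η vanishes locally, and the vertical
differential of any function in the zero direction is zero. The form is thus global, which later
allows surfaces to be moved out of `U`. -/
theorem contDiff_vertD_comp (h𝒟 : IsOpen 𝒟) (hU : IsOpen U) (hφ : ContDiffOn ℝ ∞ φ U)
    (hjet : ∀ x ∈ U, (x, jet φ x) ∈ 𝒟) (hη : ContDiffOn ℝ ∞ η U)
    (hη0 : ∀ x ∉ U, η =ᶠ[𝓝 x] 0) (i j : Fin N) :
    ContDiff ℝ ∞ fun y => vertD (L.comp i j) y (jet φ y) (jet η y) := by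
  refine contDiff_of_contDiffOn_of_eventually_zero hU
    (contDiffOn_vertD_jet (L.smooth i j) h𝒟 hU hφ hjet hη) fun x hx => ?_
  filter_upwards [(hη0 x hx).eventuallyEq_nhds] with y hy
  rw [jet_congr hy, jet_zero, vertD_zero]
  rfl

theorem contDiff_varForm (h𝒟 : IsOpen 𝒟) (hU : IsOpen U) (hφ : ContDiffOn ℝ ∞ φ U)
    (hjet : ∀ x ∈ U, (x, jet φ x) ∈ 𝒟) (hη : ContDiffOn ℝ ∞ η U)
    (hη0 : ∀ x ∉ U, η =ᶠ[𝓝 x] 0) : ContDiff ℝ ∞ (varForm L φ η) :=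
  contDiff_formOf (contDiff_vertD_comp L h𝒟 hU hφ hjet hη hη0)

theorem extD_varForm_single (h𝒟 : IsOpen 𝒟) (hU : IsOpen U) (hφ : ContDiffOn ℝ ∞ φ U)
    (hjet : ∀ x ∈ U, (x, jet φ x) ∈ 𝒟) (hη : ContDiffOn ℝ ∞ η U)
    (hη0 : ∀ x ∉ U, η =ᶠ[𝓝 x] 0) {y : Pt N} (hy : y ∈ U) (i j k : Fin N) :
    extD (varForm L φ η) y (Pi.single i 1) (Pi.single j 1) (Pi.single k 1) =
      vertD (dComp L i j k) y (jet φ y) (jet η y) := by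
  rw [varForm, extD_formOf_single (contDiff_vertD_comp L h𝒟 hU hφ hjet hη hη0)
    (fun i j y => vertD_comp_antisymm L i j y _ _), vertD_dComp L h𝒟 i j k (hjet y hy),
    vertD_totalD_jet (L.smooth _ _) h𝒟 hU hφ hjet hη i hy,
    vertD_totalD_jet (L.smooth _ _) h𝒟 hU hφ hjet hη j hy,
    vertD_totalD_jet (L.smooth _ _) h𝒟 hU hφ hjet hη k hy]

theorem fderiv_apply_antisymm {E F : Type*} [NormedAddCommGroup E] [NormedSpace ℝ E]
    [NormedAddCommGroup F] [NormedSpace ℝ F] {α : E → E →L[ℝ] E →L[ℝ] F} (hα : ContDiff ℝ ∞ α)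
    (halt : ∀ y a b, α y a b = -α y b a) (y a b c : E) :
    fderiv ℝ α y a b c = -fderiv ℝ α y a c b := by
  have hd : HasFDerivAt α (fderiv ℝ α y) y := (hα.differentiable (by simp) y).hasFDerivAt
  have h : ∀ p q, HasFDerivAt (fun z => α z p q)
      (((fderiv ℝ α y).flip p).flip q) y := fun p q => by
    refine ((hd.clm_apply (hasFDerivAt_const p y)).clm_apply (hasFDerivAt_const q y)).congr_fderiv ?_
    ext; simp
  have h1 := h b c
  have h2 := (h c b).neg
  have e : (fun z => α z b c) = fun z => -α z c b := funext fun z => halt z b c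
  rw [e] at h1
  exact DFunLike.congr_fun (h1.unique h2) a

/-- For ε ≠ 0 the perturbed jets may leave `𝒟`, so the integrand is smooth only on an open set of
parameters. A cutoff equal to 1 near the compact slice ε = 0 makes it globally smooth without
changing the integral for small ε. -/
theorem hasDerivAt_patchAction (h𝒟 : IsOpen 𝒟) (hU : IsOpen U) (hφ : ContDiffOn ℝ ∞ φ U)
    (hjet : ∀ x ∈ U, (x, jet φ x) ∈ 𝒟) (hη : ContDiffOn ℝ ∞ η U) {σ : ℝ × ℝ → Pt N}
    (hσ : ContDiff ℝ ∞ σ)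
    (hσU : ∀ s ∈ Set.Icc (0 : ℝ) 1, ∀ t ∈ Set.Icc (0 : ℝ) 1, σ (s, t) ∈ U) :
    HasDerivAt (fun ε : ℝ => patchAction L (φ + ε • η) σ)
      (∫ s in (0 : ℝ)..1, ∫ t in (0 : ℝ)..1, pullback (varForm L φ η) σ (1, 0) (0, 1) (s, t)) 0 := by
  have hds : ∀ s t i, deriv (fun s' => σ (s', t) i) s = fderiv ℝ σ (s, t) (1, 0) i := by
    intro s t i
    have h1 : HasDerivAt (fun s' => σ (s', t)) (fderiv ℝ σ (s, t) (1, 0)) s :=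
      (hσ.differentiable (by simp) (s, t)).hasFDerivAt.comp_hasDerivAt s
        ((hasDerivAt_id s).prodMk (hasDerivAt_const s t))
    exact (hasDerivAt_pi.1 h1 i).deriv
  have hdt : ∀ s t i, deriv (fun t' => σ (s, t') i) t = fderiv ℝ σ (s, t) (0, 1) i := by
    intro s t i
    have h1 : HasDerivAt (fun t' => σ (s, t')) (fderiv ℝ σ (s, t) (0, 1)) t :=
      (hσ.differentiable (by simp) (s, t)).hasFDerivAt.comp_hasDerivAt t
        ((hasDerivAt_const t s).prodMk (hasDerivAt_id t))
    exact (hasDerivAt_pi.1 h1 i).deriv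
  let jac : Fin N → Fin N → ℝ × ℝ → ℝ := fun i j p =>
    fderiv ℝ σ p (1, 0) i * fderiv ℝ σ p (0, 1) j - fderiv ℝ σ p (1, 0) j * fderiv ℝ σ p (0, 1) i
  have hjac : ∀ i j, ContDiff ℝ ∞ (jac i j) := fun i j => by
    have h : ∀ d k, ContDiff ℝ ∞ fun p => fderiv ℝ σ p d k := fun d k =>
      (contDiff_apply ℝ ℝ k).comp ((hσ.fderiv_right (by simp)).clm_apply contDiff_const)
    exact ((h _ _).mul (h _ _)).sub ((h _ _).mul (h _ _))
  let G : ℝ × ℝ × ℝ → 𝕜 := fun p => ∑ i, ∑ j ∈ Finset.Ioi i, jac i j p.2 •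
    L.comp i j (σ p.2) (jet φ (σ p.2) + p.1 • jet η (σ p.2))
  -- The parameters (ε, s, t) for which the perturbed jet lies in the domain of L.
  let O : Set (ℝ × ℝ × ℝ) := {p | σ p.2 ∈ U} ∩
    (fun p : ℝ × ℝ × ℝ => (σ p.2, jet φ (σ p.2) + p.1 • jet η (σ p.2))) ⁻¹' 𝒟
  have hσ2 : ContDiff ℝ ∞ fun p : ℝ × ℝ × ℝ => σ p.2 := hσ.comp contDiff_snd
  have hO : IsOpen O := by
    refine ContinuousOn.isOpen_inter_preimage ?_ (hU.preimage hσ2.continuous) h𝒟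
    have h1 : ∀ ψ : Pt N → V, ContDiffOn ℝ ∞ ψ U →
        ContinuousOn (fun p : ℝ × ℝ × ℝ => jet ψ (σ p.2)) {p | σ p.2 ∈ U} := fun ψ hψ =>
      (continuousOn_jet hU hψ).comp hσ2.continuous.continuousOn fun p hp => hp
    exact hσ2.continuous.continuousOn.prodMk
      ((h1 φ hφ).add (continuous_fst.continuousOn.smul (h1 η hη)))
  have hG : ContDiffOn ℝ ∞ G O := by
    refine ContDiffOn.sum fun i _ => ContDiffOn.sum fun j _ => ?_
    refine ((hjac i j).comp contDiff_snd).contDiffOn.smul ?_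
    obtain ⟨S, W, F, h⟩ := (L.smooth i j).exists_represents
    have h1 : ∀ (ψ : Pt N → V), ContDiffOn ℝ ∞ ψ U → ∀ I : MultiIdx N,
        ContDiffOn ℝ ∞ (fun p : ℝ × ℝ × ℝ => jet ψ (σ p.2) I) O := fun ψ hψ I =>
      (contDiffOn_pdMulti hU hψ I).comp hσ2.contDiffOn fun p hp => hp.1
    have h2 : ContDiffOn ℝ ∞ (fun p : ℝ × ℝ × ℝ =>
        (σ p.2, restr S (jet φ (σ p.2) + p.1 • jet η (σ p.2)))) O :=
      hσ2.contDiffOn.prodMk (contDiffOn_pi.2 fun I =>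
        (h1 φ hφ I).add (contDiff_fst.contDiffOn.smul (h1 η hη I)))
    exact (h.contDiffOn.comp h2 fun p hp => h.mem hp.2).congr fun p hp => h.eq hp.2
  let K : Set (ℝ × ℝ × ℝ) := {0} ×ˢ (Set.Icc (0 : ℝ) 1 ×ˢ Set.Icc (0 : ℝ) 1)
  have hKO : K ⊆ O := by
    rintro ⟨ε, s, t⟩ ⟨h0, hs, ht⟩
    have h0' : ε = 0 := h0
    subst h0'
    refine ⟨hσU s hs t ht, ?_⟩
    simpa using hjet _ (hσU s hs t ht)
  obtain ⟨χ, hχ, hχ1, hχ0⟩ := exists_cutoff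
    (isClosed_singleton.prod (isClosed_Icc.prod isClosed_Icc)) hO hKO
  have hχG : ContDiff ℝ ∞ fun p => χ p • G p := contDiff_cutoff_smul hO hχ hG hχ0
  have key := hasDerivAt_integral_unitSquare hχG 0
  refine (key.congr_of_eventuallyEq ?_).congr_deriv ?_
  -- Compactness of the square gives one range of ε that works for all (s, t).
  · have hev : ∀ᶠ ε in 𝓝 (0 : ℝ), ∀ q ∈ Set.Icc (0 : ℝ) 1 ×ˢ Set.Icc (0 : ℝ) 1,
        χ (ε, q) = 1 := by
      refine (isCompact_Icc.prod isCompact_Icc).eventually_forall_of_forall_eventually fun q hq => ?_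
      exact hχ1 (0, q) ⟨rfl, hq⟩
    filter_upwards [hev] with ε hε
    refine intervalIntegral.integral_congr fun s hs => intervalIntegral.integral_congr fun t ht => ?_
    rw [Set.uIcc_of_le zero_le_one] at hs ht
    show _ = χ (ε, s, t) • G (ε, s, t)
    rw [hε (s, t) ⟨hs, ht⟩, one_smul]
    simp only [hds, hdt, G, jac, jet_add_smul hU hφ hη ε (hσU s hs t ht)]
  · refine intervalIntegral.integral_congr fun s hs => intervalIntegral.integral_congr fun t ht => ?_
    rw [Set.uIcc_of_le zero_le_one] at hs ht
    have hx := hσU s hs t ht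
    have h1 := hasDerivAt_comp_fst hχG 0 s t
    have h2 : HasDerivAt (fun ε => G (ε, s, t)) (∑ i, ∑ j ∈ Finset.Ioi i, jac i j (s, t) •
        vertD (L.comp i j) (σ (s, t)) (jet φ (σ (s, t))) (jet η (σ (s, t)))) 0 := by
      refine HasDerivAt.fun_sum fun i _ => HasDerivAt.fun_sum fun j _ => ?_
      exact HasDerivAt.fun_const_smul (jac i j (s, t))
        (hasDerivAt_vertD (L.smooth i j) h𝒟 (hjet _ hx) (jet η (σ (s, t))))
    -- The cutoff is locally constant at ε = 0 and contributes nothing to the derivative.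
    have h3 : (fun ε : ℝ => G (ε, s, t)) =ᶠ[𝓝 0] fun ε => χ (ε, s, t) • G (ε, s, t) := by
      have hc : ContinuousAt (fun ε : ℝ => (ε, s, t)) 0 := by fun_prop
      filter_upwards [hc.preimage_mem_nhds (hχ1 (0, s, t) ⟨rfl, hs, ht⟩)] with ε hε
      have : χ (ε, s, t) = 1 := hε
      rw [this, one_smul]
    refine (h1.unique (h2.congr_of_eventuallyEq h3.symm)).trans ?_
    exact sum_Ioi_eq_formOf (fun i j y => vertD_comp_antisymm L i j y (jet φ y) (jet η y)) _ _ _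

end VariationForm

/-! ### Small coordinate spheres detect the exterior derivative. -/

section Spheres

variable {N : ℕ} {V 𝕜 : Type*} [NormedAddCommGroup V] [NormedSpace ℝ V] [RCLike 𝕜]
  {𝒟 : Set (Pt N × Jet N V)} {U : Set (Pt N)} {φ η : Pt N → V}

/-- The exterior derivative is alternating and trilinear, so a change of the three vectors within
their span multiplies it by the determinant. -/
theorem extD_linearCombination {E F : Type*} [NormedAddCommGroup E] [NormedSpace ℝ E]
    [NormedAddCommGroup F] [NormedSpace ℝ F] {α : E → E →L[ℝ] E →L[ℝ] F} (hα : ContDiff ℝ ∞ α)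
    (halt : ∀ y a b, α y a b = -α y b a) (y p q r : E) (a₁ a₂ a₃ b₁ b₂ b₃ c₁ c₂ c₃ : ℝ) :
    extD α y (a₁ • p + a₂ • q + a₃ • r) (b₁ • p + b₂ • q + b₃ • r) (c₁ • p + c₂ • q + c₃ • r) =
      (a₁ * (b₂ * c₃ - b₃ * c₂) - a₂ * (b₁ * c₃ - b₃ * c₁) + a₃ * (b₁ * c₂ - b₂ * c₁)) •
        extD α y p q r := by
  have h := fun a b c => fderiv_apply_antisymm hα halt y a b c
  have h0 : ∀ a b, fderiv ℝ α y a b b = 0 := fun a b => by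
    have h2 : (2 : ℝ) • fderiv ℝ α y a b b = 0 := by
      rw [two_smul]; exact add_eq_zero_iff_eq_neg.2 (h a b b)
    exact (smul_eq_zero.1 h2).resolve_left two_ne_zero
  simp only [extD, map_add, map_smul, _root_.add_apply, _root_.smul_apply, h0, smul_add, smul_zero,
    h _ q p, h _ r p, h _ r q]
  module

/-- The spherical coordinates `(r, s, u)` around a centre. -/
def sphereCoord (i j k : Fin N) (c : Pt N) : ℝ × ℝ × ℝ → Pt N := fun p => spherePatch i j k c p.1 p.2

theorem contDiff_sphereCoord (i j k : Fin N) (c : Pt N) : ContDiff ℝ ∞ (sphereCoord i j k c) := by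
  unfold sphereCoord spherePatch
  fun_prop

theorem contDiff_spherePatch (i j k : Fin N) (c : Pt N) (r : ℝ) :
    ContDiff ℝ ∞ (spherePatch i j k c r) := by
  unfold spherePatch
  fun_prop

theorem fderiv_sphereCoord_fst (i j k : Fin N) (c : Pt N) (r s u : ℝ) :
    fderiv ℝ (sphereCoord i j k c) (r, s, u) (1, 0, 0) =
      (Real.sin (Real.pi * s) * Real.cos (2 * Real.pi * u)) • Pi.single i 1 +
      (Real.sin (Real.pi * s) * Real.sin (2 * Real.pi * u)) • Pi.single j 1 +
      Real.cos (Real.pi * s) • Pi.single k 1 := by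
  refine (hasDerivAt_comp_fst (contDiff_sphereCoord i j k c) r s u).unique ?_
  have hr := hasDerivAt_id r
  have h := (((hr.mul_const (Real.sin (Real.pi * s))).mul_const
    (Real.cos (2 * Real.pi * u))).smul_const (Pi.single i (1 : ℝ) : Pt N)).const_add c
  have h' := h.add (((hr.mul_const (Real.sin (Real.pi * s))).mul_const
    (Real.sin (2 * Real.pi * u))).smul_const (Pi.single j (1 : ℝ) : Pt N))
  have h'' := h'.add ((hr.mul_const (Real.cos (Real.pi * s))).smul_const
    (Pi.single k (1 : ℝ) : Pt N))
  simp only [one_mul] at h''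
  exact h''

theorem fderiv_sphereCoord_snd (i j k : Fin N) (c : Pt N) (r s u : ℝ) :
    fderiv ℝ (sphereCoord i j k c) (r, s, u) (0, 1, 0) =
      (r * (Real.cos (Real.pi * s) * Real.pi) * Real.cos (2 * Real.pi * u)) • Pi.single i 1 +
      (r * (Real.cos (Real.pi * s) * Real.pi) * Real.sin (2 * Real.pi * u)) • Pi.single j 1 +
      (r * (-Real.sin (Real.pi * s) * Real.pi)) • Pi.single k 1 := by
  refine (hasDerivAt_comp_snd (contDiff_sphereCoord i j k c) r s u).unique ?_
  have ha : HasDerivAt (fun s => Real.pi * s) Real.pi s := by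
    simpa using (hasDerivAt_id s).const_mul Real.pi
  have h := (((ha.sin.const_mul r).mul_const
    (Real.cos (2 * Real.pi * u))).smul_const (Pi.single i (1 : ℝ) : Pt N)).const_add c
  have h' := h.add (((ha.sin.const_mul r).mul_const
    (Real.sin (2 * Real.pi * u))).smul_const (Pi.single j (1 : ℝ) : Pt N))
  exact h'.add ((ha.cos.const_mul r).smul_const (Pi.single k (1 : ℝ) : Pt N))

theorem fderiv_sphereCoord_trd (i j k : Fin N) (c : Pt N) (r s u : ℝ) :
    fderiv ℝ (sphereCoord i j k c) (r, s, u) (0, 0, 1) =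
      (r * Real.sin (Real.pi * s) * (-Real.sin (2 * Real.pi * u) * (2 * Real.pi))) •
        Pi.single i 1 +
      (r * Real.sin (Real.pi * s) * (Real.cos (2 * Real.pi * u) * (2 * Real.pi))) •
        Pi.single j 1 + (0 : ℝ) • Pi.single k 1 := by
  refine (hasDerivAt_comp_trd (contDiff_sphereCoord i j k c) r s u).unique ?_
  have ha : HasDerivAt (fun u => 2 * Real.pi * u) (2 * Real.pi) u := by
    simpa using (hasDerivAt_id u).const_mul (2 * Real.pi)
  have h := ((ha.cos.const_mul (r * Real.sin (Real.pi * s))).smul_const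
    (Pi.single i (1 : ℝ) : Pt N)).const_add c
  have h' := h.add ((ha.sin.const_mul (r * Real.sin (Real.pi * s))).smul_const
    (Pi.single j (1 : ℝ) : Pt N))
  have h'' := h'.add (hasDerivAt_const u ((r * Real.cos (Real.pi * s)) • (Pi.single k 1 : Pt N)))
  rw [zero_smul]
  exact h''

theorem integral_sin_pi : ∫ s in (0 : ℝ)..1, Real.sin (Real.pi * s) = 2 / Real.pi := by
  rw [intervalIntegral.integral_comp_mul_left (fun x => Real.sin x) Real.pi_ne_zero]
  simp
  ring

/-- A two-form whose integrals over all small coordinate spheres about `c` vanish is closed at `c`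
in the coordinate directions. -/
theorem extD_eq_zero_of_integral_sphere {F : Type*} [NormedAddCommGroup F] [NormedSpace ℝ F]
    [CompleteSpace F] {α : Pt N → Pt N →L[ℝ] Pt N →L[ℝ] F} (hα : ContDiff ℝ ∞ α)
    (halt : ∀ y a b, α y a b = -α y b a) (i j k : Fin N) (c : Pt N) {r₀ : ℝ} (hr₀ : 0 < r₀)
    (h : ∀ r, 0 < r → r < r₀ → ∫ s in (0 : ℝ)..1, ∫ u in (0 : ℝ)..1,
      pullback α (spherePatch i j k c r) (1, 0) (0, 1) (s, u) = 0) :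
    extD α c (Pi.single i 1) (Pi.single j 1) (Pi.single k 1) = 0 := by
  set Φ := sphereCoord i j k c with hΦdef
  have hΦ : ContDiff ℝ ∞ Φ := contDiff_sphereCoord i j k c
  let f : Pt N → F := fun y => extD α y (Pi.single i 1) (Pi.single j 1) (Pi.single k 1)
  have hf : Continuous f := by
    have hw : ∀ a b d : Pt N, Continuous fun y => fderiv ℝ α y a b d := fun a b d =>
      (((hα.continuous_fderiv (by simp)).clm_apply continuous_const).clm_apply
        continuous_const).clm_apply continuous_const
    exact ((hw _ _ _).sub (hw _ _ _)).add (hw _ _ _)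
  -- The radial derivative of the sphere integral with its factor 2π²r² removed; unlike that
  -- derivative, it carries information at r = 0.
  let g : ℝ → F := fun r => ∫ s in (0 : ℝ)..1, ∫ u in (0 : ℝ)..1,
    Real.sin (Real.pi * s) • f (Φ (r, s, u))
  have hgi : Continuous fun q : (ℝ × ℝ) × ℝ =>
      Real.sin (Real.pi * q.1.2) • f (Φ (q.1.1, q.1.2, q.2)) := by
    have := hf.comp (hΦ.continuous.comp
      (by fun_prop : Continuous fun q : (ℝ × ℝ) × ℝ => (q.1.1, q.1.2, q.2)))
    exact (by fun_prop : Continuous fun q : (ℝ × ℝ) × ℝ => Real.sin (Real.pi * q.1.2)).smul this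
  have hg : Continuous g := by
    refine intervalIntegral.continuous_parametric_intervalIntegral_of_continuous'
      (f := fun r s => ∫ u in (0 : ℝ)..1, Real.sin (Real.pi * s) • f (Φ (r, s, u))) ?_ _ _
    exact intervalIntegral.continuous_parametric_intervalIntegral_of_continuous'
      (f := fun (p : ℝ × ℝ) u => Real.sin (Real.pi * p.2) • f (Φ (p.1, p.2, u))) hgi _ _
  have hpull : ∀ r s u, pullback α Φ (0, 1, 0) (0, 0, 1) (r, s, u) =
      pullback α (spherePatch i j k c r) (1, 0) (0, 1) (s, u) := by
    intro r s u
    have hp : HasFDerivAt (fun q : ℝ × ℝ => Φ (r, q)) _ (s, u) :=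
      (hΦ.differentiable (by simp) (r, s, u)).hasFDerivAt.comp (s, u)
        (hasFDerivAt_prodMk_right r (s, u))
    have hp' : fderiv ℝ (spherePatch i j k c r) (s, u) = _ := hp.fderiv
    simp only [pullback, hp', ContinuousLinearMap.comp_apply, ContinuousLinearMap.inr_apply]
    rfl
  -- The Jacobian of spherical coordinates, with the factors π and 2π from the rescaling to the unit
  -- square.
  have hext : ∀ r s u, extD α (Φ (r, s, u)) (fderiv ℝ Φ (r, s, u) (1, 0, 0))
      (fderiv ℝ Φ (r, s, u) (0, 1, 0)) (fderiv ℝ Φ (r, s, u) (0, 0, 1)) =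
      (2 * Real.pi ^ 2 * r ^ 2) • (Real.sin (Real.pi * s) • f (Φ (r, s, u))) := by
    intro r s u
    rw [hΦdef, fderiv_sphereCoord_fst, fderiv_sphereCoord_snd, fderiv_sphereCoord_trd,
      extD_linearCombination hα halt, smul_smul]
    congr 1
    have h1 := Real.sin_sq_add_cos_sq (Real.pi * s)
    have h2 := Real.sin_sq_add_cos_sq (2 * Real.pi * u)
    generalize Real.sin (Real.pi * s) = A at *
    generalize Real.cos (Real.pi * s) = B at *
    generalize Real.sin (2 * Real.pi * u) = C at *
    generalize Real.cos (2 * Real.pi * u) = D at *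
    have h3 : A ^ 2 = 1 - B ^ 2 := by linarith
    have h4 : C ^ 2 = 1 - D ^ 2 := by linarith
    ring_nf
    have h5 : A ^ 3 = A * (1 - B ^ 2) := by rw [← h3]; ring
    rw [h5, h4]
    ring
  have hg0 : ∀ r ∈ Set.Ioo 0 r₀, g r = 0 := by
    intro r hr
    have hd := hasDerivAt_integral_pullback hα hΦ halt r
    have hz : (fun t => ∫ s in (0 : ℝ)..1, ∫ u in (0 : ℝ)..1,
        pullback α Φ (0, 1, 0) (0, 0, 1) (t, s, u)) =ᶠ[𝓝 r] fun _ => 0 := by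
      filter_upwards [Ioo_mem_nhds hr.1 hr.2] with t ht
      simp only [hpull]
      exact h t ht.1 ht.2
    have h0 := hd.unique ((hasDerivAt_const r (0 : F)).congr_of_eventuallyEq hz)
    -- No flux through the sides of the parameter square: at the poles the longitude derivative
    -- vanishes, and the two meridian sides (`hb2`) cancel by periodicity.
    have hb1 : ∀ s' : ℝ, Real.sin (Real.pi * s') = 0 → ∀ u,
        pullback α Φ (1, 0, 0) (0, 0, 1) (r, s', u) = 0 := by
      intro s' hs' u
      simp only [pullback]
      rw [hΦdef, fderiv_sphereCoord_trd, hs']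
      simp
    have hb2 : ∀ s, pullback α Φ (1, 0, 0) (0, 1, 0) (r, s, 1) =
        pullback α Φ (1, 0, 0) (0, 1, 0) (r, s, 0) := by
      intro s
      have hΦ1 : Φ (r, s, 1) = Φ (r, s, 0) := by simp [hΦdef, sphereCoord, spherePatch]
      simp only [pullback, hΦ1]
      rw [hΦdef]
      simp only [fderiv_sphereCoord_fst, fderiv_sphereCoord_snd]
      simp
    simp only [hb1 1 (by simp), hb1 0 (by simp), hb2, hext, sub_self, zero_add,
      intervalIntegral.integral_zero, intervalIntegral.integral_smul] at h0
    have hne : 2 * Real.pi ^ 2 * r ^ 2 ≠ 0 := by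
      have := Real.pi_pos
      have := hr.1
      positivity
    have := (smul_eq_zero.1 h0).resolve_left hne
    simp only [g, intervalIntegral.integral_smul]
    exact this
  have hg00 : g 0 = 0 := by
    have h1 : Filter.Tendsto g (𝓝[>] 0) (𝓝 (g 0)) := hg.continuousAt.tendsto.mono_left nhdsWithin_le_nhds
    have h2 : Filter.Tendsto g (𝓝[>] 0) (𝓝 0) := by
      refine tendsto_const_nhds.congr' ?_
      filter_upwards [Ioo_mem_nhdsGT hr₀] with r hr using (hg0 r hr).symm
    exact tendsto_nhds_unique h1 h2
  -- At radius zero the integrand is the value at the centre times sin(πs), whose integral 2/π is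
  -- nonzero.
  have hΦ0 : ∀ s u, Φ (0, s, u) = c := fun s u => by simp [hΦdef, sphereCoord, spherePatch]
  simp only [g, hΦ0, intervalIntegral.integral_const, intervalIntegral.integral_smul_const,
    integral_sin_pi, sub_zero, one_smul] at hg00
  exact (smul_eq_zero.1 hg00).resolve_left (by positivity)

theorem spherePatch_mem_ball3 (i j k : Fin N) (c : Pt N) (r : ℝ) (p : ℝ × ℝ) :
    spherePatch i j k c r p ∈ ball3 i j k c r := by
  refine ⟨_, _, _, le_of_eq ?_, rfl⟩
  have h1 := Real.sin_sq_add_cos_sq (Real.pi * p.1)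
  have h2 := Real.sin_sq_add_cos_sq (2 * Real.pi * p.2)
  linear_combination r ^ 2 * Real.sin (Real.pi * p.1) ^ 2 * h2 + r ^ 2 * h1

/-- The coordinate sphere as a closed surface: the meridian sides are glued to each other and the
sides at the poles are folded. -/
def sphereSurface {i j k : Fin N} {c : Pt N} {r : ℝ} (h : ball3 i j k c r ⊆ U) : Surface U where
  faces := 1
  patch _ := spherePatch i j k c r
  smooth _ := contDiff_spherePatch i j k c r
  mem _ _ _ _ _ := h (spherePatch_mem_ball3 i j k c r _)
  free := ∅
  glue e := (e.1, ![2, 1, 0, 3] e.2)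
  glue_invol e := by
    obtain ⟨a, b⟩ := e
    fin_cases b <;> rfl
  glue_free e he := absurd he (Set.notMem_empty e)
  glue_edge e _ t _ := by
    obtain ⟨a, b⟩ := e
    fin_cases b <;> simp [spherePatch, side]

variable (L : LagrangianTwoForm N V 𝕜 𝒟)

theorem stationaryOnSpheres_of_stationaryOnSurfaces (h : StationaryOnSurfaces L U φ) :
    StationaryOnSpheres L U φ := by
  intro i j k _ _ _ c r _ hU η hη
  have := h (sphereSurface hU) η hη fun e he => absurd he (Set.notMem_empty e)
  refine this.congr_of_eventuallyEq (Filter.Eventually.of_forall fun ε => ?_)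
  exact (Fin.sum_univ_one fun f => patchAction L (φ + ε • η) ((sphereSurface hU).patch f)).symm

theorem ball3_subset_closedBall (i j k : Fin N) (c : Pt N) {r : ℝ} (hr : 0 ≤ r) :
    ball3 i j k c r ⊆ Metric.closedBall c (3 * r) := by
  rintro x ⟨a, b, d, h, rfl⟩
  have hn : ∀ (t : ℝ) (l : Fin N), t ^ 2 ≤ r ^ 2 → ‖t • (Pi.single l 1 : Pt N)‖ ≤ r := by
    intro t l ht
    rw [norm_smul, Pi.norm_single, norm_one, mul_one, Real.norm_eq_abs]
    exact abs_le_of_sq_le_sq ht hr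
  have h1 := hn a i (by nlinarith [sq_nonneg b, sq_nonneg d])
  have h2 := hn b j (by nlinarith [sq_nonneg a, sq_nonneg d])
  have h3 := hn d k (by nlinarith [sq_nonneg b, sq_nonneg a])
  rw [Metric.mem_closedBall, dist_eq_norm]
  have : c + a • Pi.single i 1 + b • Pi.single j 1 + d • Pi.single k 1 - c =
      a • (Pi.single i 1 : Pt N) + b • Pi.single j 1 + d • Pi.single k 1 := by abel
  rw [this]
  linarith [norm_add₃_le (a := a • (Pi.single i 1 : Pt N)) (b := b • (Pi.single j 1 : Pt N))
    (c := d • (Pi.single k 1 : Pt N))]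

theorem deltaDVanishes_of_stationaryOnSpheres (h𝒟 : IsOpen 𝒟) (hU : IsOpen U)
    (hφ : ContDiffOn ℝ ∞ φ U) (hjet : ∀ x ∈ U, (x, jet φ x) ∈ 𝒟)
    (h : StationaryOnSpheres L U φ) : DeltaDVanishes L U φ := by
  intro x hx i j k hij hjk w
  rw [vertD]
  refine finsum_eq_zero_of_forall_eq_zero fun I => ?_
  obtain ⟨χ, hχ, hχ1, hχ0⟩ := exists_cutoff (isClosed_singleton (x := x)) hU
    (Set.singleton_subset_iff.2 hx)
  -- Near `x` this is the Taylor monomial, so its jet at `x` isolates the coefficient of δφ_I; the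
  -- cutoff makes it vanish off `U`.
  let η : Pt N → V := fun y => χ y • taylorMono x I (w I) y
  have hη : ContDiff ℝ ∞ η := hχ.smul (contDiff_taylorMono x I (w I))
  have hη0 : ∀ y ∉ U, η =ᶠ[𝓝 y] 0 := fun y hy => by
    filter_upwards [hχ0 y hy] with z hz
    simp [η, hz]
  have hηx : jet η x = Pi.single I (w I) := by
    rw [← jet_taylorMono x I (w I)]
    refine jet_congr ?_
    filter_upwards [hχ1 x rfl] with z hz
    simp [η, hz]
  rw [← vertD_single, ← hηx, ← extD_varForm_single L h𝒟 hU hφ hjet hη.contDiffOn hη0 hx]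
  obtain ⟨δ, hδ, hδU⟩ := Metric.nhds_basis_closedBall.mem_iff.1 (hU.mem_nhds hx)
  -- The bound δ / 3 keeps the solid balls in `U`, as `ball3_subset_closedBall` loses a factor 3 in
  -- the sup norm.
  refine extD_eq_zero_of_integral_sphere (contDiff_varForm L h𝒟 hU hφ hjet hη.contDiffOn hη0)
    (varForm_antisymm L) i j k x (r₀ := δ / 3) (by positivity) fun r hr hr' => ?_
  have hball : ball3 i j k x r ⊆ U := (ball3_subset_closedBall i j k x hr.le).trans
    ((Metric.closedBall_subset_closedBall (by linarith)).trans hδU)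
  exact (hasDerivAt_patchAction L h𝒟 hU hφ hjet hη.contDiffOn (contDiff_spherePatch i j k x r)
    fun s _ t _ => hball (spherePatch_mem_ball3 i j k x r _)).unique
    (h i j k hij.ne hjk.ne (hij.trans hjk).ne' x r hr hball η hη.contDiffOn)

end Spheres

/-! ### Translating a square: the flux through its sides. -/

section Translation

variable {E F : Type*} [NormedAddCommGroup E] [NormedSpace ℝ E] [NormedAddCommGroup F]
  [NormedSpace ℝ F]

/-- The flux of a two-form through the strip swept out by the curve `γ` moving in direction `v`. -/
def stripFlux (α : E → E →L[ℝ] E →L[ℝ] F) (v : E) (t : ℝ) (γ : ℝ → E) : F :=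
  ∫ τ in (0 : ℝ)..1, α (γ τ + t • v) v (deriv γ τ)

theorem stripFlux_reverse {α : E → E →L[ℝ] E →L[ℝ] F} {v : E} {t : ℝ} {γ δ : ℝ → E}
    (h : ∀ τ ∈ Set.Icc (0 : ℝ) 1, δ τ = γ (1 - τ)) :
    stripFlux α v t δ = -stripFlux α v t γ := by
  have h1 : stripFlux α v t δ =
      ∫ τ in (0 : ℝ)..1, -α (γ (1 - τ) + t • v) v (deriv γ (1 - τ)) := by
    -- The curves are related only on [0, 1], which does not determine `deriv` at the endpoints;
    -- these are discarded as a null set.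
    rw [stripFlux, intervalIntegral.integral_of_le zero_le_one,
      intervalIntegral.integral_of_le zero_le_one, MeasureTheory.integral_Ioc_eq_integral_Ioo,
      MeasureTheory.integral_Ioc_eq_integral_Ioo]
    refine MeasureTheory.setIntegral_congr_fun measurableSet_Ioo fun τ hτ => ?_
    have he : δ =ᶠ[𝓝 τ] fun τ => γ (1 - τ) := by
      filter_upwards [Ioo_mem_nhds hτ.1 hτ.2] with y hy using h y ⟨hy.1.le, hy.2.le⟩
    have hd : deriv δ τ = -deriv γ (1 - τ) := by rw [he.deriv_eq, deriv_comp_const_sub]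
    simp only [h τ ⟨hτ.1.le, hτ.2.le⟩, hd, map_neg]
  rw [h1, intervalIntegral.integral_neg,
    intervalIntegral.integral_comp_sub_left (fun x => α (γ x + t • v) v (deriv γ x))]
  simp [stripFlux]

/-- The integral of a two-form over a parametrized square. -/
def squareIntegral (α : E → E →L[ℝ] E →L[ℝ] F) (q : ℝ × ℝ → E) : F :=
  ∫ s in (0 : ℝ)..1, ∫ u in (0 : ℝ)..1, pullback α q (1, 0) (0, 1) (s, u)

/-- Closedness removes the flux through the solid swept out. What remains is carried by the four
sides in their counterclockwise orientation, with sides 2 and 3 acquiring a sign by reversal. -/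
theorem hasDerivAt_squareIntegral_translate [CompleteSpace F] {α : E → E →L[ℝ] E →L[ℝ] F}
    (hα : ContDiff ℝ ∞ α) (halt : ∀ y a b, α y a b = -α y b a)
    (hclosed : ∀ y a b c, extD α y a b c = 0) {q : ℝ × ℝ → E} (hq : ContDiff ℝ ∞ q) (v : E)
    (t : ℝ) :
    HasDerivAt (fun t : ℝ => squareIntegral α fun z => q z + t • v)
      (∑ m, stripFlux α v t fun τ => q (side m τ)) t := by
  obtain ⟨Φ, hΦdef⟩ : ∃ Φ : ℝ × ℝ × ℝ → E, Φ = fun p => q p.2 + p.1 • v := ⟨_, rfl⟩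
  have hΦv : ∀ p, Φ p = q p.2 + p.1 • v := fun p => by rw [hΦdef]
  have hΦ : ContDiff ℝ ∞ Φ := by
    rw [hΦdef]; exact (hq.comp contDiff_snd).add (contDiff_fst.smul contDiff_const)
  have hΦ' : ∀ p d, fderiv ℝ Φ p d = fderiv ℝ q p.2 d.2 + d.1 • v := by
    intro p d
    have h1 : HasFDerivAt (fun p : ℝ × ℝ × ℝ => q p.2) _ p :=
      (hq.differentiable (by simp) p.2).hasFDerivAt.comp p hasFDerivAt_snd
    have h2 : HasFDerivAt (fun p : ℝ × ℝ × ℝ => p.1 • v) _ p :=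
      (hasFDerivAt_fst (𝕜 := ℝ) (p := p)).smul_const v
    have h := h1.fun_add h2
    rw [hΦdef, h.fderiv]
    simp
  have hd := hasDerivAt_integral_pullback hα hΦ halt t
  simp only [hclosed, intervalIntegral.integral_zero, add_zero] at hd
  have hfun : (fun t : ℝ => squareIntegral α fun z => q z + t • v) = fun t =>
      ∫ s in (0 : ℝ)..1, ∫ u in (0 : ℝ)..1, pullback α Φ (0, 1, 0) (0, 0, 1) (t, s, u) := by
    funext t
    simp only [squareIntegral, pullback, hΦ', zero_smul, add_zero, fderiv_add_const, hΦv]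
  rw [hfun]
  refine hd.congr_deriv ?_
  have hqs : ∀ s u, HasDerivAt (fun s => q (s, u)) (fderiv ℝ q (s, u) (1, 0)) s := fun s u =>
    (hq.differentiable (by simp) (s, u)).hasFDerivAt.comp_hasDerivAt s
      ((hasDerivAt_id s).prodMk (hasDerivAt_const s u))
  have hqu : ∀ s u, HasDerivAt (fun u => q (s, u)) (fderiv ℝ q (s, u) (0, 1)) u := fun s u =>
    (hq.differentiable (by simp) (s, u)).hasFDerivAt.comp_hasDerivAt u
      ((hasDerivAt_const u s).prodMk (hasDerivAt_id u))
  have hc : ∀ d, Continuous fun z => fderiv ℝ q z d := fun d =>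
    (hq.continuous_fderiv (by simp)).clm_apply continuous_const
  have hca : ∀ d, Continuous fun z => α (q z + t • v) v (fderiv ℝ q z d) := fun d =>
    ((hα.continuous.comp (hq.continuous.add continuous_const)).clm_apply continuous_const).clm_apply
      (hc d)
  have hi : ∀ (d : ℝ × ℝ) {w : ℝ → ℝ × ℝ}, Continuous w →
      IntervalIntegrable (fun τ => α (q (w τ) + t • v) v (fderiv ℝ q (w τ) d))
        MeasureTheory.volume 0 1 := fun d w hw => ((hca d).comp hw).intervalIntegrable _ _
  have f0 : stripFlux α v t (fun τ => q (side 0 τ)) =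
      ∫ s in (0 : ℝ)..1, α (q (s, 0) + t • v) v (fderiv ℝ q (s, 0) (1, 0)) := by
    simp only [stripFlux, side, fun s => (hqs s 0).deriv]
  have f1 : stripFlux α v t (fun τ => q (side 1 τ)) =
      ∫ u in (0 : ℝ)..1, α (q (1, u) + t • v) v (fderiv ℝ q (1, u) (0, 1)) := by
    simp only [stripFlux, side, fun u => (hqu 1 u).deriv]
  have f2 : stripFlux α v t (fun τ => q (side 2 τ)) =
      -∫ s in (0 : ℝ)..1, α (q (s, 1) + t • v) v (fderiv ℝ q (s, 1) (1, 0)) := by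
    rw [stripFlux_reverse (γ := fun τ => q (τ, 1)) (δ := fun τ => q (side 2 τ)) (fun τ _ => rfl)]
    simp only [stripFlux, fun s => (hqs s 1).deriv]
  have f3 : stripFlux α v t (fun τ => q (side 3 τ)) =
      -∫ u in (0 : ℝ)..1, α (q (0, u) + t • v) v (fderiv ℝ q (0, u) (0, 1)) := by
    rw [stripFlux_reverse (γ := fun τ => q (0, τ)) (δ := fun τ => q (side 3 τ)) (fun τ _ => rfl)]
    simp only [stripFlux, fun u => (hqu 0 u).deriv]
  rw [Fin.sum_univ_four, f0, f1, f2, f3]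
  have hp : ∀ d s u, pullback α Φ (1, 0, 0) (0, d) (t, s, u) =
      α (q (s, u) + t • v) v (fderiv ℝ q (s, u) d) := by
    intro d s u
    have h0 : fderiv ℝ q (s, u) (0, 0) = 0 := map_zero _
    simp [pullback, hΦ', hΦv, h0]
  simp only [hp]
  rw [intervalIntegral.integral_sub (hi (0, 1) (by fun_prop)) (hi (0, 1) (by fun_prop)),
    intervalIntegral.integral_sub (hi (1, 0) (by fun_prop)) (hi (1, 0) (by fun_prop))]
  abel

end Translation

/-! ### Moving a surface off the support of a closed form. -/

section Surfaces

variable {N : ℕ} {U : Set (Pt N)} {F : Type*} [NormedAddCommGroup F] [NormedSpace ℝ F]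

/-- A side of one of the patches of a surface. -/
def Surface.edge (σ : Surface U) (e : Fin σ.faces × Fin 4) (τ : ℝ) : Pt N :=
  σ.patch e.1 (side e.2 τ)

theorem contDiff_side (m : Fin 4) : ContDiff ℝ ∞ (side m) := by
  fin_cases m
  · exact contDiff_id.prodMk contDiff_const
  · exact contDiff_const.prodMk contDiff_id
  · exact (contDiff_const.sub contDiff_id).prodMk contDiff_const
  · exact contDiff_const.prodMk (contDiff_const.sub contDiff_id)

theorem Surface.contDiff_edge (σ : Surface U) (e : Fin σ.faces × Fin 4) :
    ContDiff ℝ ∞ (σ.edge e) :=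
  (σ.smooth e.1).comp (contDiff_side e.2)

/-- Glueing is an involution of the edges that changes the sign of the flux, so the total equals its
own negative. Folded sides need no separate treatment, and on free edges the hypothesis makes the
sign change trivial. -/
theorem Surface.sum_stripFlux_eq_zero (σ : Surface U) {α : Pt N → Pt N →L[ℝ] Pt N →L[ℝ] F}
    {v : Pt N} {t : ℝ} (h : ∀ e ∈ σ.free, stripFlux α v t (σ.edge e) = 0) :
    ∑ e, stripFlux α v t (σ.edge e) = 0 := by
  have hg : ∀ e, stripFlux α v t (σ.edge (σ.glue e)) = -stripFlux α v t (σ.edge e) := by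
    intro e
    by_cases he : e ∈ σ.free
    · rw [σ.glue_free e he, h e he, neg_zero]
    · exact stripFlux_reverse fun τ hτ => σ.glue_edge e he τ hτ
  have h1 : ∑ e, stripFlux α v t (σ.edge (σ.glue e)) = ∑ e, stripFlux α v t (σ.edge e) :=
    Equiv.sum_comp (σ.glue_invol.toPerm) fun e => stripFlux α v t (σ.edge e)
  rw [Finset.sum_congr rfl fun e _ => hg e, Finset.sum_neg_distrib] at h1
  have h2 : (2 : ℝ) • ∑ e, stripFlux α v t (σ.edge e) = 0 := by
    rw [two_smul]; nth_rewrite 1 [← h1]; exact neg_add_cancel _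
  exact (smul_eq_zero.1 h2).resolve_left two_ne_zero

/-- The lines joining `p` to the edges sweep out C¹ images of the plane, of Hausdorff dimension at
most 2. Together with the origin they cannot fill a space of dimension N > 2. -/
theorem Surface.exists_direction (hN : 2 < N) (σ : Surface U) (p : Pt N) :
    ∃ v : Pt N, v ≠ 0 ∧ ∀ e (s τ : ℝ), s • (p - σ.edge e τ) ≠ v := by
  let g : Fin σ.faces × Fin 4 → ℝ × ℝ → Pt N := fun e z => z.1 • (p - σ.edge e z.2)
  have hg : ∀ e, ContDiff ℝ 1 (g e) := fun e =>
    (contDiff_fst.smul (contDiff_const.sub ((σ.contDiff_edge e).comp contDiff_snd))).of_le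
      (by simp)
  have hd : dimH ({0} ∪ ⋃ e, Set.range (g e)) < Module.finrank ℝ (Pt N) := by
    rw [dimH_union, dimH_singleton, dimH_iUnion]
    refine lt_of_le_of_lt (b := (2 : ENNReal)) (max_le (by simp) (iSup_le fun e => ?_)) ?_
    · refine (hg e).dimH_range_le.trans ?_
      simp
    · rw [Module.finrank_fin_fun]
      exact_mod_cast hN
  obtain ⟨v, hv⟩ := (dense_compl_of_dimH_lt_finrank hd).nonempty
  refine ⟨v, fun h0 => hv (Or.inl h0), fun e s τ h => hv (Or.inr ?_)⟩
  exact Set.mem_iUnion.2 ⟨e, (s, τ), h⟩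

/-- A closed two-form supported near a point off the boundary of a surface has vanishing integral
over the surface: translate the surface away in a direction in which its boundary avoids the
support. -/
theorem Surface.exists_ball_sum_squareIntegral_eq_zero [CompleteSpace F] (hN : 2 < N)
    (σ : Surface U) {p : Pt N}
    (hp : ∀ e ∈ σ.free, ∀ τ ∈ Set.Icc (0 : ℝ) 1, σ.edge e τ ≠ p) :
    ∃ r > 0, ∀ α : Pt N → Pt N →L[ℝ] Pt N →L[ℝ] F, ContDiff ℝ ∞ α →
      (∀ y a b, α y a b = -α y b a) → (∀ y a b c, extD α y a b c = 0) →
      (∀ y ∉ Metric.ball p r, α y = 0) → ∑ f, squareIntegral α (σ.patch f) = 0 := by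
  obtain ⟨v, hv0, hv⟩ := σ.exists_direction hN p
  have hK : ∀ f, ∃ R, ∀ z ∈ Set.Icc (0 : ℝ) 1 ×ˢ Set.Icc (0 : ℝ) 1, ‖σ.patch f z - p‖ ≤ R :=
    fun f => (isCompact_Icc.prod isCompact_Icc).exists_bound_of_continuousOn
      ((σ.smooth f).continuous.sub continuous_const).continuousOn
  choose R hR using hK
  obtain ⟨R', hR'0, hR'⟩ : ∃ R', 0 ≤ R' ∧ ∀ f, R f ≤ R' :=
    ⟨∑ f, |R f|, Finset.sum_nonneg fun _ _ => abs_nonneg _, fun f => (le_abs_self _).trans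
      (Finset.single_le_sum (f := fun f => |R f|) (fun _ _ => abs_nonneg _) (Finset.mem_univ f))⟩
  have hvn : 0 < ‖v‖ := norm_pos_iff.2 hv0
  -- All patches lie within R' of `p`, so moving by `T • v`, of length R' + 1, takes every point to
  -- distance at least 1 from `p`.
  set T : ℝ := (R' + 1) / ‖v‖ with hT
  have hT0 : 0 ≤ T := by positivity
  -- The track of the free edges during the motion: compact, and missing `p` at time 0 by hypothesis
  -- and later by the choice of `v`.
  let C : Set (Pt N) := ⋃ e ∈ σ.free, (fun z : ℝ × ℝ => σ.edge e z.1 + z.2 • v) ''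
    (Set.Icc (0 : ℝ) 1 ×ˢ Set.Icc 0 T)
  have hC : IsCompact C := (Set.toFinite _).isCompact_biUnion fun e _ =>
    (isCompact_Icc.prod isCompact_Icc).image (((σ.contDiff_edge e).continuous.comp
      continuous_fst).add (continuous_snd.smul continuous_const))
  have hpC : p ∉ C := by
    intro h
    simp only [C, Set.mem_iUnion] at h
    obtain ⟨e, he, ⟨τ, t⟩, ⟨hτ, ht⟩, h⟩ := h
    dsimp only at hτ ht h
    rcases eq_or_ne t 0 with h0 | h0
    · rw [h0, zero_smul, add_zero] at h
      exact hp e he τ hτ h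
    · refine hv e t⁻¹ τ ?_
      rw [← h, add_sub_cancel_left, smul_smul, inv_mul_cancel₀ h0, one_smul]
  obtain ⟨r, hr, hrC⟩ := Metric.isOpen_iff.1 hC.isClosed.isOpen_compl p hpC
  -- Radius `r` keeps the support clear of the moving free edges; radius 1 keeps it clear of the
  -- whole surface at time `T`.
  refine ⟨min r 1, lt_min hr one_pos, fun α hα halt hclosed hsupp => ?_⟩
  let J : ℝ → F := fun t => ∑ f, squareIntegral α fun z => σ.patch f z + t • v
  have hJ : ∀ t, HasDerivAt J (∑ e, stripFlux α v t (σ.edge e)) t := by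
    intro t
    rw [Fintype.sum_prod_type]
    exact HasDerivAt.fun_sum fun f _ =>
      hasDerivAt_squareIntegral_translate hα halt hclosed (σ.smooth f) v t
  have hJ0 : ∀ t ∈ Set.Ico 0 T, HasDerivWithinAt J 0 (Set.Ici t) t := by
    intro t ht
    refine ((hJ t).congr_deriv (σ.sum_stripFlux_eq_zero fun e he => ?_)).hasDerivWithinAt
    have h0 : ∀ τ ∈ Set.uIcc (0 : ℝ) 1, α (σ.edge e τ + t • v) v (deriv (σ.edge e) τ) = 0 := by
      intro τ hτ
      rw [Set.uIcc_of_le zero_le_one] at hτ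
      rw [hsupp]
      · rfl
      · intro hb
        refine hrC (Metric.ball_subset_ball (min_le_left _ _) hb) ?_
        exact Set.mem_biUnion he ⟨(τ, t), ⟨hτ, ht.1, ht.2.le⟩, rfl⟩
    rw [stripFlux, intervalIntegral.integral_congr h0, intervalIntegral.integral_zero]
  have hconst := constant_of_has_deriv_right_zero
    (fun t _ => (hJ t).continuousAt.continuousWithinAt) hJ0 T ⟨hT0, le_rfl⟩
  have hJT : J T = 0 := by
    refine Finset.sum_eq_zero fun f _ => ?_
    have h0 : ∀ s ∈ Set.uIcc (0 : ℝ) 1, ∀ u ∈ Set.uIcc (0 : ℝ) 1,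
        pullback α (fun z => σ.patch f z + T • v) (1, 0) (0, 1) (s, u) = 0 := by
      intro s hs u hu
      rw [Set.uIcc_of_le zero_le_one] at hs hu
      rw [pullback, hsupp]
      · rfl
      · intro hb
        have h1 := Metric.ball_subset_ball (min_le_right r 1) hb
        rw [Metric.mem_ball, dist_eq_norm] at h1
        have h2 := (hR f (s, u) ⟨hs, hu⟩).trans (hR' f)
        have h3 : ‖T • v‖ = R' + 1 := by
          rw [norm_smul, Real.norm_of_nonneg hT0, hT, div_mul_cancel₀ _ hvn.ne']
        have h4 : T • v = (σ.patch f (s, u) + T • v - p) - (σ.patch f (s, u) - p) := by abel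
        have h5 := norm_sub_le (σ.patch f (s, u) + T • v - p) (σ.patch f (s, u) - p)
        rw [← h4, h3] at h5
        linarith
    rw [squareIntegral, intervalIntegral.integral_congr (g := fun _ => 0),
      intervalIntegral.integral_zero]
    intro s hs
    exact (intervalIntegral.integral_congr (h0 s hs)).trans intervalIntegral.integral_zero
  rw [hJT] at hconst
  simpa [J] using hconst.symm

end Surfaces

/-! ### From closedness to stationarity on surfaces. -/

section Stationarity

variable {N : ℕ} {V 𝕜 : Type*} [NormedAddCommGroup V] [NormedSpace ℝ V] [RCLike 𝕜]
  {𝒟 : Set (Pt N × Jet N V)} {U : Set (Pt N)} {φ η : Pt N → V}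
  (L : LagrangianTwoForm N V 𝕜 𝒟)

theorem varForm_eq_zero {y : Pt N} (h : η =ᶠ[𝓝 y] 0) : varForm L φ η y = 0 := by
  have h0 : ∀ i j, vertD (L.comp i j) y (jet φ y) (jet η y) = 0 := fun i j => by
    rw [jet_congr h, jet_zero, vertD_zero]
  refine ContinuousLinearMap.ext fun a => ContinuousLinearMap.ext fun b => ?_
  rw [varForm, formOf_apply]
  simp [h0]

/-- Closedness is needed on the whole space, since translated surfaces leave `U`; off `U` the form
is locally zero. Triples with repeated indices vanish by antisymmetry, all others by the closedness
hypothesis. -/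
theorem extD_varForm_eq_zero (h𝒟 : IsOpen 𝒟) (hU : IsOpen U) (hφ : ContDiffOn ℝ ∞ φ U)
    (hjet : ∀ x ∈ U, (x, jet φ x) ∈ 𝒟) (hd : DeltaDVanishes L U φ) (hη : ContDiffOn ℝ ∞ η U)
    (hη0 : ∀ x ∉ U, η =ᶠ[𝓝 x] 0) (y a b c : Pt N) : extD (varForm L φ η) y a b c = 0 := by
  have hα := contDiff_varForm L h𝒟 hU hφ hjet hη hη0
  have halt := varForm_antisymm L (φ := φ) (η := η)
  refine extD_eq_zero_of_basis (fun i j k => ?_) a b c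
  by_cases hy : y ∈ U
  · by_cases hd3 : i ≠ j ∧ j ≠ k ∧ k ≠ i
    · rw [extD_varForm_single L h𝒟 hU hφ hjet hη hη0 hy]
      exact (deltaDVanishes_iff L h𝒟 hjet).1 hd y hy i j k hd3.1 hd3.2.1 hd3.2.2 _
    · have h := fun a b c => fderiv_apply_antisymm hα halt y a b c
      have h0 : ∀ a b, fderiv ℝ (varForm L φ η) y a b b = 0 := fun a b =>
        self_eq_neg.1 (h a b b)
      rw [extD]
      by_cases hij : i = j
      · subst hij; rw [h0, sub_self, zero_add]
      by_cases hjk : j = k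
      · subst hjk; rw [h0]; ring
      have hki : k = i := by
        by_contra hki; exact hd3 ⟨hij, hjk, hki⟩
      subst hki
      rw [h0, h _ (Pi.single j 1)]; ring
  · have h0 : varForm L φ η =ᶠ[𝓝 y] fun _ => 0 := by
      filter_upwards [(hη0 y hy).eventuallyEq_nhds] with z hz using varForm_eq_zero L hz
    simp [extD, h0.fderiv_eq]

theorem varForm_eq_sum (h𝒟 : IsOpen 𝒟) (hU : IsOpen U) (hjet : ∀ x ∈ U, (x, jet φ x) ∈ 𝒟)
    {ι : Type*} (s : Finset ι) {ηs : ι → Pt N → V} (hs : ∀ a ∈ s, ContDiffOn ℝ ∞ (ηs a) U)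
    {y : Pt N} (hy : y ∈ U) (h : η =ᶠ[𝓝 y] ∑ a ∈ s, ηs a) :
    varForm L φ η y = ∑ a ∈ s, varForm L φ (ηs a) y := by
  have h0 : ∀ i j, vertD (L.comp i j) y (jet φ y) (jet η y) =
      ∑ a ∈ s, vertD (L.comp i j) y (jet φ y) (jet (ηs a) y) := fun i j => by
    rw [jet_congr h, jet_sum hU s hs hy, vertD_sum (L.smooth i j) h𝒟 (hjet y hy)]
  refine ContinuousLinearMap.ext fun a => ContinuousLinearMap.ext fun b => ?_
  rw [_root_.sum_apply, _root_.sum_apply]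
  simp only [varForm, formOf_apply, h0, Finset.smul_sum]
  rw [Finset.sum_comm]
  have : ∀ f : Fin N → Fin N → ι → 𝕜,
      ∑ j, ∑ i, ∑ a ∈ s, f i j a = ∑ a ∈ s, ∑ i, ∑ j, f i j a := fun f => by
    rw [Finset.sum_comm]
    rw [Finset.sum_congr rfl fun i _ => Finset.sum_comm, Finset.sum_comm]
  exact this _

/-- The sum must be 1 near each point of `K`, not only at it, for jets to add up correctly; the
partition is therefore made subordinate on a slightly larger compact set. -/
theorem exists_partition {K : Set (Pt N)} (hK : IsCompact K) {B : Pt N → Set (Pt N)}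
    (hB : ∀ p ∈ K, IsOpen (B p)) (hp : ∀ p ∈ K, p ∈ B p) :
    ∃ (t : Finset K) (χ : t → Pt N → ℝ), (∀ a, ContDiff ℝ ∞ (χ a)) ∧
      (∀ (a : t), ∀ x ∉ B a, χ a =ᶠ[𝓝 x] 0) ∧ ∀ x ∈ K, ∀ᶠ y in 𝓝 x, ∑ a, χ a y = 1 := by
  obtain ⟨t, ht⟩ := hK.elim_nhds_subcover' (fun p _ => B p)
    fun p h => (hB p h).mem_nhds (hp p h)
  let B' : t → Set (Pt N) := fun a => B a
  have hBo : ∀ a, IsOpen (B' a) := fun a => hB a a.1.2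
  have hcov : K ⊆ ⋃ a, B' a := fun x hx => by
    obtain ⟨a, ha, hxa⟩ := Set.mem_iUnion₂.1 (ht hx)
    exact Set.mem_iUnion.2 ⟨⟨a, ha⟩, hxa⟩
  obtain ⟨K', hK', hKK', hK'B⟩ := exists_compact_between hK (isOpen_iUnion hBo) hcov
  obtain ⟨f, hf⟩ := SmoothPartitionOfUnity.exists_isSubordinate (modelWithCornersSelf ℝ (Pt N))
    hK'.isClosed B' hBo hK'B
  refine ⟨t, fun a => f a, fun a => contMDiff_iff_contDiff.1 (f a).contMDiff, fun a x hx => ?_,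
    fun x hx => ?_⟩
  · exact notMem_tsupport_iff_eventuallyEq.1 fun h => hx (hf a h)
  · filter_upwards [mem_interior_iff_mem_nhds.1 (hKK' hx)] with y hy
    rw [← finsum_eq_sum_of_fintype]
    exact f.sum_eq_one hy

theorem stationaryOnSurfaces_of_deltaDVanishes (hN : 2 < N) (h𝒟 : IsOpen 𝒟) (hU : IsOpen U)
    (hφ : ContDiffOn ℝ ∞ φ U) (hjet : ∀ x ∈ U, (x, jet φ x) ∈ 𝒟) (hd : DeltaDVanishes L U φ) :
    StationaryOnSurfaces L U φ := by
  intro σ η hη hfree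
  have hact : HasDerivAt (fun ε : ℝ => action L (φ + ε • η) σ)
      (∑ f, squareIntegral (varForm L φ η) (σ.patch f)) 0 :=
    HasDerivAt.fun_sum fun f _ => hasDerivAt_patchAction L h𝒟 hU hφ hjet hη (σ.smooth f) (σ.mem f)
  refine hact.congr_deriv ?_
  let Q : Set (ℝ × ℝ) := Set.Icc (0 : ℝ) 1 ×ˢ Set.Icc (0 : ℝ) 1
  let K : Set (Pt N) := ⋃ f, σ.patch f '' Q
  have hK : IsCompact K := isCompact_iUnion fun f =>
    (isCompact_Icc.prod isCompact_Icc).image (σ.smooth f).continuous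
  have hKU : K ⊆ U := by
    refine Set.iUnion_subset fun f => ?_
    rintro _ ⟨⟨s, t⟩, ⟨hs, ht⟩, rfl⟩
    exact σ.mem f s hs t ht
  -- Each point of the surface has a neighbourhood such that every piece of η cut off to it
  -- contributes zero. Either η vanishes near the point, or the point is off the boundary and the
  -- translation argument applies.
  have hloc : ∀ p ∈ K, ∃ B : Set (Pt N), IsOpen B ∧ p ∈ B ∧ B ⊆ U ∧ ∀ χ : Pt N → ℝ,
      ContDiff ℝ ∞ χ → (∀ x ∉ B, χ =ᶠ[𝓝 x] 0) →
      ∑ f, squareIntegral (varForm L φ fun y => χ y • η y) (σ.patch f) = 0 := by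
    intro p hpK
    by_cases hη0 : η =ᶠ[𝓝 p] 0
    · obtain ⟨B, hB, hBo, hpB⟩ := mem_nhds_iff.1 hη0
      refine ⟨B ∩ U, hBo.inter hU, ⟨hpB, hKU hpK⟩, Set.inter_subset_right, fun χ _ hχ => ?_⟩
      have h0 : (fun y => χ y • η y) = 0 := by
        funext y
        by_cases hy : y ∈ B
        · have : η y = 0 := hB hy
          simp [this]
        · have : χ y = 0 := (hχ y fun h => hy h.1).self_of_nhds
          simp [this]
      refine Finset.sum_eq_zero fun f _ => ?_
      rw [h0]
      have : ∀ y, varForm L φ (0 : Pt N → V) y = 0 := fun y =>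
        varForm_eq_zero L Filter.EventuallyEq.rfl
      simp [squareIntegral, pullback, this]
    · have hp : ∀ e ∈ σ.free, ∀ τ ∈ Set.Icc (0 : ℝ) 1, σ.edge e τ ≠ p := fun e he τ hτ h =>
        hη0 (h ▸ hfree e he τ hτ)
      obtain ⟨r, hr, hα⟩ := σ.exists_ball_sum_squareIntegral_eq_zero (F := 𝕜) hN hp
      refine ⟨Metric.ball p r ∩ U, Metric.isOpen_ball.inter hU, ⟨Metric.mem_ball_self hr, hKU hpK⟩,
        Set.inter_subset_right, fun χ hχs hχ => ?_⟩
      have hη1 : ContDiffOn ℝ ∞ (fun y => χ y • η y) U := hχs.contDiffOn.smul hη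
      have hη2 : ∀ x ∉ Metric.ball p r ∩ U, (fun y => χ y • η y) =ᶠ[𝓝 x] 0 := fun x hx => by
        filter_upwards [hχ x hx] with y hy
        simp [hy]
      have hη3 : ∀ x ∉ U, (fun y => χ y • η y) =ᶠ[𝓝 x] 0 := fun x hx => hη2 x fun h => hx h.2
      exact hα _ (contDiff_varForm L h𝒟 hU hφ hjet hη1 hη3) (varForm_antisymm L)
        (extD_varForm_eq_zero L h𝒟 hU hφ hjet hd hη1 hη3)
        fun y hy => varForm_eq_zero L (hη2 y fun h => hy h.1)
  choose! B hBo hpB hBU hB using hloc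
  obtain ⟨t, χ, hχs, hχ0, hχ1⟩ := exists_partition hK hBo hpB
  let ηs : t → Pt N → V := fun a y => χ a y • η y
  have hηs : ∀ a, ContDiffOn ℝ ∞ (ηs a) U := fun a => (hχs a).contDiffOn.smul hη
  have hηs0 : ∀ a, ∀ x ∉ U, ηs a =ᶠ[𝓝 x] 0 := fun a x hx => by
    filter_upwards [hχ0 a x fun h => hx (hBU _ a.1.2 h)] with y hy
    simp [ηs, hy]
  -- The integrals see the form only on the surface, and there it is additive in the pieces of η.
  have hsum : ∀ y ∈ K, varForm L φ η y = ∑ a, varForm L φ (ηs a) y := fun y hy => by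
    refine varForm_eq_sum L h𝒟 hU hjet Finset.univ (fun a _ => hηs a) (hKU hy) ?_
    filter_upwards [hχ1 y hy] with z hz
    simp only [Finset.sum_apply, ηs]
    rw [← Finset.sum_smul, hz, one_smul]
  have hcont : ∀ a f, Continuous (pullback (varForm L φ (ηs a)) (σ.patch f) (1, 0) (0, 1)) :=
    fun a f => (contDiff_pullback (contDiff_varForm L h𝒟 hU hφ hjet (hηs a) (hηs0 a))
      (σ.smooth f) _ _).continuous
  have hsq : ∀ f, squareIntegral (varForm L φ η) (σ.patch f) =
      ∑ a, squareIntegral (varForm L φ (ηs a)) (σ.patch f) := by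
    intro f
    simp only [squareIntegral]
    rw [← intervalIntegral.integral_finsetSum fun a _ =>
      (intervalIntegral.continuous_parametric_intervalIntegral_of_continuous'
        (f := fun s u => pullback (varForm L φ (ηs a)) (σ.patch f) (1, 0) (0, 1) (s, u))
        (hcont a f) _ _).intervalIntegrable _ _]
    refine intervalIntegral.integral_congr fun s hs => ?_
    rw [Set.uIcc_of_le zero_le_one] at hs
    refine Eq.trans ?_ (intervalIntegral.integral_finsetSum fun a _ =>
      ((hcont a f).comp (by fun_prop : Continuous fun u : ℝ => (s, u))).intervalIntegrable _ _)
    refine intervalIntegral.integral_congr fun u hu => ?_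
    rw [Set.uIcc_of_le zero_le_one] at hu
    have hy : σ.patch f (s, u) ∈ K := Set.mem_iUnion.2 ⟨f, (s, u), ⟨hs, hu⟩, rfl⟩
    simp only [pullback, hsum _ hy, _root_.sum_apply]
  rw [Finset.sum_congr rfl fun f _ => hsq f, Finset.sum_comm]
  exact Finset.sum_eq_zero fun a _ => hB a a.1.2 (χ a) (hχs a) (hχ0 a)

end Stationarity

end

end Multiform

theorem theorem1 {N : ℕ} (hN : 2 < N) {V 𝕜 : Type*} [NormedAddCommGroup V] [NormedSpace ℝ V]
    [FiniteDimensional ℝ V] [RCLike 𝕜]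
    (𝒟 : Set (Multiform.Pt N × Multiform.Jet N V)) (h𝒟 : IsOpen 𝒟)
    (L : Multiform.LagrangianTwoForm N V 𝕜 𝒟)
    (U : Set (Multiform.Pt N)) (hU : IsOpen U)
    (φ : Multiform.Pt N → V) (hφ : ContDiffOn ℝ ∞ φ U)
    (hjet : ∀ x ∈ U, (x, Multiform.jet φ x) ∈ 𝒟) :
    List.TFAE
      [Multiform.StationaryOnSurfaces L U φ,
       Multiform.StationaryOnSpheres L U φ,
       Multiform.DeltaDVanishes L U φ,
       Multiform.MultiformEL L U φ] := by
  tfae_have 1 → 2 := Multiform.stationaryOnSpheres_of_stationaryOnSurfaces L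
  tfae_have 2 → 3 := Multiform.deltaDVanishes_of_stationaryOnSpheres L h𝒟 hU hφ hjet
  tfae_have 3 → 1 := Multiform.stationaryOnSurfaces_of_deltaDVanishes L hN h𝒟 hU hφ hjet
  tfae_have 3 ↔ 4 := Multiform.deltaDVanishes_iff_multiformEL L h𝒟 hU hφ hjet
  tfae_finish
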